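/- **Conventions.** All objects depend on a security parameter $\lambda\in\mathbb N$. All finite sets are sets of bit strings of a fixed length, and lengths are computable in time polynomial in $\lambda$ (in unary). A function $\mu$ is negligible, $\mu=\mathrm{negl}(\lambda)$, if $\mu(\lambda)=o(\lambda^{-c})$ for every $c$; where a bound $\mathrm{negl}(\lambda)$ is claimed for all keys (or for all $k,b,x$), one negligible function serves for all of them. Efficient algorithms are polynomial-time uniform circuit families: deterministic poly-time algorithms use the gates NOT, CNOT, Toffoli, PPT algorithms additionally receive uniformly random coins, and QPT algorithms use in addition the gates $H$ and $T$. $\mathcal D_Y$ is the set of probability densities on $Y$, $\operatorname{supp}p=\{y:p(y)>0\}$, $H^2(p,q)=1-\sum_y\sqrt{p(y)q(y)}$, and $u\cdot v$, $\oplus$ are the inner product and the sum modulo 2. **NTCF family.** Let $X\neq\emptyset$, $Y$, $K_F$, $T_F$ be finite sets and $f_{k,b}:X\to\mathcal D_Y$ ($k\in K_F$, $b\in\{0,1\}$). The family $F$ of these functions is an *NTCF family with parameter $c_F\in[0,1]$* if there are: 1. a PPT algorithm $\mathrm{Gen}_F(1^\lambda)$ with output $(k,t_k)\in K_F\times T_F$;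 2. subsets $X_0,X_1\subseteq X$, a set $I_F\subseteq K_F\times T_F$ with $\Pr_{\mathrm{Gen}_F}[(k,t_k)\notin I_F]=\mathrm{negl}(\lambda)$ and a deterministic poly-time $\mathrm{Inv}_F$ such that for all $(k,t_k)\in I_F$: $\mathrm{Inv}_F(t_k,b,y)=x$ whenever $y\in\operatorname{supp}f_{k,b}(x)$; with $R_k=\{(x_0,x_1)\in X^2:f_{k,0}(x_0)=f_{k,1}(x_1)\}$, every $x\in X_0$ has exactly one $x'\in X$ with $(x,x')\in R_k$, and every $x\in X_1$ exactly one $x'\in X$ with $(x',x)\in R_k$; for all sufficiently large $\lambda$ (independently of the keys) $|X_0\cap X_1|/|X|\ge c_F$, and $(x_0,x_1)\in R_k$, $x_b\in X_0\cap X_1$ imply $x_{b\oplus1}\in X_{b\oplus1}$; and membership in $R_k$ can be decided in poly-time from $k,t_k,x_0,x_1$; 3. functions $f'_{k,b}:X\to\mathcal D_Y$ ($k\in K_F$) such that for all $(k,t_k)\in I_F$: $\mathrm{Inv}_F(t_k,b,y)=x$ for all $b$, all $x\in X$ and all $y\in\operatorname{supp}f'_{k,b}(x)$, and $\mathrm{Inv}_F(t_k,b\oplus1,y)=x_{b\oplus1}$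 for all $b$, $(x_0,x_1)\in R_k$ and $y\in\operatorname{supp}f'_{k,b}(x_b)$; a deterministic poly-time $\mathrm{Chk}_F$ with $\mathrm{Chk}_F(k,y,b,x)=1$ iff $y\in\operatorname{supp}f'_{k,b}(x)$, for all $k\in K_F$, $b\in\{0,1\}$, $x\in X$, $y\in Y$; $\mathbb E_{x\in X}H^2(f_{k,b}(x),f'_{k,b}(x))=\mathrm{negl}(\lambda)$ for all $k,b$; and a unitary QPT procedure $\mathrm{Samp}_F$ that maps $|k\rangle|0\rangle|0\rangle|b\rangle$ (with ancillas in state $0$, which it returns to $0$) to $|k\rangle\big(|X|^{-1/2}\sum_{x\in X,y\in Y}\sqrt{f'_{k,b}(x)(y)}\,|x\rangle|y\rangle\big)|b\rangle$ up to an error of negligible norm; 4. (adaptive hardcore bit) a length $w=w(\lambda)$, sets $G_{k,b,x}\subseteq\{0,1\}^w$ with $\Pr_{d\in\{0,1\}^w}[d\notin G_{k,b,x}]=\mathrm{negl}(\lambda)$, membership in which can be decided in poly-time from $k,t_k,b,x,d$ for generated pairs $(k,t_k)$, and a poly-time computable injection $J:X\to\{0,1\}^w$, with poly-time inverse on its range,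 such that for every PPT algorithm $A$ $$\Big|\Pr_{\mathrm{Gen}_F}[A(k)\in H_k]-\Pr_{\mathrm{Gen}_F}[A(k)\in\overline H_k]\Big|=\mathrm{negl}(\lambda),$$ where $H_k=\{(b,x_b,d,d\cdot(J(x_0)\oplus J(x_1))):b\in\{0,1\},(x_0,x_1)\in R_k,\ x_b\in X_b,\ d\in G_{k,0,x_0}\cap G_{k,1,x_1}\}$ and $\overline H_k=\{(b,x,d,c):(b,x,d,c\oplus1)\in H_k\}$. **Trapdoor injective family.** Let $B_G\supseteq\{0,1\}$, $X_G\supseteq X$, $K_G$, $T_G$ be finite sets and $g_{k,b}:X_G\to\mathcal D_Y$ ($k\in K_G$, $b\in B_G$). The family $G$ of these functions is *trapdoor injective* if there are: a PPT algorithm $\mathrm{Gen}_G$ with output $(k,t_k)\in K_G\times T_G$; a set $I_G\subseteq K_G\times T_G$ with $\Pr_{\mathrm{Gen}_G}[(k,t_k)\notin I_G]=\mathrm{negl}(\lambda)$ such that for $(k,t_k)\in I_G$ the supports of $g_{k,b}(x)$ and $g_{k,b'}(x')$ are disjoint for $(b,x)\ne(b',x')$ in $B_G\times X_G$, and a deterministic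 poly-time $\mathrm{Inv}_G$ that, for $(k,t_k)\in I_G$, $y\in Y$, outputs $\mathrm{Inv}_G(t_k,y)\in\{0,1\}\times X$, equal to $(b,x)$ whenever $b\in\{0,1\}$, $x\in X$, $y\in\operatorname{supp}g_{k,b}(x)$; a deterministic poly-time $\mathrm{Chk}_G$ with $\mathrm{Chk}_G(k,y,b,x)=1$ iff $y\in\operatorname{supp}g_{k,b}(x)$ for all $k\in K_G$, $b\in B_G$, $x\in X_G$, $y\in Y$; and a QPT procedure $\mathrm{Samp}_G$ that prepares, for all $k\in K_G$, $b\in B_G$, the state $|X|^{-1/2}\sum_{x\in X,y\in Y}\sqrt{g_{k,b}(x)(y)}\,|x\rangle|y\rangle$, in the same sense as above. **e²NTCF pair.** $(F,G)$ is an *extended extractable NTCF pair with parameter $c_F$* if $F$ is an NTCF family with parameter $c_F$; $G$ is a trapdoor injective family (with the same $X$, $Y$); $F$ is injective invariant with respect to $G$, that is, $\mathrm{Chk}_F=\mathrm{Chk}_G$ and $\mathrm{Samp}_F=\mathrm{Samp}_G$ as algorithms, and the keys generated by $\mathrm{Gen}_F$ and $\mathrm{Gen}_G$ are computationally indistinguishable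 for PPT algorithms; and $G$ is extractable: for every PPT algorithm $A$ that outputs a string $y$ on input of a key $k$, there is a PPT algorithm $A^*$, whose output $(b,x)$ on input of $k$, the coins $r$ of $A$ and $y$ is always in $\{0,1\}\times X$, such that for $(k,t_k)\leftarrow\mathrm{Gen}_G(1^\lambda)$, uniform $r$, $y=A(k,r)$ and $(b,x)\leftarrow A^*(k,r,y)$ $$\Pr\Big[y\notin\operatorname{supp}g_{k,b}(x)\ \wedge\ y\in\bigcup_{b'\in\{0,1\},x'\in X}\operatorname{supp}g_{k,b'}(x')\Big]=\mathrm{negl}(\lambda).$$ **Protocol.** The verifier tosses a fair coin to choose one of two tests. *Equation test*: it samples $(k,t_k)\leftarrow\mathrm{Gen}_F(1^\lambda)$, sends $k$, receives $(y,d,c)$, computes $x_b=\mathrm{Inv}_F(t_k,b,y)$ for $b\in\{0,1\}$, and accepts iff $y\in Y$, $\mathrm{Chk}_F(k,y,0,x_0)=\mathrm{Chk}_F(k,y,1,x_1)=1$, $(x_0,x_1)\in R_k$, $x_0\in X_0$, $x_1\in X_1$, $(J(x_0)\oplus J(x_1))\cdot d=c$ and $d\in G_{k,0,x_0}\cap G_{k,1,x_1}$.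 *Image test*: it samples $(k,t_k)\leftarrow\mathrm{Gen}_G(1^\lambda)$, sends $k$, receives $(y,d,c)$, computes $(b,x)=\mathrm{Inv}_G(t_k,y)$, and accepts iff $y\in Y$ and $\mathrm{Chk}_G(k,y,b,x)=1$. **Theorem.** Let $(F,G)$ be an e²NTCF pair with parameter $c_F$. 1. *(Completeness)* There is a QPT prover that succeeds in the protocol with probability at least $\frac{1+c_F}{2}-\mathrm{negl}(\lambda)$. 2. *(Soundness)* Every PPT prover succeeds in the protocol with probability at most $\frac34+\mathrm{negl}(\lambda)$. -/

import Mathlib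

namespace PoQ

/-- The alphabet in which circuits are written. -/
inductive Sym : Type
  | nameX
  | nameCX
  | nameCCX
  | nameH
  | nameT
  | tick
  | done
  deriving DecidableEq

instance : Fintype Sym where
  elems := {.nameX, .nameCX, .nameCCX, .nameH, .nameT, .tick, .done}
  complete a := by cases a <;> decide

noncomputable section

/-! ## Bit strings, negligible functions, uniform probabilities -/

/-- Bit strings of length `m`. -/
abbrev Bits (m : ℕ) : Type := Fin m → Bool

/-- A bit string as a list of bits. -/
def str {m : ℕ} (x : Bits m) : List Bool := List.ofFn x

/-- The bit `b` as a string of length `m`, padded with zeros. -/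
def padBit (m : ℕ) (b : Bool) : Bits m := fun i => if (i : ℕ) = 0 then b else false

/-- Bitwise exclusive or. -/
def bxor {m : ℕ} (u v : Bits m) : Bits m := fun i => xor (u i) (v i)

/-- The inner product modulo 2. -/
def dot {m : ℕ} (u v : Bits m) : Bool :=
  decide (Odd (Finset.univ.filter fun i => u i = true ∧ v i = true).card)

/-- A function of the security parameter is negligible if it is `o(n ^ (-c))` for all `c`. -/
def Negligible (μ : ℕ → ℝ) : Prop :=
  Asymptotics.SuperpolynomialDecay Filter.atTop (fun n : ℕ => (n : ℝ)) μ

/-- The expectation of `Z` under the uniform distribution on a finite type. -/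
def avg {Ω : Type} [Fintype Ω] (Z : Ω → ℝ) : ℝ := (∑ ω, Z ω) / (Fintype.card Ω : ℝ)

open scoped Classical in
/-- The probability of `E` under the uniform distribution on a finite type. -/
def prob {Ω : Type} [Fintype Ω] (E : Ω → Prop) : ℝ := avg fun ω => if E ω then 1 else 0

/-- The squared Hellinger distance of two densities on a finite set. -/
def hellingerSq {Y : Type} [Fintype Y] (p q : stdSimplex ℝ Y) : ℝ :=
  1 - ∑ y, Real.sqrt ((p : Y → ℝ) y * (q : Y → ℝ) y)

/-! ## Circuits

Circuits act on wires indexed by `ℕ`; a circuit touches finitely many wires, and all wires that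
carry no input start in the state `0`. -/

/-- Elementary gates: NOT, CNOT, Toffoli (the last wire is the target), Hadamard, and the
phase gate `diag (1, exp (i π / 4))`. -/
inductive Gate : Type
  | x (i : ℕ)
  | cx (i j : ℕ)
  | ccx (i j l : ℕ)
  | h (i : ℕ)
  | t (i : ℕ)

/-- The classical gates are NOT, CNOT and Toffoli. -/
def Gate.IsClassical : Gate → Prop
  | .x _ => True
  | .cx _ _ => True
  | .ccx _ _ _ => True
  | .h _ => False
  | .t _ => False

/-- An assignment of bits to the wires. -/
abbrev Wires : Type := ℕ → Bool

/-- The action of a classical gate. A gate whose target is also one of its controls does nothing.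
(The values at the two nonclassical gates are irrelevant.) -/
def Gate.act : Gate → Wires → Wires
  | .x i, s => Function.update s i (!s i)
  | .cx i j, s => if i = j then s else Function.update s j (xor (s j) (s i))
  | .ccx i j l, s =>
      if i = l ∨ j = l then s else Function.update s l (xor (s l) (s i && s j))
  | .h _, s => s
  | .t _, s => s

/-- Pure states of the wires: finite linear combinations of the basis states `s : Wires`. -/
abbrev QState : Type := Wires →₀ ℂ

/-- The basis state of an assignment. -/
def ket (s : Wires) : QState := Finsupp.single s 1

/-- The image of a basis state under a gate. -/
def Gate.onKet : Gate → Wires → QState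
  | .h i, s =>
      Finsupp.single (Function.update s i false) ((1 / Real.sqrt 2 : ℝ) : ℂ) +
        Finsupp.single (Function.update s i true)
          (if s i then -((1 / Real.sqrt 2 : ℝ) : ℂ) else ((1 / Real.sqrt 2 : ℝ) : ℂ))
  | .t i, s =>
      Finsupp.single s (if s i then Complex.exp (Complex.I * (Real.pi / 4 : ℝ)) else 1)
  | .x i, s => ket ((Gate.x i).act s)
  | .cx i j, s => ket ((Gate.cx i j).act s)
  | .ccx i j l, s => ket ((Gate.ccx i j l).act s)

/-- The unitary action of a gate on states. -/
def Gate.apply (g : Gate) : QState →ₗ[ℂ] QState := Finsupp.linearCombination ℂ g.onKet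

/-- Classical evaluation of a circuit (first gate of the list first). -/
def runC (C : List Gate) (s : Wires) : Wires := C.foldl (fun s g => g.act s) s

/-- Quantum evaluation of a circuit (first gate of the list first). -/
def runQ (C : List Gate) (ψ : QState) : QState := C.foldl (fun ψ g => g.apply ψ) ψ

/-- The squared norm of a state. -/
def normSq (ψ : QState) : ℝ := ψ.sum fun _ a => ‖a‖ ^ 2

open scoped Classical in
/-- The probability that a measurement of all wires in the computational basis has its outcome
in `E`. -/
def measureProb (ψ : QState) (E : Wires → Prop) : ℝ :=
  ψ.sum fun s a => if E s then ‖a‖ ^ 2 else 0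

/-- The input `l` on the first wires, zeros on all others. -/
def load (l : List Bool) : Wires := fun i => l.getD i false

/-- The content of the `m` wires `a, ..., a + m - 1`. -/
def slice (s : Wires) (a m : ℕ) : Bits m := fun i => s (a + i)

/-! ## Polynomial-time uniformity and efficient algorithms -/

/-- A wire index in unary. -/
def wireCode (i : ℕ) : List Sym := List.replicate i Sym.tick ++ [Sym.done]

/-- The code of a gate: its name and its wires. -/
def Gate.code : Gate → List Sym
  | .x i => Sym.nameX :: wireCode i
  | .cx i j => Sym.nameCX :: (wireCode i ++ wireCode j)
  | .ccx i j l => Sym.nameCCX :: (wireCode i ++ wireCode j ++ wireCode l)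
  | .h i => Sym.nameH :: wireCode i
  | .t i => Sym.nameT :: wireCode i

/-- The code of a circuit. -/
def circuitCode (C : List Gate) : List Sym := C.flatMap Gate.code

/-- A family of circuits is (polynomial-time) uniform if a Turing machine writes down the circuit
number `n`, on input of `n` in unary, in time polynomial in `n`. -/
def UniformCircuits (C : ℕ → List Gate) : Prop :=
  Nonempty (Turing.TM2ComputableInPolyTime Computability.unaryEncodeNat circuitCode C)

/-- A length function: a function `ℕ → ℕ` that is computable in polynomial time when arguments and
values are written in unary (so it is polynomially bounded). -/
def PolyLength (m : ℕ → ℕ) : Prop :=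
  Nonempty (Turing.TM2ComputableInPolyTime Computability.unaryEncodeNat
    Computability.unaryEncodeNat m)

/-- Deterministic polynomial-time algorithms: uniform families of classical circuits. The circuit
number `n` is run when the security parameter is `n`. -/
structure DetAlg where
  circ : ℕ → List Gate
  uniform : UniformCircuits circ
  classical : ∀ n, ∀ g ∈ circ n, g.IsClassical

/-- The final content of the wires, on the given input. -/
def DetAlg.run (D : DetAlg) (n : ℕ) (input : List Bool) : Wires := runC (D.circ n) (load input)

/-- Probabilistic polynomial-time (PPT) algorithms: uniform families of classical circuits which
receive, after their input, a string of uniformly random coins. -/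
structure PPTAlg extends DetAlg where
  coins : ℕ → ℕ
  coins_length : PolyLength coins

/-- The random coins of a PPT algorithm. -/
abbrev PPTAlg.Coins (A : PPTAlg) (n : ℕ) : Type := Bits (A.coins n)

/-- The final content of the wires, on the given input and coins. -/
def PPTAlg.runWith (A : PPTAlg) (n : ℕ) (input : List Bool) (r : A.Coins n) : Wires :=
  A.toDetAlg.run n (input ++ str r)

/-- Quantum polynomial-time (QPT) algorithms: uniform families of quantum circuits. -/
structure QPTAlg where
  circ : ℕ → List Gate
  uniform : UniformCircuits circ

/-- The final state of the wires, on a given classical input. -/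
def QPTAlg.state (Q : QPTAlg) (n : ℕ) (input : List Bool) : QState :=
  runQ (Q.circ n) (ket (load input))

/-- Computational indistinguishability of two families of distributions on bit strings, the
distributions being given as images of uniform distributions. -/
def CompIndist (m : ℕ → ℕ) {Ω₀ Ω₁ : ℕ → Type} [∀ n, Fintype (Ω₀ n)] [∀ n, Fintype (Ω₁ n)]
    (D₀ : ∀ n, Ω₀ n → Bits (m n)) (D₁ : ∀ n, Ω₁ n → Bits (m n)) : Prop :=
  ∀ A : PPTAlg, Negligible fun n =>
    |prob (fun p : Ω₀ n × A.Coins n => A.runWith n (str (D₀ n p.1)) p.2 0 = false) -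
      prob (fun p : Ω₁ n × A.Coins n => A.runWith n (str (D₁ n p.1)) p.2 0 = false)|

/-! ## Function families -/

/-- What two function families have in common: the domain `X`, the range `Y`, and the length of the
strings that represent keys. All finite sets are sets of bit strings of some length. -/
structure Setting where
  nK : ℕ → ℕ
  nX : ℕ → ℕ
  nY : ℕ → ℕ
  nK_length : PolyLength nK
  nX_length : PolyLength nX
  nY_length : PolyLength nY
  X : ∀ n, Finset (Bits (nX n))
  Y : ∀ n, Finset (Bits (nY n))
  X_nonempty : ∀ n, (X n).Nonempty

/-- The state `|X|^(-1/2) ∑ (p x y)^(1/2) |k⟩ |x⟩ |y⟩ |b⟩`, the sum being over `x ∈ X`, `y ∈ Y`. -/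
def Setting.rangeState (S : Setting) (n : ℕ) (k : Bits (S.nK n)) (b : List Bool)
    (p : S.X n → stdSimplex ℝ (S.Y n)) : QState :=
  ∑ x : S.X n, ∑ y : S.Y n,
    ((Real.sqrt ((p x : S.Y n → ℝ) y) / Real.sqrt ((S.X n).card : ℝ) : ℝ) : ℂ) •
      ket (load (str k ++ str x.1 ++ str y.1 ++ b))

/-- A key generation procedure: a PPT algorithm that outputs an element of `K × T`. -/
structure KeyGen (nK nT : ℕ → ℕ) (K : ∀ n, Finset (Bits (nK n)))
    (T : ∀ n, Finset (Bits (nT n))) where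
  alg : PPTAlg
  key_mem : ∀ n r, slice (alg.runWith n [] r) 0 (nK n) ∈ K n
  trap_mem : ∀ n r, slice (alg.runWith n [] r) (nK n) (nT n) ∈ T n

/-- The generated key. -/
def KeyGen.key {nK nT : ℕ → ℕ} {K : ∀ n, Finset (Bits (nK n))} {T : ∀ n, Finset (Bits (nT n))}
    (gen : KeyGen nK nT K T) (n : ℕ) (r : gen.alg.Coins n) : K n :=
  ⟨slice (gen.alg.runWith n [] r) 0 (nK n), gen.key_mem n r⟩

/-- The generated trapdoor. -/
def KeyGen.trap {nK nT : ℕ → ℕ} {K : ∀ n, Finset (Bits (nK n))} {T : ∀ n, Finset (Bits (nT n))}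
    (gen : KeyGen nK nT K T) (n : ℕ) (r : gen.alg.Coins n) : T n :=
  ⟨slice (gen.alg.runWith n [] r) (nK n) (nT n), gen.trap_mem n r⟩

/-- The objects that make up a noisy trapdoor claw-free family. -/
structure NTCFData (S : Setting) where
  nT : ℕ → ℕ
  nT_length : PolyLength nT
  K : ∀ n, Finset (Bits (S.nK n))
  T : ∀ n, Finset (Bits (nT n))
  /-- the functions of the family -/
  f : ∀ n, K n → Bool → S.X n → stdSimplex ℝ (S.Y n)
  /-- the approximating functions, for which a range superposition is prepared -/
  fr : ∀ n, K n → Bool → S.X n → stdSimplex ℝ (S.Y n)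
  gen : KeyGen S.nK nT K T
  /-- the inversion algorithm, run on `(t, b, y)` -/
  inv : DetAlg
  /-- the check algorithm, run on `(k, y, x, b)` -/
  chk : DetAlg
  /-- the state preparation procedure, run on `(k, 0, 0, b)` -/
  samp : QPTAlg
  /-- the good pairs of a key and a trapdoor -/
  I : ∀ n, Set (K n × T n)
  X₀ : ∀ n, Finset (S.X n)
  X₁ : ∀ n, Finset (S.X n)
  /-- the guaranteed fraction of preimages that lie in claws -/
  c : ℝ
  w : ℕ → ℕ
  w_length : PolyLength w
  /-- the sets of admissible `d` -/
  dset : ∀ n, K n → Bool → S.X n → Finset (Bits (w n))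
  J : ∀ n, S.X n → Bits (w n)

namespace NTCFData

variable {S : Setting}

/-- `Inv (t, b, y)`, as a bit string. -/
def invert (F : NTCFData S) (n : ℕ) (t : F.T n) (b : Bool) (y : Bits (S.nY n)) :
    Bits (S.nX n) :=
  slice (F.inv.run n (str t.1 ++ [b] ++ str y)) 0 (S.nX n)

/-- `Chk (k, y, b, x) = 1`. -/
def Check (F : NTCFData S) (n : ℕ) (k : F.K n) (y : Bits (S.nY n)) (b : Bool)
    (x : Bits (S.nX n)) : Prop :=
  F.chk.run n (str k.1 ++ str y ++ str x ++ [b]) 0 = true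

/-- The relation `R_k` of claws: `x₀` and `x₁` have the same image distribution. -/
def Claw (F : NTCFData S) (n : ℕ) (k : F.K n) (x₀ x₁ : S.X n) : Prop :=
  F.f n k false x₀ = F.f n k true x₁

/-- The set `H_k`. -/
def H (F : NTCFData S) (n : ℕ) (k : F.K n) :
    Set (Bool × Bits (S.nX n) × Bits (F.w n) × Bool) :=
  {p | ∃ x₀ x₁ : S.X n, F.Claw n k x₀ x₁ ∧
    p.2.1 = (if p.1 then x₁.1 else x₀.1) ∧
    (if p.1 then x₁ ∈ F.X₁ n else x₀ ∈ F.X₀ n) ∧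
    p.2.2.1 ∈ F.dset n k false x₀ ∧ p.2.2.1 ∈ F.dset n k true x₁ ∧
    p.2.2.2 = dot p.2.2.1 (bxor (F.J n x₀) (F.J n x₁))}

/-- The set `H_k` with the last bit flipped. -/
def Hbar (F : NTCFData S) (n : ℕ) (k : F.K n) :
    Set (Bool × Bits (S.nX n) × Bits (F.w n) × Bool) :=
  {p | (p.1, p.2.1, p.2.2.1, !p.2.2.2) ∈ F.H n k}

/-- The tuple `(b, x, d, c)` on the first wires. -/
def readAHCB (F : NTCFData S) (n : ℕ) (s : Wires) :
    Bool × Bits (S.nX n) × Bits (F.w n) × Bool :=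
  (s 0, slice s 1 (S.nX n), slice s (1 + S.nX n) (F.w n), s (1 + S.nX n + F.w n))

end NTCFData

/-- Noisy trapdoor claw-free (NTCF) families. -/
structure IsNTCF {S : Setting} (F : NTCFData S) : Prop where
  /-- most pairs of a key and a trapdoor are good -/
  good : Negligible fun n =>
    prob fun r : F.gen.alg.Coins n => (F.gen.key n r, F.gen.trap n r) ∉ F.I n
  /-- trapdoor -/
  invert_f : ∀ n k t, (k, t) ∈ F.I n → ∀ (b : Bool) (x : S.X n) (y : S.Y n),
    0 < (F.f n k b x : S.Y n → ℝ) y → F.invert n t b y.1 = x.1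
  /-- injective pair -/
  pair₀ : ∀ n k t, (k, t) ∈ F.I n → ∀ x ∈ F.X₀ n, ∃! x' : S.X n, F.Claw n k x x'
  pair₁ : ∀ n k t, (k, t) ∈ F.I n → ∀ x ∈ F.X₁ n, ∃! x' : S.X n, F.Claw n k x' x
  c_mem : F.c ∈ Set.Icc (0 : ℝ) 1
  fraction : ∃ N : ℕ, ∀ n > N,
    F.c ≤ ((F.X₀ n ∩ F.X₁ n).card : ℝ) / ((S.X n).card : ℝ) ∧
    ∀ k t, (k, t) ∈ F.I n → ∀ x₀ x₁ : S.X n, F.Claw n k x₀ x₁ →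
      (x₀ ∈ F.X₀ n ∩ F.X₁ n → x₁ ∈ F.X₁ n) ∧ (x₁ ∈ F.X₀ n ∩ F.X₁ n → x₀ ∈ F.X₀ n)
  claw_checkable : ∃ D : DetAlg, ∀ n k t, (k, t) ∈ F.I n → ∀ x₀ x₁ : S.X n,
    D.run n (str k.1 ++ str t.1 ++ str x₀.1 ++ str x₁.1) 0 = true ↔ F.Claw n k x₀ x₁
  /-- efficient range superposition: inversion on the supports of the approximating functions -/
  invert_fr : ∀ n k t, (k, t) ∈ F.I n → ∀ (b : Bool) (x : S.X n) (y : S.Y n),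
    0 < (F.fr n k b x : S.Y n → ℝ) y → F.invert n t b y.1 = x.1
  invert_claw₀ : ∀ n k t, (k, t) ∈ F.I n → ∀ x₀ x₁ : S.X n, F.Claw n k x₀ x₁ → ∀ y : S.Y n,
    0 < (F.fr n k false x₀ : S.Y n → ℝ) y → F.invert n t true y.1 = x₁.1
  invert_claw₁ : ∀ n k t, (k, t) ∈ F.I n → ∀ x₀ x₁ : S.X n, F.Claw n k x₀ x₁ → ∀ y : S.Y n,
    0 < (F.fr n k true x₁ : S.Y n → ℝ) y → F.invert n t false y.1 = x₀.1
  check : ∀ n k (b : Bool) (x : S.X n) (y : S.Y n),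
    F.Check n k y.1 b x.1 ↔ 0 < (F.fr n k b x : S.Y n → ℝ) y
  hellinger : ∃ μ : ℕ → ℝ, Negligible μ ∧ ∀ n k (b : Bool),
    avg (fun x : S.X n => hellingerSq (F.f n k b x) (F.fr n k b x)) ≤ μ n
  /-- the state is prepared by a unitary circuit, up to a negligible error -/
  samp : ∃ μ : ℕ → ℝ, Negligible μ ∧ ∀ n (k : F.K n) (b : Bool),
    normSq (F.samp.state n
        (str k.1 ++ List.replicate (S.nX n) false ++ List.replicate (S.nY n) false ++ [b]) -
      S.rangeState n k.1 [b] (F.fr n k b)) ≤ μ n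
  /-- adaptive hardcore bit property -/
  dset_large : ∃ μ : ℕ → ℝ, Negligible μ ∧ ∀ n (k : F.K n) (b : Bool) (x : S.X n),
    prob (fun d : Bits (F.w n) => d ∉ F.dset n k b x) ≤ μ n
  dset_checkable : ∃ D : DetAlg, ∀ n (r : F.gen.alg.Coins n) (b : Bool) (x : S.X n)
    (d : Bits (F.w n)),
    D.run n (str (F.gen.key n r).1 ++ str (F.gen.trap n r).1 ++ [b] ++ str x.1 ++ str d) 0 = true ↔
      d ∈ F.dset n (F.gen.key n r) b x
  J_injective : ∀ n, Function.Injective (F.J n)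
  J_computable : ∃ D : DetAlg, ∀ n (x : S.X n),
    slice (D.run n (str x.1)) 0 (F.w n) = F.J n x
  J_invertible : ∃ D : DetAlg, ∀ n (x : S.X n),
    slice (D.run n (str (F.J n x))) 0 (S.nX n) = x.1
  ahcb : ∀ A : PPTAlg, Negligible fun n =>
    |prob (fun p : F.gen.alg.Coins n × A.Coins n =>
        F.readAHCB n (A.runWith n (str (F.gen.key n p.1).1) p.2) ∈ F.H n (F.gen.key n p.1)) -
      prob (fun p : F.gen.alg.Coins n × A.Coins n =>
        F.readAHCB n (A.runWith n (str (F.gen.key n p.1).1) p.2) ∈ F.Hbar n (F.gen.key n p.1))|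

/-- The objects that make up a trapdoor injective function family. The bit `b` is identified with
the string `b 0 ... 0` of the set `B`. -/
structure TIFData (S : Setting) where
  nT : ℕ → ℕ
  nT_length : PolyLength nT
  nB : ℕ → ℕ
  nB_length : PolyLength nB
  nB_pos : ∀ n, 0 < nB n
  K : ∀ n, Finset (Bits (S.nK n))
  T : ∀ n, Finset (Bits (nT n))
  B : ∀ n, Finset (Bits (nB n))
  bit_mem : ∀ n b, padBit (nB n) b ∈ B n
  /-- the extended domain -/
  XG : ∀ n, Finset (Bits (S.nX n))
  X_subset : ∀ n, S.X n ⊆ XG n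
  g : ∀ n, K n → B n → XG n → stdSimplex ℝ (S.Y n)
  gen : KeyGen S.nK nT K T
  /-- the inversion algorithm, run on `(t, y)` -/
  inv : DetAlg
  /-- the check algorithm, run on `(k, y, x, b)` -/
  chk : DetAlg
  /-- the state preparation procedure, run on `(k, 0, 0, b)` -/
  samp : QPTAlg
  I : ∀ n, Set (K n × T n)

namespace TIFData

variable {S : Setting}

/-- A bit as an element of `B`. -/
def bit (G : TIFData S) (n : ℕ) (b : Bool) : G.B n := ⟨padBit (G.nB n) b, G.bit_mem n b⟩

/-- An element of `X` as an element of the extended domain. -/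
def incl (G : TIFData S) (n : ℕ) (x : S.X n) : G.XG n := ⟨x.1, G.X_subset n x.2⟩

/-- The bit `b` in `(b, x) = Inv (t, y)`. -/
def invertBit (G : TIFData S) (n : ℕ) (t : G.T n) (y : Bits (S.nY n)) : Bool :=
  G.inv.run n (str t.1 ++ str y) 0

/-- The string `x` in `(b, x) = Inv (t, y)`. -/
def invertStr (G : TIFData S) (n : ℕ) (t : G.T n) (y : Bits (S.nY n)) : Bits (S.nX n) :=
  slice (G.inv.run n (str t.1 ++ str y)) 1 (S.nX n)

/-- `Chk (k, y, b, x) = 1`. -/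
def Check (G : TIFData S) (n : ℕ) (k : G.K n) (y : Bits (S.nY n)) (b : Bits (G.nB n))
    (x : Bits (S.nX n)) : Prop :=
  G.chk.run n (str k.1 ++ str y ++ str x ++ str b) 0 = true

end TIFData

/-- Trapdoor injective function families. -/
structure IsTrapdoorInjective {S : Setting} (G : TIFData S) : Prop where
  good : Negligible fun n =>
    prob fun r : G.gen.alg.Coins n => (G.gen.key n r, G.gen.trap n r) ∉ G.I n
  disjoint : ∀ n k t, (k, t) ∈ G.I n → ∀ (b b' : G.B n) (x x' : G.XG n), (b, x) ≠ (b', x') →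
    ∀ y : S.Y n, ¬ (0 < (G.g n k b x : S.Y n → ℝ) y ∧ 0 < (G.g n k b' x' : S.Y n → ℝ) y)
  invert_mem : ∀ n k t, (k, t) ∈ G.I n → ∀ y ∈ S.Y n, G.invertStr n t y ∈ S.X n
  invert_g : ∀ n k t, (k, t) ∈ G.I n → ∀ (b : Bool) (x : S.X n) (y : S.Y n),
    0 < (G.g n k (G.bit n b) (G.incl n x) : S.Y n → ℝ) y →
      G.invertBit n t y.1 = b ∧ G.invertStr n t y.1 = x.1
  check : ∀ n k (b : G.B n) (x : G.XG n) (y : S.Y n),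
    G.Check n k y.1 b.1 x.1 ↔ 0 < (G.g n k b x : S.Y n → ℝ) y
  samp : ∃ μ : ℕ → ℝ, Negligible μ ∧ ∀ n (k : G.K n) (b : G.B n),
    normSq (G.samp.state n
        (str k.1 ++ List.replicate (S.nX n) false ++ List.replicate (S.nY n) false ++ str b.1) -
      S.rangeState n k.1 (str b.1) (fun x => G.g n k b (G.incl n x))) ≤ μ n

/-- `F` is injective invariant, with `G` as the corresponding trapdoor injective family: the check
and state preparation algorithms are the same, and the keys are indistinguishable. -/
structure InjectiveInvariant {S : Setting} (F : NTCFData S) (G : TIFData S) : Prop where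
  chk_eq : F.chk = G.chk
  samp_eq : F.samp = G.samp
  keys : CompIndist S.nK (fun n (r : F.gen.alg.Coins n) => (F.gen.key n r).1)
    (fun n (r : G.gen.alg.Coins n) => (G.gen.key n r).1)

/-- The extractability property: for every PPT algorithm `A` that outputs a string `y` on input of
a key, there is a PPT extractor that, on input of the key, the coins of `A` and `y`, outputs a bit
`b` and some `x ∈ X`; the probability that `y` lies in the joint support of the functions on
`{0, 1} × X` but not in the support of `g_{k,b}(x)` is negligible. -/
def Extractable {S : Setting} (G : TIFData S) : Prop :=
  ∀ A : PPTAlg, ∃ E : PPTAlg,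
    ∃ hE : ∀ n (k : Bits (S.nK n)) (r : A.Coins n) (y : Bits (S.nY n)) (r' : E.Coins n),
      slice (E.runWith n (str k ++ str r ++ str y) r') 1 (S.nX n) ∈ S.X n,
    Negligible fun n =>
      prob fun p : G.gen.alg.Coins n × A.Coins n × E.Coins n =>
        ∃ y : S.Y n, y.1 = slice (A.runWith n (str (G.gen.key n p.1).1) p.2.1) 0 (S.nY n) ∧
          ¬ 0 < (G.g n (G.gen.key n p.1)
              (G.bit n (E.runWith n (str (G.gen.key n p.1).1 ++ str p.2.1 ++ str y.1) p.2.2 0))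
              (G.incl n ⟨_, hE n (G.gen.key n p.1).1 p.2.1 y.1 p.2.2⟩) : S.Y n → ℝ) y ∧
          ∃ (b' : Bool) (x' : S.X n),
            0 < (G.g n (G.gen.key n p.1) (G.bit n b') (G.incl n x') : S.Y n → ℝ) y

/-- Extended extractable noisy trapdoor claw-free family pairs. -/
structure IsE2NTCF {S : Setting} (F : NTCFData S) (G : TIFData S) : Prop where
  ntcf : IsNTCF F
  tif : IsTrapdoorInjective G
  invariant : InjectiveInvariant F G
  extractable : Extractable G

/-! ## The protocol -/

/-- The messages `(y, d, c)` of the prover. -/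
abbrev Message {S : Setting} (F : NTCFData S) (n : ℕ) : Type :=
  Bits (S.nY n) × Bits (F.w n) × Bool

/-- The message on the first wires. -/
def readMessage {S : Setting} (F : NTCFData S) (n : ℕ) (s : Wires) : Message F n :=
  (slice s 0 (S.nY n), slice s (S.nY n) (F.w n), s (S.nY n + F.w n))

/-- The messages that the verifier accepts in the equation test. -/
def eqTest {S : Setting} (F : NTCFData S) (n : ℕ) (k : F.K n) (t : F.T n) : Set (Message F n) :=
  {m | m.1 ∈ S.Y n ∧ ∃ x₀ x₁ : S.X n,
    F.invert n t false m.1 = x₀.1 ∧ F.invert n t true m.1 = x₁.1 ∧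
    F.Check n k m.1 false x₀.1 ∧ F.Check n k m.1 true x₁.1 ∧
    F.Claw n k x₀ x₁ ∧ x₀ ∈ F.X₀ n ∧ x₁ ∈ F.X₁ n ∧
    dot m.2.1 (bxor (F.J n x₀) (F.J n x₁)) = m.2.2 ∧
    m.2.1 ∈ F.dset n k false x₀ ∧ m.2.1 ∈ F.dset n k true x₁}

/-- The messages that the verifier accepts in the image test. -/
def imTest {S : Setting} (F : NTCFData S) (G : TIFData S) (n : ℕ) (k : G.K n) (t : G.T n) :
    Set (Message F n) :=
  {m | m.1 ∈ S.Y n ∧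
    G.Check n k m.1 (padBit (G.nB n) (G.invertBit n t m.1)) (G.invertStr n t m.1)}

/-- The probability that the verifier accepts, for a prover whose reply to the key `k` lies in the
set `E` with probability `reply k E`: a fair coin decides which test is performed. -/
def acceptProb {S : Setting} (F : NTCFData S) (G : TIFData S) (n : ℕ)
    (reply : Bits (S.nK n) → Set (Message F n) → ℝ) : ℝ :=
  (1 / 2) * avg (fun r : F.gen.alg.Coins n =>
      reply (F.gen.key n r).1 (eqTest F n (F.gen.key n r) (F.gen.trap n r))) +
    (1 / 2) * avg (fun r : G.gen.alg.Coins n =>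
      reply (G.gen.key n r).1 (imTest F G n (G.gen.key n r) (G.gen.trap n r)))

/-- The success probability of a PPT prover. -/
def successPPT {S : Setting} (F : NTCFData S) (G : TIFData S) (A : PPTAlg) (n : ℕ) : ℝ :=
  acceptProb F G n fun k E =>
    prob fun r : A.Coins n => readMessage F n (A.runWith n (str k) r) ∈ E

/-- The success probability of a QPT prover, which measures all its wires at the end. -/
def successQPT {S : Setting} (F : NTCFData S) (G : TIFData S) (P : QPTAlg) (n : ℕ) : ℝ :=
  acceptProb F G n fun k E =>
    measureProb (P.state n (str k)) fun s => readMessage F n s ∈ E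

end

end PoQ

/-! Soundness. Suppose that a prover passes the equation test with probability `p` and the image
test with probability `q`. For a key of `G`, a reply that passes the image test has its `y` in the
support of some `g_{k,b}(x)` with `b` a bit and `x ∈ X`. The extractor, run on the prover's own
coins, therefore finds a pair `(b, x)` that the check algorithm accepts, with probability at least
`q - negl` (`extractOK_of_imTest`). The verdict of the check algorithm is efficiently computed from
`k` alone, and `F` has the same check algorithm, so indistinguishability of the keys carries the
bound over to keys of `F`. There, an accepted pair must be an end of the claw belonging to `y`. If
the prover also passes the equation test, then `(b, x, d, c) ∈ H_k` (`mem_H_of_eqTest`). Since the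
two events have probabilities about `p` and `q`, the tuple lies in `H_k` with probability at least
`p + q - 1 - negl`. For good keys `H_k` and its flipped version are disjoint (`not_mem_H_and_Hbar`),
and the hardcore bit property makes them almost equally likely, so this probability is at most `1/2
+ negl`. Hence `(p + q)/2 ≤ 3/4 + negl`.

Completeness. The prover puts `b` in superposition, prepares the range superposition, replaces `x`
reversibly by `J x`, applies Hadamard gates to `(J x, b)` and measures. Up to the preparation error,
`y` is always an image, so the image test is passed (`measureProb_imTest`). In the equation test,
let `y` have preimages `x₀`, `x₁` forming a claw. The amplitude of `(y, d, c)` is then a sum of two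
terms whose signs agree exactly when `c = d · (J x₀ ⊕ J x₁)` (`le_amplitude_sq`). The probability
collected by a claw is thus essentially the overlap of the two approximating densities divided by
`|X|`. The overlap is close to `1` on average, since both densities are Hellinger-close to the
common density of the claw (`le_sum_sqrt_mul`). Summing over `x₀ ∈ X₀ ∩ X₁` gives about `c_F`
(`le_measureProb_eqTest`).

Uniformity. Both reductions and the prover must be uniform circuit families. Their circuits are
assembled by concatenation, shifting of wires, reversal, and blocks of CNOT or Hadamard gates.
Closure under these operations is obtained from one machine construction, `PolyTime.process`, which
runs two given machines and then a program on four stacks. Reversal makes it possible to uncompute,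
so that subroutine calls (`runC_call`) leave nothing behind but their result. -/

namespace PoQ

open Turing Turing.TM2

/-! ## Programming with stack machines -/

section Routines

/-- A state of which a part can be read and overwritten. -/
structure Lens (σ' σ : Type) where
  get : σ' → σ
  set : σ' → σ → σ'
  get_set : ∀ s v, get (set s v) = v
  set_set : ∀ s v w, set (set s v) w = set s w
  set_get : ∀ s, set s (get s) = s

/-- The lens of the whole state. -/
def Lens.refl (σ : Type) : Lens σ σ := ⟨id, fun _ v => v, fun _ _ => rfl, fun _ _ _ => rfl, fun _ => rfl⟩

variable {K : Type} [DecidableEq K] {Γ : K → Type} {Λ σ : Type}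

/-- `Steps m c t c'`: the machine `m` goes from `c` to `c'` in `t` steps. -/
inductive Steps (m : Λ → Stmt Γ Λ σ) : Cfg Γ Λ σ → ℕ → Cfg Γ Λ σ → Prop
  | refl (c) : Steps m c 0 c
  | head {c c' c'' t} : step m c = some c' → Steps m c' t c'' → Steps m c (t + 1) c''

theorem Steps.trans {m : Λ → Stmt Γ Λ σ} {c c' c'' : Cfg Γ Λ σ} {t t' : ℕ}
    (h : Steps m c t c') (h' : Steps m c' t' c'') : Steps m c (t + t') c'' := by
  induction h with
  | refl c => simpa using h'
  | head h₁ _ ih => rw [Nat.add_right_comm]; exact .head h₁ (ih h')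

/-- The interface of `TM2OutputsInTime` uses iterates of the partial step function, whereas
composing runs is easier with an inductive relation. A run that halts too early cannot hide in an
iterate, because `none` is a fixed point. -/
theorem steps_iff_iterate {m : Λ → Stmt Γ Λ σ} {c c' : Cfg Γ Λ σ} {t : ℕ} :
    Steps m c t c' ↔ (flip bind (step m))^[t] (some c) = some c' := by
  constructor
  · intro h
    induction h with
    | refl c => rfl
    | head h₁ _ ih =>
      rw [Function.iterate_succ_apply, ← ih]
      congr 1
  · induction t generalizing c with
    | zero => intro h; cases h; exact .refl _
    | succ t ih =>
      intro h
      rw [Function.iterate_succ_apply] at h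
      rcases hc : step m c with _ | c₁
      · have h0 : flip bind (step m) (some c) = none := hc
        rw [h0, Function.iterate_fixed (show flip bind (step m) none = none from rfl)] at h
        cases h
      · have h0 : flip bind (step m) (some c) = some c₁ := hc
        rw [h0] at h
        exact .head hc (ih h)

variable {K' : Type} [DecidableEq K'] {Γ' : K' → Type} {Λ' σ' : Type}

/-- A statement as part of a larger machine; `ex` is where it goes on instead of halting. -/
def liftStmt (ι : K → K') (L : Lens σ' σ) (φ : Λ → Λ') (ex : Option Λ') :
    Stmt (fun k => Γ' (ι k)) Λ σ → Stmt Γ' Λ' σ'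
  | .push k f q => .push (ι k) (fun s => f (L.get s)) (liftStmt ι L φ ex q)
  | .peek k f q => .peek (ι k) (fun s a => L.set s (f (L.get s) a)) (liftStmt ι L φ ex q)
  | .pop k f q => .pop (ι k) (fun s a => L.set s (f (L.get s) a)) (liftStmt ι L φ ex q)
  | .load f q => .load (fun s => L.set s (f (L.get s))) (liftStmt ι L φ ex q)
  | .branch p q₁ q₂ => .branch (fun s => p (L.get s)) (liftStmt ι L φ ex q₁) (liftStmt ι L φ ex q₂)
  | .goto l => .goto fun s => φ (l (L.get s))
  | .halt => match ex with
    | some l => .goto fun _ => l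
    | none => .halt

/-- The label in the larger machine. -/
def liftLabel (φ : Λ → Λ') (ex : Option Λ') : Option Λ → Option Λ'
  | some l => some (φ l)
  | none => ex

/-- Injectivity of `ι` makes an update of the stack `ι k` restrict to an update of the stack `k`
alone, so the simulation goes through constructor by constructor. All reads and writes of the state
pass through the lens. -/
theorem stepAux_liftStmt {ι : K → K'} (hι : Function.Injective ι) (L : Lens σ' σ) (φ : Λ → Λ')
    (ex : Option Λ') (q : Stmt (fun k => Γ' (ι k)) Λ σ) (s : σ') (S : ∀ k, List (Γ' (ι k)))
    (S' : ∀ k, List (Γ' k)) (hS : ∀ k, S' (ι k) = S k) :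
    (stepAux (liftStmt ι L φ ex q) s S').l = liftLabel φ ex (stepAux q (L.get s) S).l ∧
    (stepAux (liftStmt ι L φ ex q) s S').var = L.set s (stepAux q (L.get s) S).var ∧
    (∀ k, (stepAux (liftStmt ι L φ ex q) s S').stk (ι k) = (stepAux q (L.get s) S).stk k) ∧
    ∀ k', k' ∉ Set.range ι → (stepAux (liftStmt ι L φ ex q) s S').stk k' = S' k' := by
  have upd : ∀ (S : ∀ k, List (Γ' (ι k))) (S' : ∀ k, List (Γ' k)), (∀ k, S' (ι k) = S k) →
      ∀ k a, ∀ j, Function.update S' (ι k) a (ι j) = Function.update S k a j := by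
    intro S S' h k a j
    have : S = fun k => S' (ι k) := funext fun k => (h k).symm
    subst this
    exact congrFun (Function.update_comp_eq_of_injective' S' hι k a) j
  induction q generalizing s S S' with
  | push k f q ih =>
    simp only [liftStmt, stepAux]
    rw [hS k]
    obtain ⟨h₁, h₂, h₃, h₄⟩ := ih s _ (Function.update S' (ι k) (f (L.get s) :: S k))
      (upd S S' hS k (f (L.get s) :: S k))
    refine ⟨h₁, h₂, h₃, fun k' hk' => ?_⟩
    rw [h₄ k' hk', Function.update_of_ne]
    rintro rfl
    exact hk' ⟨k, rfl⟩
  | peek k f q ih =>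
    simp only [liftStmt, stepAux]
    rw [hS k]
    have := ih (L.set s (f (L.get s) (S k).head?)) S S' hS
    rwa [L.get_set, L.set_set] at this
  | pop k f q ih =>
    simp only [liftStmt, stepAux]
    rw [hS k]
    have := ih (L.set s (f (L.get s) (S k).head?)) _ (Function.update S' (ι k) (S k).tail)
      (upd S S' hS k (S k).tail)
    rw [L.get_set, L.set_set] at this
    obtain ⟨h₁, h₂, h₃, h₄⟩ := this
    refine ⟨h₁, h₂, h₃, fun k' hk' => ?_⟩
    rw [h₄ k' hk', Function.update_of_ne]
    rintro rfl
    exact hk' ⟨k, rfl⟩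
  | load f q ih =>
    simp only [liftStmt, stepAux]
    have := ih (L.set s (f (L.get s))) S S' hS
    rwa [L.get_set, L.set_set] at this
  | branch p q₁ q₂ ih₁ ih₂ =>
    simp only [liftStmt, stepAux]
    cases p (L.get s)
    · exact ih₂ s S S' hS
    · exact ih₁ s S S' hS
  | goto l =>
    simp only [liftStmt, stepAux]
    exact ⟨rfl, (L.set_get s).symm, hS, fun _ _ => trivial⟩
  | halt =>
    cases ex <;> exact ⟨rfl, (L.set_get s).symm, hS, fun _ _ => rfl⟩

/-- A halt is replaced by a jump to `ex` inside the same statement, so leaving the part costs no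
extra step. Only halted configurations have label `none`, which `liftLabel` sends to the exit. -/
theorem Steps.lift {ι : K → K'} (hι : Function.Injective ι) (L : Lens σ' σ) (φ : Λ → Λ')
    (ex : Option Λ') {m : Λ → Stmt (fun k => Γ' (ι k)) Λ σ} {m' : Λ' → Stmt Γ' Λ' σ'}
    (hm : ∀ l, m' (φ l) = liftStmt ι L φ ex (m l)) {c c₂ : Cfg (fun k => Γ' (ι k)) Λ σ} {t : ℕ}
    (h : Steps m c t c₂) (hc₂ : c₂.l = none) (s : σ') (S' : ∀ k, List (Γ' k))
    (hs : L.get s = c.var) (hS : ∀ k, S' (ι k) = c.stk k) :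
    ∃ S₂ : ∀ k, List (Γ' k),
      Steps m' ⟨liftLabel φ ex c.l, s, S'⟩ t ⟨ex, L.set s c₂.var, S₂⟩ ∧
      (∀ k, S₂ (ι k) = c₂.stk k) ∧ ∀ k', k' ∉ Set.range ι → S₂ k' = S' k' := by
  induction h generalizing s S' with
  | refl c =>
    refine ⟨S', ?_, hS, fun _ _ => rfl⟩
    rw [hc₂, ← hs, L.set_get]
    exact .refl _
  | @head c c' c'' t h₁ h₂ ih =>
    obtain ⟨l, v, S⟩ := c
    cases l with
    | none => cases h₁
    | some l =>
      simp only [step, Option.some.injEq] at h₁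
      simp only at hs hS
      subst hs
      obtain ⟨e₁, e₂, e₃, e₄⟩ := stepAux_liftStmt hι L φ ex (m l) s S S' hS
      rw [h₁] at e₁ e₂ e₃
      obtain ⟨S₂, r₁, r₂, r₃⟩ := ih hc₂
        (stepAux (liftStmt ι L φ ex (m l)) s S').var
        (stepAux (liftStmt ι L φ ex (m l)) s S').stk
        (by rw [e₂, L.get_set]) e₃
      refine ⟨S₂, ?_, r₂, fun k' hk' => by rw [r₃ k' hk', e₄ k' hk']⟩
      rw [e₂, L.set_set, ← e₂] at r₁
      refine .head (c' := stepAux (liftStmt ι L φ ex (m l)) s S') ?_ ?_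
      · simp only [liftLabel, step, hm]
      · rw [← e₁] at r₁
        exact r₁

variable (Γ σ) in
/-- A piece of a stack machine. It ends by halting. -/
structure Routine where
  Lbl : Type
  fin : Fintype Lbl
  entry : Lbl
  code : Lbl → Stmt Γ Lbl σ

/-- `R.Takes T v S v' S'`: within at most `T` steps `R` ends, with state `v'` and stacks `S'`. -/
def Routine.Takes (R : Routine Γ σ) (T : ℕ) (v : σ) (S : ∀ k, List (Γ k)) (v' : σ)
    (S' : ∀ k, List (Γ k)) : Prop :=
  ∃ t ≤ T, Steps R.code ⟨some R.entry, v, S⟩ t ⟨none, v', S'⟩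

theorem Routine.Takes.mono {R : Routine Γ σ} {T T' : ℕ} {v v' : σ} {S S' : ∀ k, List (Γ k)}
    (h : R.Takes T v S v' S') (hT : T ≤ T') : R.Takes T' v S v' S' :=
  let ⟨t, ht, h'⟩ := h; ⟨t, ht.trans hT, h'⟩

/-- A single statement. -/
def Routine.stmt (q : Stmt Γ Unit σ) : Routine Γ σ := ⟨Unit, inferInstance, (), fun _ => q⟩

theorem Routine.stmt_takes {q : Stmt Γ Unit σ} {v v' : σ} {S S' : ∀ k, List (Γ k)}
    (h : stepAux q v S = ⟨none, v', S'⟩) : (Routine.stmt q).Takes 1 v S v' S' :=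
  ⟨1, le_rfl, .head (congrArg some h) (.refl _)⟩

/-- Embedding steps of a part with the same stacks and states. -/
theorem Steps.embed {φ : Λ → Λ'} {ex : Option Λ'} {m : Λ → Stmt Γ Λ σ} {m' : Λ' → Stmt Γ Λ' σ}
    (hm : ∀ l, m' (φ l) = liftStmt id (Lens.refl σ) φ ex (m l)) {l : Λ} {v v₂ : σ}
    {S S₂ : ∀ k, List (Γ k)} {t : ℕ} (h : Steps m ⟨some l, v, S⟩ t ⟨none, v₂, S₂⟩) :
    Steps m' ⟨some (φ l), v, S⟩ t ⟨ex, v₂, S₂⟩ := by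
  obtain ⟨S₃, h₁, h₂, -⟩ := Steps.lift (ι := (id : K → K)) (Γ' := Γ) Function.injective_id
    (Lens.refl σ) φ ex hm h rfl v S rfl (fun _ => rfl)
  have : S₃ = S₂ := funext h₂
  rw [this] at h₁
  exact h₁

/-- One routine after another. -/
def Routine.seq (R₁ R₂ : Routine Γ σ) : Routine Γ σ where
  Lbl := R₁.Lbl ⊕ R₂.Lbl
  fin := haveI := R₁.fin; haveI := R₂.fin; inferInstance
  entry := Sum.inl R₁.entry
  code
    | .inl l => liftStmt id (Lens.refl σ) Sum.inl (some (.inr R₂.entry)) (R₁.code l)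
    | .inr l => liftStmt id (Lens.refl σ) Sum.inr none (R₂.code l)

theorem Routine.Takes.seq {R₁ R₂ : Routine Γ σ} {T₁ T₂ : ℕ} {v v₁ v₂ : σ}
    {S S₁ S₂ : ∀ k, List (Γ k)} (h₁ : R₁.Takes T₁ v S v₁ S₁) (h₂ : R₂.Takes T₂ v₁ S₁ v₂ S₂) :
    (R₁.seq R₂).Takes (T₁ + T₂) v S v₂ S₂ := by
  obtain ⟨t₁, ht₁, h₁⟩ := h₁
  obtain ⟨t₂, ht₂, h₂⟩ := h₂
  exact ⟨t₁ + t₂, add_le_add ht₁ ht₂, (Steps.embed (m' := (R₁.seq R₂).code) (fun _ => rfl) h₁).trans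
    (Steps.embed (m' := (R₁.seq R₂).code) (fun _ => rfl) h₂)⟩

/-- Run `R` if the state satisfies `p`. -/
def Routine.when (p : σ → Bool) (R : Routine Γ σ) : Routine Γ σ where
  Lbl := Option R.Lbl
  fin := haveI := R.fin; inferInstance
  entry := none
  code
    | none => .branch p (.goto fun _ => some R.entry) .halt
    | some l => liftStmt id (Lens.refl σ) some none (R.code l)

theorem Routine.when_false {p : σ → Bool} {R : Routine Γ σ} {v : σ} (S : ∀ k, List (Γ k))
    (h : p v = false) : (R.when p).Takes 1 v S v S :=
  ⟨1, le_rfl, .head (by simp [Routine.when, h]) (.refl _)⟩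

theorem Routine.Takes.when {p : σ → Bool} {R : Routine Γ σ} {T : ℕ} {v v₁ : σ}
    {S S₁ : ∀ k, List (Γ k)} (h : R.Takes T v S v₁ S₁) (hp : p v = true) :
    (R.when p).Takes (1 + T) v S v₁ S₁ := by
  obtain ⟨t, ht, h⟩ := h
  refine ⟨t + 1, by omega, .head (c' := ⟨some (some R.entry), v, S⟩) ?_
    (Steps.embed (m' := (R.when p).code) (fun _ => rfl) h)⟩
  simp [Routine.when, hp]

/-- Pop a symbol from the stack `k` and run `R`, as long as the state satisfies `p` after the
pop. -/
def Routine.whilePop (k : K) (f : σ → Option (Γ k) → σ) (p : σ → Bool) (R : Routine Γ σ) :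
    Routine Γ σ where
  Lbl := Option R.Lbl
  fin := haveI := R.fin; inferInstance
  entry := none
  code
    | none => .pop k f (.branch p (.goto fun _ => some R.entry) .halt)
    | some l => liftStmt id (Lens.refl σ) some (some none) (R.code l)

theorem Routine.whilePop_stop {k : K} {f : σ → Option (Γ k) → σ} {p : σ → Bool} {R : Routine Γ σ}
    {v : σ} {S : ∀ k, List (Γ k)} (hS : S k = []) (h : p (f v none) = false) :
    (R.whilePop k f p).Takes 1 v S (f v none) S := by
  refine ⟨1, le_rfl, .head ?_ (.refl _)⟩
  have : Function.update S k [] = S := by rw [← hS, Function.update_eq_self]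
  simp [Routine.whilePop, hS, h, this]

/-- One step for the pop and the test, then the body, then the loop again. Proofs about loops are
inductions on the popped stack, with this as inductive step and `Routine.whilePop_stop` as base. -/
theorem Routine.whilePop_go {k : K} {f : σ → Option (Γ k) → σ} {p : σ → Bool} {R : Routine Γ σ}
    {v v₁ v₂ : σ} {S S₁ S₂ : ∀ k, List (Γ k)} {a : Γ k} {l : List (Γ k)} {T₁ T₂ : ℕ}
    (hS : S k = a :: l) (h : p (f v (some a)) = true)
    (h₁ : R.Takes T₁ (f v (some a)) (Function.update S k l) v₁ S₁)
    (h₂ : (R.whilePop k f p).Takes T₂ v₁ S₁ v₂ S₂) :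
    (R.whilePop k f p).Takes (1 + T₁ + T₂) v S v₂ S₂ := by
  obtain ⟨t₁, ht₁, h₁⟩ := h₁
  obtain ⟨t₂, ht₂, h₂⟩ := h₂
  refine ⟨t₁ + t₂ + 1, by omega, .head (c' := ⟨some (some R.entry), f v (some a),
    Function.update S k l⟩) ?_ ((Steps.embed (m' := (R.whilePop k f p).code) (fun _ => rfl) h₁).trans h₂)⟩
  simp [Routine.whilePop, hS, h]

/-- A routine as a routine on more stacks, with a larger state. -/
def Routine.lift (ι : K → K') (L : Lens σ' σ) (R : Routine (fun k => Γ' (ι k)) σ) :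
    Routine Γ' σ' where
  Lbl := R.Lbl
  fin := R.fin
  entry := R.entry
  code l := liftStmt ι L id none (R.code l)

theorem Routine.Takes.lift {ι : K → K'} (hι : Function.Injective ι) (L : Lens σ' σ)
    {R : Routine (fun k => Γ' (ι k)) σ} {T : ℕ} {v v₁ : σ} {S S₁ : ∀ k, List (Γ' (ι k))}
    (h : R.Takes T v S v₁ S₁) {s s₁ : σ'} {S' S₁' : ∀ k, List (Γ' k)} (hs : L.get s = v)
    (hs₁ : L.set s v₁ = s₁) (hS : ∀ k, S' (ι k) = S k) (hS₁ : ∀ k, S₁' (ι k) = S₁ k)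
    (hS₁' : ∀ k', k' ∉ Set.range ι → S₁' k' = S' k') : (R.lift ι L).Takes T s S' s₁ S₁' := by
  obtain ⟨t, ht, h⟩ := h
  obtain ⟨S₂, h₁, h₂, h₃⟩ := Steps.lift (m' := (R.lift ι L).code) hι L id none (fun _ => rfl) h rfl s S' hs hS
  refine ⟨t, ht, ?_⟩
  have : S₁' = S₂ := by
    funext k'
    by_cases hk : k' ∈ Set.range ι
    · obtain ⟨k, rfl⟩ := hk
      rw [hS₁, h₂]
    · rw [hS₁' k' hk, h₃ k' hk]
  rw [this, ← hs₁]
  exact h₁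

end Routines

end PoQ

namespace PoQ

open Turing Turing.TM2

/-! ## Functions of `n` that a machine computes in time polynomial in `n` -/

/-- A function `ℕ → ℕ` that is bounded by a polynomial. -/
def PolyBdd (t : ℕ → ℕ) : Prop := ∃ p : Polynomial ℕ, ∀ n, t n ≤ p.eval n

theorem PolyBdd.mono {s t : ℕ → ℕ} (h : PolyBdd t) (hst : ∀ n, s n ≤ t n) : PolyBdd s :=
  let ⟨p, hp⟩ := h; ⟨p, fun n => (hst n).trans (hp n)⟩

theorem PolyBdd.const (c : ℕ) : PolyBdd fun _ => c := ⟨.C c, fun n => by simp⟩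

theorem PolyBdd.id : PolyBdd fun n => n := ⟨.X, fun n => by simp⟩

theorem PolyBdd.add {s t : ℕ → ℕ} (hs : PolyBdd s) (ht : PolyBdd t) : PolyBdd fun n => s n + t n :=
  let ⟨p, hp⟩ := hs; let ⟨q, hq⟩ := ht
  ⟨p + q, fun n => by rw [Polynomial.eval_add]; exact add_le_add (hp n) (hq n)⟩

theorem PolyBdd.mul {s t : ℕ → ℕ} (hs : PolyBdd s) (ht : PolyBdd t) : PolyBdd fun n => s n * t n :=
  let ⟨p, hp⟩ := hs; let ⟨q, hq⟩ := ht
  ⟨p * q, fun n => by rw [Polynomial.eval_mul]; exact Nat.mul_le_mul (hp n) (hq n)⟩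

/-- The list-valued function `f` is computed by a stack machine, on input of `n` in unary, in
polynomial time. -/
def PolyTime {α : Type} (f : ℕ → List α) : Prop :=
  Nonempty (TM2ComputableInPolyTime Computability.unaryEncodeNat id f)

theorem unaryEncodeNat_eq (n : ℕ) : Computability.unaryEncodeNat n = List.replicate n true := by
  induction n with
  | zero => rfl
  | succ n ih => rw [Computability.unaryEncodeNat, ih, List.replicate_succ]

/-! ### Growth of stacks and length of outputs -/

section Length

variable {K : Type} [DecidableEq K] {Γ : K → Type} {Λ σ : Type}

/-- The number of pushes in a statement. -/
def pushCount : Stmt Γ Λ σ → ℕ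
  | .push _ _ q => pushCount q + 1
  | .peek _ _ q => pushCount q
  | .pop _ _ q => pushCount q
  | .load _ q => pushCount q
  | .branch _ q₁ q₂ => pushCount q₁ + pushCount q₂
  | .goto _ => 0
  | .halt => 0

/-- `pushCount` counts both sides of a branch, so it is a bound that depends neither on the state
nor on the stacks. -/
theorem length_stepAux_le (q : Stmt Γ Λ σ) (v : σ) (S : ∀ k, List (Γ k)) (k : K) :
    ((stepAux q v S).stk k).length ≤ (S k).length + pushCount q := by
  induction q generalizing v S with
  | push j f q ih =>
    refine (ih v _).trans ?_
    rcases eq_or_ne k j with rfl | h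
    · simp only [Function.update_self, List.length_cons, pushCount]; omega
    · simp only [Function.update_of_ne h, pushCount]; omega
  | peek j f q ih => exact ih _ S
  | pop j f q ih =>
    refine (ih _ _).trans ?_
    rcases eq_or_ne k j with rfl | h
    · simp only [Function.update_self, List.length_tail, pushCount]; omega
    · simp only [Function.update_of_ne h, pushCount]; omega
  | load f q ih => exact ih _ S
  | branch p q₁ q₂ ih₁ ih₂ =>
    simp only [stepAux, pushCount]
    cases p v
    · exact (ih₂ v S).trans (by omega)
    · exact (ih₁ v S).trans (by omega)
  | goto l => simp [stepAux]
  | halt => simp [stepAux]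

theorem length_steps_le {m : Λ → Stmt Γ Λ σ} {c : ℕ} (hc : ∀ l, pushCount (m l) ≤ c)
    {C C' : Cfg Γ Λ σ} {t : ℕ} (h : Steps m C t C') (k : K) :
    (C'.stk k).length ≤ (C.stk k).length + t * c := by
  induction h with
  | refl => simp
  | @head C C₁ C₂ t h₁ _ ih =>
    obtain ⟨l, v, S⟩ := C
    cases l with
    | none => cases h₁
    | some l =>
      simp only [step, Option.some.injEq] at h₁
      have := length_stepAux_le (m l) v S k
      rw [h₁] at this
      have := hc l
      rw [Nat.add_mul]
      simp only at this ⊢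
      omega

end Length

theorem initList_stk (tm : FinTM2) (s : List (tm.Γ tm.k₀)) :
    (initList tm s).stk = Function.update (fun _ => []) tm.k₀ s := by
  funext k
  by_cases h : k = tm.k₀
  · subst h; simp [initList]
  · simp [initList, h]

theorem haltList_stk (tm : FinTM2) (s : List (tm.Γ tm.k₁)) :
    (haltList tm s).stk = Function.update (fun _ => []) tm.k₁ s := by
  funext k
  by_cases h : k = tm.k₁
  · subst h; simp [haltList]
  · simp [haltList, h]

/-- A machine as a routine. -/
def finRoutine (tm : FinTM2) : Routine tm.Γ tm.σ := ⟨tm.Λ, tm.ΛFin, tm.main, tm.m⟩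

theorem takes_finRoutine {tm : FinTM2} {s : List (tm.Γ tm.k₀)} {s' : List (tm.Γ tm.k₁)} {T : ℕ}
    (h : TM2OutputsInTime tm s (some s') T) :
    (finRoutine tm).Takes T tm.initialState (Function.update (fun _ => []) tm.k₀ s)
      tm.initialState (Function.update (fun _ => []) tm.k₁ s') := by
  refine ⟨h.steps, h.steps_le_m, ?_⟩
  rw [← initList_stk, ← haltList_stk]
  exact steps_iff_iterate.2 h.evals_in_steps

/-- A machine with finitely many labels pushes at most a fixed number of symbols per step, so its
output is bounded by the input length plus a multiple of the running time. The time bounds of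
programs that process the output rely on this. -/
theorem PolyTime.length_polyBdd {α : Type} {f : ℕ → List α} (hf : PolyTime f) :
    PolyBdd fun n => (f n).length := by
  obtain ⟨⟨⟨tm, eI, eO⟩, time, hout⟩⟩ := hf
  have := tm.ΛFin
  obtain ⟨c, hc⟩ : ∃ c, ∀ l, pushCount (tm.m l) ≤ c :=
    ⟨∑ l, pushCount (tm.m l), fun l =>
      Finset.single_le_sum (f := fun l => pushCount (tm.m l)) (fun _ _ => Nat.zero_le _)
        (Finset.mem_univ l)⟩
  refine PolyBdd.mono (t := fun n => n + time.eval n * c)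
    (PolyBdd.id.add (PolyBdd.mul ⟨time, fun _ => le_rfl⟩ (PolyBdd.const c))) fun n => ?_
  obtain ⟨t, ht, h⟩ := takes_finRoutine (hout n)
  have := length_steps_le (c := c) hc h tm.k₁
  simp only [Function.update_self, List.length_map, id] at this
  refine this.trans ?_
  rw [unaryEncodeNat_eq] at ht ⊢
  simp only [List.length_replicate] at ht
  have h1 : (Function.update (fun k => ([] : List (tm.Γ k))) tm.k₀
      (List.map eI.invFun (List.replicate n true)) tm.k₁).length ≤ n := by
    by_cases h : tm.k₁ = tm.k₀
    · rw [h]; simp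
    · rw [Function.update_of_ne h]; simp
  have h2 := Nat.mul_le_mul_right c ht
  omega

section Move

variable {K : Type} [DecidableEq K] {Γ : K → Type} {σ : Type}

/-- Pop all symbols of the stack `k` and push their images on `k'`. -/
def Routine.move (k k' : K) (rd : σ → Option (Γ k) → σ) (p : σ → Bool) (wr : σ → Γ k') :
    Routine Γ σ :=
  Routine.whilePop k rd p (.stmt (.push k' wr .halt))

/-- Popping and pushing reverses the order, so two moves in a row preserve it. The condition `hrd`
says that the state after the loop does not depend on the symbols that were read. -/
theorem Routine.move_takes {k k' : K} (hk : k ≠ k') {rd : σ → Option (Γ k) → σ} {p : σ → Bool}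
    {wr : σ → Γ k'} (e : Γ k → Γ k') (hp : ∀ v a, p (rd v (some a)) = true)
    (hp' : ∀ v, p (rd v none) = false) (hwr : ∀ v a, wr (rd v (some a)) = e a)
    (hrd : ∀ v a, rd (rd v (some a)) none = rd v none) (v : σ) (S : ∀ k, List (Γ k)) :
    (Routine.move k k' rd p wr).Takes (2 * (S k).length + 1) v S (rd v none)
      (Function.update (Function.update S k []) k' (((S k).map e).reverse ++ S k')) := by
  obtain ⟨l, hl⟩ : ∃ l, S k = l := ⟨_, rfl⟩
  induction l generalizing v S with
  | nil =>
    have : Function.update (Function.update S k []) k' (((S k).map e).reverse ++ S k') = S := by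
      rw [hl, ← hl, Function.update_eq_self, hl]; simp
    rw [this]
    exact (Routine.whilePop_stop hl (hp' v)).mono (by omega)
  | cons a l ih =>
    have h₂ := ih (rd v (some a)) (Function.update (Function.update S k l) k' (e a :: S k'))
      (by rw [Function.update_of_ne hk, Function.update_self])
    have h₁ : (Routine.stmt (.push k' wr .halt) : Routine Γ σ).Takes 1 (rd v (some a))
        (Function.update S k l) (rd v (some a))
        (Function.update (Function.update S k l) k' (e a :: S k')) := by
      refine Routine.stmt_takes ?_
      simp only [stepAux, hwr, Function.update_of_ne hk.symm]
    rw [hrd, Function.update_of_ne hk, Function.update_self, Function.update_self] at h₂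
    have hS : Function.update (Function.update S k []) k' (((S k).map e).reverse ++ S k') =
        Function.update (Function.update (Function.update (Function.update S k l) k'
          (e a :: S k')) k []) k' ((l.map e).reverse ++ e a :: S k') := by
      funext j
      by_cases h1 : j = k'
      · subst h1; simp [hl]
      · by_cases h2 : j = k
        · subst h2; simp [h1]
        · simp [h1, h2]
    rw [hS]
    exact (Routine.whilePop_go hl (hp v a) h₁ h₂).mono (by rw [hl, List.length_cons]; omega)

end Move

end PoQ

/-! ### Gluing two machines to a program with four stacks -/

namespace PoQ

open Turing Turing.TM2

/-- The stacks of a machine that runs two others: an input stack, an output stack, four work stacks,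
and those of the two machines. -/
inductive GlueStack (K₁ K₂ : Type) : Type
  | inp
  | out
  | work (i : Fin 4)
  | fst (k : K₁)
  | snd (k : K₂)
  deriving DecidableEq, Fintype

namespace GlueStack

variable {K₁ K₂ : Type} {Γ₁ : K₁ → Type} {Γ₂ : K₂ → Type} {A γ : Type}

variable (Γ₁ Γ₂ A γ) in
/-- The alphabets. -/
abbrev Alph : GlueStack K₁ K₂ → Type
  | inp => Bool
  | out => γ
  | work _ => A
  | fst k => Γ₁ k
  | snd k => Γ₂ k

/-- The contents of all stacks. -/
def mk (i : List Bool) (o : List γ) (w : Fin 4 → List A) (s₁ : ∀ k, List (Γ₁ k))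
    (s₂ : ∀ k, List (Γ₂ k)) : ∀ k, List (Alph Γ₁ Γ₂ A γ k)
  | inp => i
  | out => o
  | work j => w j
  | fst k => s₁ k
  | snd k => s₂ k

variable {i : List Bool} {o : List γ} {w : Fin 4 → List A} {s₁ : ∀ k, List (Γ₁ k)}
  {s₂ : ∀ k, List (Γ₂ k)} [DecidableEq K₁] [DecidableEq K₂]

theorem update_inp (l : List Bool) :
    Function.update (mk i o w s₁ s₂) inp l = mk l o w s₁ s₂ := by
  funext k
  cases k with
  | inp => exact Function.update_self _ _ _
  | _ => exact Function.update_of_ne (by simp) _ _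

theorem update_out (l : List γ) :
    Function.update (mk i o w s₁ s₂) out l = mk i l w s₁ s₂ := by
  funext k
  cases k with
  | out => exact Function.update_self _ _ _
  | _ => exact Function.update_of_ne (by simp) _ _

theorem update_work (j : Fin 4) (l : List A) :
    Function.update (mk i o w s₁ s₂) (work j) l = mk i o (Function.update w j l) s₁ s₂ := by
  funext k
  cases k with
  | work k =>
    rcases eq_or_ne k j with rfl | h
    · exact (Function.update_self _ _ _).trans (Function.update_self k l w).symm
    · exact (Function.update_of_ne (by simpa using h) _ _).trans (Function.update_of_ne h _ _).symm
  | _ => exact Function.update_of_ne (by simp) _ _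

theorem update_fst (j : K₁) (l : List (Γ₁ j)) :
    Function.update (mk i o w s₁ s₂) (fst j) l = mk i o w (Function.update s₁ j l) s₂ := by
  funext k
  cases k with
  | fst k =>
    rcases eq_or_ne k j with rfl | h
    · exact (Function.update_self _ _ _).trans (Function.update_self k l s₁).symm
    · exact (Function.update_of_ne (by simpa using h) _ _).trans (Function.update_of_ne h _ _).symm
  | _ => exact Function.update_of_ne (by simp) _ _

theorem update_snd (j : K₂) (l : List (Γ₂ j)) :
    Function.update (mk i o w s₁ s₂) (snd j) l = mk i o w s₁ (Function.update s₂ j l) := by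
  funext k
  cases k with
  | snd k =>
    rcases eq_or_ne k j with rfl | h
    · exact (Function.update_self _ _ _).trans (Function.update_self k l s₂).symm
    · exact (Function.update_of_ne (by simpa using h) _ _).trans (Function.update_of_ne h _ _).symm
  | _ => exact Function.update_of_ne (by simp) _ _

end GlueStack

open GlueStack

section Glue

variable {α β γ A : Type}

variable (M₁ : TM2ComputableAux Bool α) (M₂ : TM2ComputableAux Bool β)

/-- The states of the glued machine: a register, and the states of the two machines. -/
abbrev GlueState (A : Type) : Type := Option A × M₁.tm.σ × M₂.tm.σ

/-- The alphabets of the glued machine. -/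
abbrev GlueAlph (A γ : Type) : GlueStack M₁.tm.K M₂.tm.K → Type := Alph M₁.tm.Γ M₂.tm.Γ A γ

/-- Moving symbols from one stack to another. -/
def glueMove [Inhabited A] (k k' : GlueStack M₁.tm.K M₂.tm.K) (rd : GlueAlph M₁ M₂ A γ k → A)
    (wr : A → GlueAlph M₁ M₂ A γ k') : Routine (GlueAlph M₁ M₂ A γ) (GlueState M₁ M₂ A) :=
  .move k k' (fun s a => (a.map rd, s.2)) (fun s => s.1.isSome) (fun s => wr (s.1.getD default))

theorem glueMove_takes [Inhabited A] {k k' : GlueStack M₁.tm.K M₂.tm.K} (hk : k ≠ k')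
    (rd : GlueAlph M₁ M₂ A γ k → A) (wr : A → GlueAlph M₁ M₂ A γ k')
    (s : M₁.tm.σ × M₂.tm.σ) (S S' : ∀ k, List (GlueAlph M₁ M₂ A γ k))
    (l : List (GlueAlph M₁ M₂ A γ k)) (hl : S k = l)
    (hS' : Function.update (Function.update S k []) k' ((l.map (wr ∘ rd)).reverse ++ S k') = S') :
    (glueMove M₁ M₂ k k' rd wr).Takes (2 * l.length + 1) (none, s) S (none, s) S' := by
  subst hl
  rw [← hS']
  exact Routine.move_takes hk (wr ∘ rd) (fun _ _ => rfl) (fun _ => rfl) (fun _ _ => rfl)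
    (fun _ _ => rfl) (none, s) S

/-- Copying the input to the two machines. -/
def glueInput [Inhabited A] : Routine (GlueAlph M₁ M₂ A γ) (GlueState M₁ M₂ A) :=
  .whilePop inp (fun s a => (a.map fun _ => default, s.2)) (fun s => s.1.isSome)
    (.stmt (.push (fst M₁.tm.k₀) (fun _ => M₁.inputAlphabet.symm true)
      (.push (snd M₂.tm.k₀) (fun _ => M₂.inputAlphabet.symm true) .halt)))

/-- In unary all input symbols are equal, so the reversal caused by popping is harmless. The lists
`l₁` and `l₂` accumulate what has been copied so far. -/
theorem glueInput_takes [Inhabited A] (n : ℕ) (r : Option A) (s : M₁.tm.σ × M₂.tm.σ)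
    (w : Fin 4 → List A) (l₁ : List (M₁.tm.Γ M₁.tm.k₀)) (l₂ : List (M₂.tm.Γ M₂.tm.k₀)) :
    (glueInput (A := A) (γ := γ) M₁ M₂).Takes (2 * n + 1) (r, s)
      (mk (List.replicate n true) [] w (Function.update (fun _ => []) M₁.tm.k₀ l₁)
        (Function.update (fun _ => []) M₂.tm.k₀ l₂)) (none, s)
      (mk [] [] w
        (Function.update (fun _ => []) M₁.tm.k₀
          (List.replicate n (M₁.inputAlphabet.symm true) ++ l₁))
        (Function.update (fun _ => []) M₂.tm.k₀
          (List.replicate n (M₂.inputAlphabet.symm true) ++ l₂))) := by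
  induction n generalizing r l₁ l₂ with
  | zero => exact Routine.whilePop_stop rfl rfl
  | succ n ih =>
    have h₂ := ih (some default) (M₁.inputAlphabet.symm true :: l₁) (M₂.inputAlphabet.symm true :: l₂)
    refine (Routine.whilePop_go (T₁ := 1) (T₂ := 2 * n + 1) (a := true)
      (l := List.replicate n true) (v₁ := (some default, s)) ?_ rfl
      (Routine.stmt_takes rfl) (?_ : Routine.Takes (glueInput (A := A) (γ := γ) M₁ M₂) _ _ _ _ _)).mono (by omega)
    · rfl
    · refine cast ?_ h₂
      congr 1
      · rw [update_inp, update_fst, update_snd]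
        simp [mk]
      · simp [List.replicate_succ']

/-- The lens of the register. -/
def regLens (α β : Type) : Lens (α × β) α :=
  ⟨Prod.fst, fun s a => (a, s.2), fun _ _ => rfl, fun _ _ _ => rfl, fun _ => rfl⟩

def fstLens (A α β : Type) : Lens (A × α × β) α :=
  ⟨fun s => s.2.1, fun s a => (s.1, a, s.2.2), fun _ _ => rfl, fun _ _ _ => rfl, fun _ => rfl⟩

def sndLens (A α β : Type) : Lens (A × α × β) β :=
  ⟨fun s => s.2.2, fun s a => (s.1, s.2.1, a), fun _ _ => rfl, fun _ _ _ => rfl, fun _ => rfl⟩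


theorem glueFst_takes {s₁ s₁' : ∀ k, List (M₁.tm.Γ k)} {T : ℕ} {v v' : M₁.tm.σ}
    (h : (finRoutine M₁.tm).Takes T v s₁ v' s₁') (r : Option A) (u : M₂.tm.σ)
    (i : List Bool) (o : List γ) (w : Fin 4 → List A) (s₂ : ∀ k, List (M₂.tm.Γ k)) :
    (Routine.lift (Γ' := GlueAlph M₁ M₂ A γ) fst (fstLens (Option A) M₁.tm.σ M₂.tm.σ)
      (finRoutine M₁.tm)).Takes T (r, v, u) (mk i o w s₁ s₂) (r, v', u) (mk i o w s₁' s₂) := by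
  refine Routine.Takes.lift (Γ' := GlueAlph M₁ M₂ A γ) (fun _ _ h => by simpa using h) _ h rfl rfl
    (fun _ => rfl) (fun _ => rfl) fun k' hk' => ?_
  cases k' with
  | fst k => exact absurd ⟨k, rfl⟩ hk'
  | _ => rfl

theorem glueSnd_takes {s₂ s₂' : ∀ k, List (M₂.tm.Γ k)} {T : ℕ} {v v' : M₂.tm.σ}
    (h : (finRoutine M₂.tm).Takes T v s₂ v' s₂') (r : Option A) (u : M₁.tm.σ)
    (i : List Bool) (o : List γ) (w : Fin 4 → List A) (s₁ : ∀ k, List (M₁.tm.Γ k)) :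
    (Routine.lift (Γ' := GlueAlph M₁ M₂ A γ) snd (sndLens (Option A) M₁.tm.σ M₂.tm.σ)
      (finRoutine M₂.tm)).Takes T (r, u, v) (mk i o w s₁ s₂) (r, u, v') (mk i o w s₁ s₂') := by
  refine Routine.Takes.lift (Γ' := GlueAlph M₁ M₂ A γ) (fun _ _ h => by simpa using h) _ h rfl rfl
    (fun _ => rfl) (fun _ => rfl) fun k' hk' => ?_
  cases k' with
  | snd k => exact absurd ⟨k, rfl⟩ hk'
  | _ => rfl

theorem glueWork_takes {R : Routine (fun _ : Fin 4 => A) (Option A)} {w w' : Fin 4 → List A} {T : ℕ}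
    {v v' : Option A} (h : R.Takes T v w v' w') (u : M₁.tm.σ × M₂.tm.σ)
    (i : List Bool) (o : List γ) (s₁ : ∀ k, List (M₁.tm.Γ k)) (s₂ : ∀ k, List (M₂.tm.Γ k)) :
    (Routine.lift (Γ' := GlueAlph M₁ M₂ A γ) work (regLens (Option A) (M₁.tm.σ × M₂.tm.σ))
      R).Takes T (v, u) (mk i o w s₁ s₂) (v', u) (mk i o w' s₁ s₂) := by
  refine Routine.Takes.lift (Γ' := GlueAlph M₁ M₂ A γ) (fun _ _ h => by simpa using h) _ h rfl rfl
    (fun _ => rfl) (fun _ => rfl) fun k' hk' => ?_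
  cases k' with
  | work k => exact absurd ⟨k, rfl⟩ hk'
  | _ => rfl

/-- The program of the glued machine. -/
def glueRoutine [Inhabited A] (eα : α → A) (eβ : β → A) (d : A → γ)
    (R : Routine (fun _ : Fin 4 => A) (Option A)) :
    Routine (GlueAlph M₁ M₂ A γ) (GlueState M₁ M₂ A) :=
  (glueInput M₁ M₂).seq <|
  (Routine.lift (Γ' := GlueAlph M₁ M₂ A γ) fst (fstLens (Option A) M₁.tm.σ M₂.tm.σ)
    (finRoutine M₁.tm)).seq <|
  (Routine.lift (Γ' := GlueAlph M₁ M₂ A γ) snd (sndLens (Option A) M₁.tm.σ M₂.tm.σ)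
    (finRoutine M₂.tm)).seq <|
  (glueMove M₁ M₂ (fst M₁.tm.k₁) (work 3) (fun a => eα (M₁.outputAlphabet a)) id).seq <|
  (glueMove M₁ M₂ (work 3) (work 0) id id).seq <|
  (glueMove M₁ M₂ (snd M₂.tm.k₁) (work 3) (fun a => eβ (M₂.outputAlphabet a)) id).seq <|
  (glueMove M₁ M₂ (work 3) (work 1) id id).seq <|
  (Routine.lift (Γ' := GlueAlph M₁ M₂ A γ) work (regLens (Option A) (M₁.tm.σ × M₂.tm.σ)) R).seq <|
  glueMove M₁ M₂ (work 2) out id d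

/-- Both machines halt in their initial states with everything but the output stack empty, so after
the moves only the work stacks are filled. The outputs pass through work stack 3 because a single
move would reverse them. `R` leaves its result reversed, and the last move puts it right. -/
theorem glueRoutine_takes [Inhabited A] (eα : α → A) (eβ : β → A) (d : A → γ)
    {R : Routine (fun _ : Fin 4 => A) (Option A)} {n T₁ T₂ T : ℕ} {f : List α} {g : List β}
    {o : List A}
    (h₁ : TM2OutputsInTime M₁.tm ((List.replicate n true).map M₁.inputAlphabet.invFun)
      (some (f.map M₁.outputAlphabet.invFun)) T₁)
    (h₂ : TM2OutputsInTime M₂.tm ((List.replicate n true).map M₂.inputAlphabet.invFun)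
      (some (g.map M₂.outputAlphabet.invFun)) T₂)
    (hR : R.Takes T none ![f.map eα, g.map eβ, [], []] none ![[], [], o.reverse, []]) :
    (glueRoutine M₁ M₂ eα eβ d R).Takes
      (2 * n + 1 + (T₁ + (T₂ + (2 * f.length + 1 + (2 * f.length + 1 + (2 * g.length + 1 +
        (2 * g.length + 1 + (T + (2 * o.length + 1)))))))))
      (none, M₁.tm.initialState, M₂.tm.initialState)
      (mk (List.replicate n true) [] (fun _ => []) (fun _ => []) (fun _ => []))
      (none, M₁.tm.initialState, M₂.tm.initialState)
      (mk [] (o.map d) (fun _ => []) (fun _ => []) (fun _ => [])) := by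
  have h0 := glueInput_takes (A := A) (γ := γ) M₁ M₂ n none
    (M₁.tm.initialState, M₂.tm.initialState) (fun _ => []) [] []
  rw [Function.update_eq_self_iff.2 rfl, Function.update_eq_self_iff.2 rfl,
    List.append_nil, List.append_nil] at h0
  have k₁ := takes_finRoutine h₁
  have k₂ := takes_finRoutine h₂
  rw [List.map_replicate] at k₁ k₂
  refine h0.seq ((glueFst_takes M₁ M₂ k₁ none M₂.tm.initialState [] [] _ _).seq
    ((glueSnd_takes M₁ M₂ k₂ none M₁.tm.initialState [] [] _ _).seq ?_))
  have m₁ := glueMove_takes M₁ M₂ (A := A) (γ := γ) (k := fst M₁.tm.k₁) (k' := work 3) (by simp)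
    (fun a => eα (M₁.outputAlphabet a)) id (M₁.tm.initialState, M₂.tm.initialState)
    (mk [] [] (fun _ => [])
      (Function.update (fun _ => []) M₁.tm.k₁ (f.map M₁.outputAlphabet.invFun))
      (Function.update (fun _ => []) M₂.tm.k₁ (g.map M₂.outputAlphabet.invFun)))
    (mk [] [] ![[], [], [], (f.map eα).reverse] (fun _ => [])
      (Function.update (fun _ => []) M₂.tm.k₁ (g.map M₂.outputAlphabet.invFun)))
    (f.map M₁.outputAlphabet.invFun)
    (show Function.update (fun _ => []) M₁.tm.k₁ (f.map M₁.outputAlphabet.invFun) M₁.tm.k₁ = _ from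
      Function.update_self _ _ _) (by
      refine (congrArg (fun S => Function.update S _ _) (update_fst _ _)).trans
        ((update_work _ _).trans ?_)
      rw [Function.update_idem, Function.update_eq_self_iff.2 rfl]
      congr 1
      simp only [List.map_map]
      funext j
      fin_cases j <;> simp [mk, Function.comp_def])
  have m₂ := glueMove_takes M₁ M₂ (A := A) (γ := γ) (k := work 3) (k' := work 0) (by simp)
    id id (M₁.tm.initialState, M₂.tm.initialState)
    (mk [] [] ![[], [], [], (f.map eα).reverse] (fun _ => [])
      (Function.update (fun _ => []) M₂.tm.k₁ (g.map M₂.outputAlphabet.invFun)))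
    (mk [] [] ![f.map eα, [], [], []] (fun _ => [])
      (Function.update (fun _ => []) M₂.tm.k₁ (g.map M₂.outputAlphabet.invFun)))
    (f.map eα).reverse rfl (by
      refine (congrArg (fun S => Function.update S _ _) (update_work _ _)).trans
        ((update_work _ _).trans ?_)
      congr 1
      funext j
      fin_cases j <;> simp [mk])
  have m₃ := glueMove_takes M₁ M₂ (A := A) (γ := γ) (k := snd M₂.tm.k₁) (k' := work 3) (by simp)
    (fun a => eβ (M₂.outputAlphabet a)) id (M₁.tm.initialState, M₂.tm.initialState)
    (mk [] [] ![f.map eα, [], [], []] (fun _ => [])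
      (Function.update (fun _ => []) M₂.tm.k₁ (g.map M₂.outputAlphabet.invFun)))
    (mk [] [] ![f.map eα, [], [], (g.map eβ).reverse] (fun _ => []) (fun _ => []))
    (g.map M₂.outputAlphabet.invFun)
    (show Function.update (fun _ => []) M₂.tm.k₁ (g.map M₂.outputAlphabet.invFun) M₂.tm.k₁ = _ from
      Function.update_self _ _ _) (by
      refine (congrArg (fun S => Function.update S _ _) (update_snd _ _)).trans
        ((update_work _ _).trans ?_)
      rw [Function.update_idem, Function.update_eq_self_iff.2 rfl]
      congr 1
      simp only [List.map_map]
      funext j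
      fin_cases j <;> simp [mk, Function.comp_def])
  have m₄ := glueMove_takes M₁ M₂ (A := A) (γ := γ) (k := work 3) (k' := work 1) (by simp)
    id id (M₁.tm.initialState, M₂.tm.initialState)
    (mk [] [] ![f.map eα, [], [], (g.map eβ).reverse] (fun _ => []) (fun _ => []))
    (mk [] [] ![f.map eα, g.map eβ, [], []] (fun _ => []) (fun _ => []))
    (g.map eβ).reverse rfl (by
      refine (congrArg (fun S => Function.update S _ _) (update_work _ _)).trans
        ((update_work _ _).trans ?_)
      congr 1
      funext j
      fin_cases j <;> simp [mk])
  have m₅ := glueMove_takes M₁ M₂ (A := A) (γ := γ) (k := work 2) (k' := out) (by simp)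
    id d (M₁.tm.initialState, M₂.tm.initialState)
    (mk [] [] ![[], [], o.reverse, []] (fun _ => []) (fun _ => []))
    (mk [] (o.map d) (fun _ => []) (fun _ => []) (fun _ => []))
    o.reverse rfl (by
      refine (congrArg (fun S => Function.update S _ _) (update_work _ _)).trans
        ((update_out _).trans ?_)
      congr 1
      · simp [mk]
      · funext j
        fin_cases j <;> simp)
  simp only [List.length_map, List.length_reverse] at m₁ m₂ m₃ m₄ m₅
  exact m₁.seq (m₂.seq (m₃.seq (m₄.seq
    ((glueWork_takes M₁ M₂ hR _ [] [] (fun _ => []) (fun _ => [])).seq m₅))))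

/-- The glued machine. -/
def glueMachine [Fintype A] [Inhabited A] (eα : α → A) (eβ : β → A) (d : A → γ)
    (R : Routine (fun _ : Fin 4 => A) (Option A)) : FinTM2 where
  K := GlueStack M₁.tm.K M₂.tm.K
  kFin := haveI := M₁.tm.kFin; haveI := M₂.tm.kFin; inferInstance
  k₀ := inp
  k₁ := out
  Γ := GlueAlph M₁ M₂ A γ
  Λ := (glueRoutine M₁ M₂ eα eβ d R).Lbl
  main := (glueRoutine M₁ M₂ eα eβ d R).entry
  ΛFin := (glueRoutine M₁ M₂ eα eβ d R).fin
  σ := GlueState M₁ M₂ A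
  initialState := (none, M₁.tm.initialState, M₂.tm.initialState)
  σFin := haveI := M₁.tm.σFin; haveI := M₂.tm.σFin; inferInstance
  Γk₀Fin := inferInstanceAs (Fintype Bool)
  m := (glueRoutine M₁ M₂ eα eβ d R).code

end Glue

/-- Two lists that are computed in polynomial time can be processed by a polynomial-time program
with four stacks. -/
theorem PolyTime.process {α β γ A : Type} [Fintype A] [Inhabited A] {f : ℕ → List α} {g : ℕ → List β}
    (hf : PolyTime f) (hg : PolyTime g) (eα : α → A) (eβ : β → A) (d : A → γ)
    (R : Routine (fun _ : Fin 4 => A) (Option A)) {T : ℕ → ℕ} (hT : PolyBdd T) {o : ℕ → List A}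
    (ho : PolyBdd fun n => (o n).length)
    (hR : ∀ n, R.Takes (T n) none ![(f n).map eα, (g n).map eβ, [], []] none
      ![[], [], (o n).reverse, []]) :
    PolyTime fun n => (o n).map d := by
  have lf := hf.length_polyBdd
  have lg := hg.length_polyBdd
  obtain ⟨M₁, t₁, h₁⟩ := hf
  obtain ⟨M₂, t₂, h₂⟩ := hg
  have two : ∀ {l : ℕ → ℕ}, PolyBdd l → PolyBdd fun n => 2 * l n + 1 := fun hl =>
    ((PolyBdd.const 2).mul hl).add (.const 1)
  -- The summands follow the stages of `glueRoutine_takes`: copying the input, the two machines,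
  -- four moves, `R`, and the last move.
  obtain ⟨p, hp⟩ := (two PolyBdd.id).add <| PolyBdd.add ⟨t₁, fun _ => le_rfl⟩ <|
    PolyBdd.add ⟨t₂, fun _ => le_rfl⟩ <| (two lf).add <| (two lf).add <| (two lg).add <|
    (two lg).add <| hT.add (two ho)
  refine ⟨⟨⟨glueMachine (γ := γ) M₁ M₂ eα eβ d R, Equiv.refl Bool, Equiv.refl γ⟩, p, fun n => ?_⟩⟩
  have k₁ := h₁ n
  have k₂ := h₂ n
  rw [unaryEncodeNat_eq, List.length_replicate] at k₁ k₂
  have key := glueRoutine_takes M₁ M₂ eα eβ d k₁ k₂ (hR n)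
  choose t ht hst using key
  refine ⟨⟨t, ?_⟩, ht.trans ?_⟩
  · have hnil : (fun _ => []) = mk (Γ₁ := M₁.tm.Γ) (Γ₂ := M₂.tm.Γ) (A := A) (γ := γ) [] [] (fun _ => [])
        (fun _ => []) (fun _ => []) := by
      funext k; cases k <;> rfl
    have e₁ : (initList (glueMachine (γ := γ) M₁ M₂ eα eβ d R)
        (List.map (Equiv.refl Bool).invFun (Computability.unaryEncodeNat n))).stk =
          mk (List.replicate n true) [] (fun _ => []) (fun _ => []) (fun _ => []) := by
      refine (initList_stk _ _).trans ?_
      refine (congrArg (fun S => Function.update S _ _) hnil).trans ((update_inp _).trans ?_)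
      rw [unaryEncodeNat_eq]
      exact congrArg (fun l => mk l [] (fun _ => []) (fun _ => []) (fun _ => [])) (List.map_id _)
    have e₂ : (haltList (glueMachine (γ := γ) M₁ M₂ eα eβ d R)
        (List.map (Equiv.refl γ).invFun (id ((o n).map d)))).stk =
          mk [] ((o n).map d) (fun _ => []) (fun _ => []) (fun _ => []) := by
      refine (haltList_stk _ _).trans ?_
      refine (congrArg (fun S => Function.update S _ _) hnil).trans ((update_out _).trans ?_)
      exact congrArg (fun l => mk [] l (fun _ => []) (fun _ => []) (fun _ => [])) (List.map_id _)
    rw [← e₁, ← e₂] at hst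
    exact steps_iff_iterate.1 hst
  · rw [unaryEncodeNat_eq, List.length_replicate]
    exact hp n

end PoQ

/-! ### List programs on four stacks -/

namespace PoQ

open Turing Turing.TM2

section WorkPrograms

variable {A : Type}

theorem update_vec4_zero {B : Type} (a b c d x : B) :
    Function.update ![a, b, c, d] 0 x = ![x, b, c, d] := by
  funext j; fin_cases j <;> rfl

theorem update_vec4_one {B : Type} (a b c d x : B) :
    Function.update ![a, b, c, d] 1 x = ![a, x, c, d] := by
  funext j; fin_cases j <;> rfl

theorem update_vec4_two {B : Type} (a b c d x : B) :
    Function.update ![a, b, c, d] 2 x = ![a, b, x, d] := by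
  funext j; fin_cases j <;> rfl

theorem update_vec4_three {B : Type} (a b c d x : B) :
    Function.update ![a, b, c, d] 3 x = ![a, b, c, x] := by
  funext j; fin_cases j <;> rfl

variable (A) in
/-- Programs with four stacks over the alphabet `A` and a register for one symbol. -/
abbrev WorkRoutine : Type 1 := Routine (fun _ : Fin 4 => A) (Option A)

variable (A) in
/-- Statements of such programs. -/
abbrev WorkStmt : Type := Stmt (fun _ : Fin 4 => A) Unit (Option A)

/-- Run `R` for all symbols of the stack `k`, with the symbol in the register. -/
def forEach (k : Fin 4) (R : WorkRoutine A) : WorkRoutine A :=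
  .whilePop k (fun _ a => a) Option.isSome R

theorem forEach_nil {k : Fin 4} {R : WorkRoutine A} {r : Option A} {S : Fin 4 → List A}
    (h : S k = []) : (forEach k R).Takes 1 r S none S :=
  Routine.whilePop_stop h rfl

theorem forEach_cons {k : Fin 4} {R : WorkRoutine A} {r r₁ r₂ : Option A}
    {S S₁ S₂ : Fin 4 → List A} {a : A} {l : List A} {T₁ T₂ : ℕ} (h : S k = a :: l)
    (h₁ : R.Takes T₁ (some a) (Function.update S k l) r₁ S₁)
    (h₂ : (forEach k R).Takes T₂ r₁ S₁ r₂ S₂) : (forEach k R).Takes (1 + T₁ + T₂) r S r₂ S₂ :=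
  Routine.whilePop_go h rfl h₁ h₂

/-- Push a list of constants. -/
def pushes (k : Fin 4) : List A → WorkStmt A → WorkStmt A
  | [], q => q
  | a :: l, q => .push k (fun _ => a) (pushes k l q)

theorem stepAux_pushes (k : Fin 4) (l : List A) (q : WorkStmt A) (r : Option A)
    (S : Fin 4 → List A) :
    stepAux (pushes k l q) r S = stepAux q r (Function.update S k (l.reverse ++ S k)) := by
  induction l generalizing S with
  | nil => simp [pushes]
  | cons a l ih =>
    simp only [pushes, stepAux]
    rw [ih, Function.update_self, Function.update_idem]
    simp

/-- Empty a stack. -/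
def drain (k : Fin 4) : WorkRoutine A := forEach k (.stmt .halt)

theorem drain_takes (k : Fin 4) (r : Option A) (S S' : Fin 4 → List A) (l : List A)
    (hl : S k = l) (hS' : Function.update S k [] = S') :
    (drain k).Takes (2 * l.length + 1) r S none S' := by
  subst hS'
  induction l generalizing r S with
  | nil =>
    rw [← hl, Function.update_eq_self, hl]
    exact forEach_nil hl
  | cons a l ih =>
    have := ih (some a) (Function.update S k l) (Function.update_self ..)
    rw [Function.update_idem] at this
    exact (forEach_cons hl (Routine.stmt_takes rfl) this).mono (by rw [List.length_cons]; omega)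

/-- The body of the loop of `stairRoutine`. -/
def stairBody (t : A) (pre mid u post : List A) : WorkRoutine A :=
  (Routine.stmt (pushes 2 pre .halt)).seq <|
  (forEach 1 (.stmt (.push 2 (fun _ => t) (.push 3 (fun _ => t) .halt)))).seq <|
  (Routine.stmt (pushes 2 mid .halt)).seq <|
  (forEach 3 (.stmt (pushes 2 u (.push 1 (fun _ => t) .halt)))).seq <|
  Routine.stmt (pushes 2 post (.push 1 (fun _ => t) .halt))

/-- Write `pre t^i mid u^i post` for all `i` less than the length of the first stack. -/
def stairRoutine (t : A) (pre mid u post : List A) : WorkRoutine A :=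
  (drain 1).seq <| (forEach 0 (stairBody t pre mid u post)).seq <| drain 1

/-- The piece number `i` of the list that `stairRoutine` writes. -/
def stairPiece (t : A) (pre mid u post : List A) (i : ℕ) : List A :=
  pre ++ List.replicate i t ++ mid ++ (List.replicate i u).flatten ++ post

/-- Stack 1 holds the counter `i` in unary. The first loop shifts it to stack 3 while also writing
it to the output, the second shifts it back while writing one `u` per symbol, and the last push
increments it. -/
theorem stairBody_takes (t : A) (pre mid u post : List A) (i : ℕ) (r : Option A) (f c : List A) :
    (stairBody t pre mid u post).Takes (4 * i + 5) r ![f, List.replicate i t, c, []] none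
      ![f, List.replicate (i + 1) t, (stairPiece t pre mid u post i).reverse ++ c, []] := by
  have up : ∀ (i : ℕ) (r : Option A) (c d : List A),
      (forEach 1 (.stmt (.push 2 (fun _ => t) (.push 3 (fun _ => t) .halt)))).Takes (2 * i + 1) r
        ![f, List.replicate i t, c, d] none
        ![f, [], List.replicate i t ++ c, List.replicate i t ++ d] := by
    intro i
    induction i with
    | zero => exact fun r c d => forEach_nil rfl
    | succ i ih =>
      intro r c d
      have h₂ := ih (some t) (t :: c) (t :: d)
      refine (forEach_cons (a := t) (l := List.replicate i t) rfl (Routine.stmt_takes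
        (v' := some t) (S' := ![f, List.replicate i t, t :: c, t :: d]) ?_) ?_).mono
          (T := 1 + 1 + (2 * i + 1)) (by omega)
      · simp [update_vec4_one, update_vec4_two, update_vec4_three]
      · simpa [List.replicate_succ'] using h₂
  have down : ∀ (i : ℕ) (r : Option A) (b c : List A),
      (forEach 3 (.stmt (pushes 2 u (.push 1 (fun _ => t) .halt)))).Takes (2 * i + 1) r
        ![f, b, c, List.replicate i t] none
        ![f, List.replicate i t ++ b, (List.replicate i u).flatten.reverse ++ c, []] := by
    intro i
    induction i with
    | zero => exact fun r b c => forEach_nil rfl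
    | succ i ih =>
      intro r b c
      have h₂ := ih (some t) (t :: b) (u.reverse ++ c)
      refine (forEach_cons (a := t) (l := List.replicate i t) rfl (Routine.stmt_takes
        (v' := some t) (S' := ![f, t :: b, u.reverse ++ c, List.replicate i t]) ?_) ?_).mono
          (T := 1 + 1 + (2 * i + 1)) (by omega)
      · simp [stepAux_pushes, update_vec4_one, update_vec4_two, update_vec4_three]
      · have e : (List.replicate (i + 1) u).flatten.reverse ++ c =
            (List.replicate i u).flatten.reverse ++ (u.reverse ++ c) := by
          rw [List.replicate_succ, List.flatten_cons]; simp
        rw [e, List.replicate_succ']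
        simpa using h₂
  refine Routine.Takes.mono (T := 1 + (2 * i + 1 + (1 + (2 * i + 1 + 1)))) ?_ (by omega)
  refine (Routine.stmt_takes (v' := r) (S' := ![f, List.replicate i t, pre.reverse ++ c, []])
    ?_).seq ((up i _ _ _).seq ((Routine.stmt_takes (v' := none) (S' := ![f, [],
      mid.reverse ++ (List.replicate i t ++ (pre.reverse ++ c)), List.replicate i t]) ?_).seq
      ((down i _ _ _).seq (Routine.stmt_takes ?_))))
  · simp [stepAux_pushes, update_vec4_two]
  · simp [stepAux_pushes, update_vec4_two]
  · simp [stepAux_pushes, update_vec4_two, update_vec4_one, stairPiece, List.replicate_succ]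

theorem stairRoutine_takes (t : A) (pre mid u post f g : List A) :
    (stairRoutine t pre mid u post).Takes
      (2 * g.length + 1 + ((4 * f.length + 6) * f.length + 1 + (2 * f.length + 1))) none
      ![f, g, [], []] none
      ![[], [], ((List.range f.length).flatMap (stairPiece t pre mid u post)).reverse, []] := by
  -- `N` bounds the counter throughout, so a single cost `4 * N + 6` covers every round. Stack 0
  -- merely supplies the number of rounds.
  have loop : ∀ (N : ℕ) (f : List A) (i : ℕ) (c : List A) (r : Option A), i + f.length ≤ N →
      (forEach 0 (stairBody t pre mid u post)).Takes
      ((4 * N + 6) * f.length + 1) r ![f, List.replicate i t, c, []] none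
      ![[], List.replicate (i + f.length) t,
        ((List.range' i f.length).flatMap (stairPiece t pre mid u post)).reverse ++ c, []] := by
    intro N f
    induction f with
    | nil => exact fun i c r h => (forEach_nil rfl).mono (by simp)
    | cons a f ih =>
      intro i c r h
      rw [List.length_cons] at h ⊢
      have h₁ := stairBody_takes t pre mid u post i (some a) f c
      have h₂ := ih (i + 1) ((stairPiece t pre mid u post i).reverse ++ c) none (by omega)
      refine (forEach_cons (a := a) (l := f) rfl (by rw [update_vec4_zero]; exact h₁)
        (T₂ := (4 * N + 6) * f.length + 1) ?_).mono ?_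
      · rw [List.range'_succ, List.flatMap_cons, List.reverse_append, List.append_assoc,
          show i + (f.length + 1) = i + 1 + f.length by omega]
        exact h₂
      · rw [Nat.mul_add_one]
        omega
  refine (drain_takes 1 _ _ ![f, [], [], []] g rfl ?_).seq
    ((loop f.length f 0 [] none (by omega)).seq ((drain_takes 1 _ _ _ _ rfl ?_).mono ?_))
  · rw [update_vec4_one]
  · rw [update_vec4_one, List.append_nil, List.range_eq_range']
  · simp

/-- One step of the reversal of the order of the pieces of a list: the first component collects the
current piece, the second the pieces before. -/
def reverseStep (p : A → Bool) (s : List A × List A) (a : A) : List A × List A :=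
  if p a then ([a], s.1.reverse ++ s.2) else (a :: s.1, s.2)

/-- The current piece is stored backwards and turned over when the next one begins. Turning over the
last piece and appending the earlier ones restores the invariant, hence the form of both sides. -/
theorem foldl_reverseStep_flatten (p : A → Bool) (L : List (List A))
    (hL : ∀ l ∈ L, ∃ a l', l = a :: l' ∧ p a = true ∧ ∀ x ∈ l', p x = false)
    (s : List A × List A) :
    (L.flatten.foldl (reverseStep p) s).1.reverse ++ (L.flatten.foldl (reverseStep p) s).2 =
      L.reverse.flatten ++ (s.1.reverse ++ s.2) := by
  have inner : ∀ (l : List A) (s : List A × List A), (∀ x ∈ l, p x = false) →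
      l.foldl (reverseStep p) s = (l.reverse ++ s.1, s.2) := by
    intro l
    induction l with
    | nil => simp
    | cons x l ih =>
      intro s h
      rw [List.foldl_cons, ih _ fun y hy => h y (List.mem_cons_of_mem _ hy)]
      simp [reverseStep, h x List.mem_cons_self]
  induction L generalizing s with
  | nil => simp
  | cons l L ih =>
    obtain ⟨a, l', rfl, ha, hl'⟩ := hL l List.mem_cons_self
    rw [List.flatten_cons, List.foldl_append, List.foldl_cons,
      inner l' _ hl', ih fun l hl => hL l (List.mem_cons_of_mem _ hl)]
    simp [reverseStep, ha]

variable [Inhabited A]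

/-- Push the symbol in the register. -/
abbrev pushReg (k : Fin 4) (q : WorkStmt A) : WorkStmt A := .push k (fun r => r.getD default) q

/-- Move the symbols of one stack to another. -/
def mv (k k' : Fin 4) : WorkRoutine A := forEach k (.stmt (pushReg k' .halt))

theorem mv_takes {k k' : Fin 4} (hk : k ≠ k') (r : Option A) (S S' : Fin 4 → List A) (l : List A)
    (hl : S k = l)
    (hS' : Function.update (Function.update S k []) k' (l.reverse ++ S k') = S') :
    (mv k k').Takes (2 * l.length + 1) r S none S' := by
  subst hl
  rw [← hS']
  have := Routine.move_takes (Γ := fun _ : Fin 4 => A) hk (rd := fun _ a => a) (p := Option.isSome)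
    (wr := fun r : Option A => r.getD default) id (fun _ _ => rfl) (fun _ => rfl) (fun _ _ => rfl)
    (fun _ _ => rfl) r S
  rwa [List.map_id] at this

/-- Concatenation of the first two stacks, with constants in between. -/
def concatRoutine (c : List A) : WorkRoutine A :=
  (mv 0 2).seq ((Routine.stmt (pushes 2 c .halt)).seq (mv 1 2))

theorem concatRoutine_takes (f c g : List A) :
    (concatRoutine c).Takes (2 * f.length + 1 + (1 + (2 * g.length + 1))) none ![f, g, [], []] none
      ![[], [], (f ++ c ++ g).reverse, []] := by
  refine (mv_takes (S' := ![[], g, f.reverse, []]) (by decide) _ _ f rfl ?_).seq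
    ((Routine.stmt_takes (v' := none) (S' := ![[], g, c.reverse ++ f.reverse, []]) ?_).seq
    (mv_takes (by decide) _ _ _ g rfl ?_))
  · rw [update_vec4_zero, update_vec4_two]; simp
  · rw [stepAux_pushes, update_vec4_two]; simp
  · rw [update_vec4_one, update_vec4_two]; simp

/-- The body of the loop of `insertRoutine`. -/
def insertBody (p q : A → Bool) : WorkRoutine A :=
  (Routine.when (fun r => r.any p) <|
    (Routine.stmt (pushReg 0 .halt)).seq <|
    (forEach 1 (.stmt (pushReg 2 (pushReg 3 .halt)))).seq <|
    (mv 3 1).seq <|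
    Routine.stmt (.pop 0 (fun _ a => a) .halt)).seq
  (Routine.stmt (.branch (fun r => r.any q) (pushReg 2 .halt) .halt))

/-- Copy the first stack to the third; before each symbol that satisfies `p` insert a copy of the
second stack, and drop the symbols that do not satisfy `q`. -/
def insertRoutine (p q : A → Bool) : WorkRoutine A :=
  (forEach 0 (insertBody p q)).seq (drain 1)

theorem dup_takes (f g c d : List A) (r : Option A) :
    (forEach 1 (.stmt (pushReg 2 (pushReg 3 .halt)))).Takes (2 * g.length + 1) r ![f, g, c, d] none
      ![f, [], g.reverse ++ c, g.reverse ++ d] := by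
  induction g generalizing r c d with
  | nil => exact forEach_nil rfl
  | cons a g ih =>
    have := ih (a :: c) (a :: d) (some a)
    refine (forEach_cons rfl (Routine.stmt_takes
      (S' := ![f, g, a :: c, a :: d]) (v' := some a) ?_) ?_).mono
        (T := 1 + 1 + (2 * g.length + 1)) (by rw [List.length_cons]; omega)
    · simp [update_vec4_one, update_vec4_two, update_vec4_three]
    · simpa using this

/-- The list that `insertRoutine` writes. -/
def insertList (p q : A → Bool) (g : List A) (l : List A) : List A :=
  l.flatMap fun s => (if p s then g else []) ++ if q s then [s] else []

/-- Loops over other stacks overwrite the register, so the current symbol is parked on stack 0 and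
popped back afterwards. -/
theorem insertBody_takes (p q : A → Bool) (a : A) (f g c : List A) :
    (insertBody p q).Takes (4 * g.length + 6) (some a) ![f, g, c, []] (some a)
      ![f, g, (if q a then [a] else []) ++ ((if p a then g.reverse else []) ++ c), []] := by
  refine Routine.Takes.mono (T := (1 + (1 + (2 * g.length + 1 + (2 * g.length + 1 + 1)))) + 1)
    (Routine.Takes.seq (v₁ := some a) (S₁ := ![f, g, (if p a then g.reverse else []) ++ c, []])
    ?_ ?_) (by omega)
  · by_cases ha : p a = true
    · refine Routine.Takes.when ?_ (by simpa using ha)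
      refine (Routine.stmt_takes (v' := some a) (S' := ![a :: f, g, c, []]) ?_).seq
        ((dup_takes _ _ _ _ _).seq (((mv_takes (S' := ![a :: f, g, g.reverse ++ c, []])
          (by decide) _ _ g.reverse ?_ ?_).mono ?_).seq (Routine.stmt_takes ?_)))
      · simp [update_vec4_zero]
      · simp
      · rw [update_vec4_three, update_vec4_one]; simp
      · simp
      · simp [update_vec4_zero, ha]
    · have := Routine.when_false (p := fun r : Option A => r.any p)
        (R := (Routine.stmt (pushReg 0 .halt)).seq <|
          (forEach 1 (.stmt (pushReg 2 (pushReg 3 .halt)))).seq <|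
          (mv 3 1).seq <| Routine.stmt (.pop 0 (fun _ a => a) .halt))
        (v := some a) ![f, g, c, []] (by simpa using ha)
      simpa [ha] using this.mono (by omega)
  · refine Routine.stmt_takes ?_
    by_cases ha : q a = true
    · simp [ha, update_vec4_two]
    · simp [ha]

theorem insertRoutine_takes (p q : A → Bool) (f g : List A) :
    (insertRoutine p q).Takes ((4 * g.length + 7) * f.length + 1 + (2 * g.length + 1)) none
      ![f, g, [], []] none ![[], [], (insertList p q g f).reverse, []] := by
  have loop : ∀ (f c : List A) (r : Option A), (forEach 0 (insertBody p q)).Takes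
      ((4 * g.length + 7) * f.length + 1) r ![f, g, c, []] none
      ![[], g, (insertList p q g f).reverse ++ c, []] := by
    intro f
    induction f with
    | nil => exact fun c r => (forEach_nil rfl).mono (by simp)
    | cons a f ih =>
      intro c r
      have h₁ := insertBody_takes p q a f g c
      have h₂ := ih ((if q a then [a] else []) ++ ((if p a then g.reverse else []) ++ c)) (some a)
      have e : (insertList p q g (a :: f)).reverse ++ c = (insertList p q g f).reverse ++
          ((if q a then [a] else []) ++ ((if p a then g.reverse else []) ++ c)) := by
        simp only [insertList, List.flatMap_cons]
        split_ifs <;> simp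
      rw [e]
      refine (forEach_cons (a := a) (l := f) rfl (by rw [update_vec4_zero]; exact h₁) h₂).mono ?_
      rw [List.length_cons, Nat.mul_add_one]
      omega
  refine (loop f [] none).seq (drain_takes 1 _ _ _ g rfl ?_)
  rw [update_vec4_one, List.append_nil]

/-- The body of the loop of `reverseRoutine`. -/
def reverseBody (p : A → Bool) : WorkRoutine A :=
  (Routine.when (fun r => r.any p) <|
    (Routine.stmt (pushReg 0 .halt)).seq <|
    (mv 1 3).seq <|
    Routine.stmt (.pop 0 (fun _ a => a) .halt)).seq
  (Routine.stmt (pushReg 1 .halt))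

/-- Reverse the order of the pieces of a list, a piece beginning with a symbol that satisfies
`p`. -/
def reverseRoutine (p : A → Bool) : WorkRoutine A :=
  (drain 1).seq <| (forEach 0 (reverseBody p)).seq <| (mv 1 3).seq <| mv 3 2

theorem reverseBody_takes (p : A → Bool) (a : A) (f b d : List A) :
    (reverseBody p).Takes (2 * b.length + 5) (some a) ![f, b, [], d] (some a)
      ![f, if p a then [a] else a :: b, [], if p a then b.reverse ++ d else d] := by
  refine Routine.Takes.mono (T := (1 + (1 + (2 * b.length + 1 + 1))) + 1)
    (Routine.Takes.seq (v₁ := some a) (S₁ := ![f, if p a then [] else b, [],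
      if p a then b.reverse ++ d else d]) ?_ (Routine.stmt_takes ?_)) (by omega)
  · by_cases ha : p a = true
    · refine Routine.Takes.when ?_ (by simpa using ha)
      refine (Routine.stmt_takes (v' := some a) (S' := ![a :: f, b, [], d]) ?_).seq
        ((mv_takes (S' := ![a :: f, [], [], b.reverse ++ d])
          (by decide) _ _ b rfl ?_).seq (Routine.stmt_takes ?_))
      · simp [update_vec4_zero]
      · rw [update_vec4_one, update_vec4_three]; simp
      · simp [update_vec4_zero, ha]
    · have := Routine.when_false (p := fun r : Option A => r.any p)
        (R := (Routine.stmt (pushReg 0 .halt)).seq <| (mv 1 3).seq <|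
          Routine.stmt (.pop 0 (fun _ a => a) .halt))
        (v := some a) ![f, b, [], d] (by simpa using ha)
      simpa [ha] using this.mono (by omega)
  · by_cases ha : p a = true
    · simp [ha, update_vec4_one]
    · simp [ha, update_vec4_one]

theorem reverseRoutine_takes (p : A → Bool) (L : List (List A))
    (hL : ∀ l ∈ L, ∃ a l', l = a :: l' ∧ p a = true ∧ ∀ x ∈ l', p x = false) (g : List A) :
    (reverseRoutine p).Takes (2 * g.length + 1 + ((2 * L.flatten.length + 6) * L.flatten.length + 1 +
      (2 * L.flatten.length + 1 + (2 * L.flatten.length + 1)))) none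
      ![L.flatten, g, [], []] none ![[], [], L.reverse.flatten.reverse, []] := by
  -- Stacks 1 and 3 hold the two components of the fold by `reverseStep`. The length bound on the
  -- first controls the cost of turning a piece over.
  have loop : ∀ (N : ℕ) (f : List A) (s : List A × List A) (r : Option A),
      s.1.length + f.length ≤ N →
      (f.foldl (reverseStep p) s).1.length ≤ N ∧
      (forEach 0 (reverseBody p)).Takes ((2 * N + 6) * f.length + 1) r ![f, s.1, [], s.2] none
        ![[], (f.foldl (reverseStep p) s).1, [], (f.foldl (reverseStep p) s).2] := by
    intro N f
    induction f with
    | nil => exact fun s r h => ⟨by simpa using h, (forEach_nil rfl).mono (by simp)⟩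
    | cons a f ih =>
      intro s r h
      rw [List.length_cons] at h ⊢
      have h₁ := reverseBody_takes p a f s.1 s.2
      have h₂ := ih (reverseStep p s a) (some a) (by
        unfold reverseStep
        split_ifs <;> simp <;> omega)
      refine ⟨h₂.1, (forEach_cons (a := a) (l := f) rfl (by rw [update_vec4_zero]; exact h₁)
        (T₂ := (2 * N + 6) * f.length + 1) ?_).mono ?_⟩
      · refine cast ?_ h₂.2
        congr 2
        unfold reverseStep
        split_ifs <;> rfl
      · rw [Nat.mul_add_one]
        omega
  obtain ⟨h₁, h₂⟩ := loop L.flatten.length L.flatten ([], []) none (by simp)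
  have h₃ := foldl_reverseStep_flatten p L hL ([], [])
  rw [List.reverse_nil, List.append_nil, List.append_nil] at h₃
  refine (drain_takes 1 _ _ ![L.flatten, [], [], []] g rfl ?_).seq
    (h₂.seq (((mv_takes (S' := ![[], [], [], L.reverse.flatten]) (by decide) _ _ _ rfl ?_).mono ?_).seq
      ((mv_takes (by decide) _ _ _ _ rfl ?_).mono ?_)))
  · rw [update_vec4_one]
  · rw [update_vec4_one, update_vec4_three, ← h₃]
    rfl
  · simpa using h₁
  · rw [update_vec4_three, update_vec4_two]
    simp
  · simp only [Matrix.cons_val]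
    rw [List.length_flatten, List.length_flatten, List.map_reverse, List.sum_reverse]

end WorkPrograms

end PoQ

namespace PoQ

open Turing Turing.TM2

/-! ## Closure properties of uniform circuit families -/

section InsertList

variable {A : Type} {p q : A → Bool} {k : List A}

theorem insertList_nil : insertList p q k [] = [] := rfl

theorem insertList_cons (a : A) (l : List A) : insertList p q k (a :: l) =
    (if p a then k else []) ++ (if q a then [a] else []) ++ insertList p q k l := by
  simp [insertList]

theorem insertList_append (l l' : List A) :
    insertList p q k (l ++ l') = insertList p q k l ++ insertList p q k l' := by
  simp [insertList]

theorem insertList_replicate {a : A} (hp : p a = false) (hq : q a = true) (i : ℕ) :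
    insertList p q k (List.replicate i a) = List.replicate i a := by
  induction i with
  | zero => rfl
  | succ i ih => rw [List.replicate_succ, insertList_cons, ih]; simp [hp, hq]

theorem insertList_false (l : List A) :
    insertList (fun _ => false) (fun _ => false) k l = [] := by
  induction l with
  | nil => rfl
  | cons a l ih => rw [insertList_cons, ih]; rfl

theorem length_insertList_le (l : List A) :
    (insertList p q k l).length ≤ (k.length + 1) * l.length := by
  induction l with
  | nil => simp [insertList]
  | cons a l ih =>
    rw [insertList_cons, List.length_cons, Nat.mul_add_one, List.length_append, List.length_append]
    split_ifs <;> simp <;> omega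

end InsertList

section Lists

variable {α β γ A : Type} [Fintype A] [Inhabited A] {f : ℕ → List α} {g : ℕ → List β}

theorem PolyTime.concat {f g : ℕ → List A} (hf : PolyTime f) (hg : PolyTime g) (c : List A) :
    PolyTime fun n => f n ++ c ++ g n := by
  have lf := hf.length_polyBdd
  have lg := hg.length_polyBdd
  have := hf.process hg id id id (concatRoutine c)
    (T := fun n => 2 * (f n).length + 1 + (1 + (2 * (g n).length + 1)))
    ((((PolyBdd.const 2).mul lf).add (.const 1)).add
      ((PolyBdd.const 1).add (((PolyBdd.const 2).mul lg).add (.const 1))))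
    (o := fun n => f n ++ c ++ g n)
    (((lf.add (.const c.length)).add lg).mono fun n => by simp [Nat.add_assoc])
    (fun n => by simpa using concatRoutine_takes (f n) c (g n))
  simpa using this

theorem PolyTime.insert (hf : PolyTime f) (hg : PolyTime g) (eα : α → A) (eβ : β → A) (d : A → γ)
    (p q : A → Bool) :
    PolyTime fun n => (insertList p q ((g n).map eβ) ((f n).map eα)).map d := by
  have lf := hf.length_polyBdd
  have lg := hg.length_polyBdd
  refine hf.process hg eα eβ d (insertRoutine p q)
    (T := fun n => (4 * (g n).length + 7) * (f n).length + 1 + (2 * (g n).length + 1))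
    ((((((PolyBdd.const 4).mul lg).add (.const 7)).mul lf).add (.const 1)).add
      (((PolyBdd.const 2).mul lg).add (.const 1)))
    (((lg.add (.const 1)).mul lf).mono fun n => by
      simpa using length_insertList_le (p := p) (q := q) (k := (g n).map eβ) ((f n).map eα))
    (fun n => by simpa using insertRoutine_takes p q ((f n).map eα) ((g n).map eβ))

theorem PolyTime.stair (hf : PolyTime f) (t : A) (pre mid u post : List A) :
    PolyTime fun n => (List.range (f n).length).flatMap (stairPiece t pre mid u post) := by
  have lf := hf.length_polyBdd
  have hlen : ∀ m, ((List.range m).flatMap (stairPiece t pre mid u post)).length ≤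
      m * (pre.length + m + mid.length + m * u.length + post.length) := by
    intro m
    rw [List.length_flatMap]
    refine (List.sum_le_card_nsmul _ (pre.length + m + mid.length + m * u.length + post.length)
      ?_).trans (by simp)
    intro x hx
    obtain ⟨i, hi, rfl⟩ := List.mem_map.1 hx
    rw [List.mem_range] at hi
    have := Nat.mul_le_mul_right u.length hi.le
    simp only [stairPiece, List.length_append, List.length_replicate, List.length_flatten,
      List.map_replicate, List.sum_replicate, smul_eq_mul]
    omega
  have := hf.process hf (fun _ => t) (fun _ => t) id (stairRoutine t pre mid u post)
    (T := fun n => 2 * (f n).length + 1 + ((4 * (f n).length + 6) * (f n).length + 1 +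
      (2 * (f n).length + 1)))
    ((((PolyBdd.const 2).mul lf).add (.const 1)).add
      ((((((PolyBdd.const 4).mul lf).add (.const 6)).mul lf).add (.const 1)).add
      (((PolyBdd.const 2).mul lf).add (.const 1))))
    (o := fun n => (List.range (f n).length).flatMap (stairPiece t pre mid u post))
    ((lf.mul (((((PolyBdd.const pre.length).add lf).add (.const mid.length)).add
      (lf.mul (.const u.length))).add (.const post.length))).mono fun n => hlen _)
    (fun n => by
      simpa using stairRoutine_takes t pre mid u post ((f n).map fun _ => t) ((f n).map fun _ => t))
  simpa using this

theorem PolyTime.reversePieces {L : ℕ → List (List A)} (hf : PolyTime fun n => (L n).flatten)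
    (p : A → Bool)
    (hL : ∀ n, ∀ l ∈ L n, ∃ a l', l = a :: l' ∧ p a = true ∧ ∀ x ∈ l', p x = false) :
    PolyTime fun n => (L n).reverse.flatten := by
  have lf := hf.length_polyBdd
  have two := ((PolyBdd.const 2).mul lf).add (.const 1)
  have := hf.process hf id id id (reverseRoutine p)
    (T := fun n => 2 * (L n).flatten.length + 1 + ((2 * (L n).flatten.length + 6) *
      (L n).flatten.length + 1 + (2 * (L n).flatten.length + 1 + (2 * (L n).flatten.length + 1))))
    (two.add ((((((PolyBdd.const 2).mul lf).add (.const 6)).mul lf).add (.const 1)).add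
      (two.add two)))
    (o := fun n => (L n).reverse.flatten)
    (lf.mono fun n => by
      rw [List.length_flatten, List.length_flatten, List.map_reverse, List.sum_reverse])
    (fun n => by
      simpa only [List.map_id] using reverseRoutine_takes p (L n) (hL n) (L n).flatten)
  simpa using this

end Lists

/-- The machine is the same on both sides: whether the coding of circuits belongs to the output
encoding or to the function makes no difference to what is written. -/
theorem uniformCircuits_iff {C : ℕ → List Gate} :
    UniformCircuits C ↔ PolyTime fun n => circuitCode (C n) :=
  ⟨fun ⟨h⟩ => ⟨⟨h.toTM2ComputableAux, h.time, h.outputsFun⟩⟩,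
    fun ⟨h⟩ => ⟨⟨h.toTM2ComputableAux, h.time, h.outputsFun⟩⟩⟩

theorem polyLength_iff {m : ℕ → ℕ} : PolyLength m ↔ PolyTime fun n => List.replicate (m n) true := by
  have : (fun n => List.replicate (m n) true) = fun n => Computability.unaryEncodeNat (m n) :=
    funext fun n => (unaryEncodeNat_eq _).symm
  rw [this]
  exact ⟨fun ⟨h⟩ => ⟨⟨h.toTM2ComputableAux, h.time, h.outputsFun⟩⟩,
    fun ⟨h⟩ => ⟨⟨h.toTM2ComputableAux, h.time, h.outputsFun⟩⟩⟩

theorem polyLength_id : PolyLength fun n => n := ⟨idComputableInPolyTime _⟩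

theorem PolyLength.add {a b : ℕ → ℕ} (ha : PolyLength a) (hb : PolyLength b) :
    PolyLength fun n => a n + b n := by
  rw [polyLength_iff] at *
  simpa using ha.concat hb []

/-- An insertion with both predicates false erases everything, which provides the empty list; the
constant is then the separator in a concatenation. -/
theorem polyLength_const (c : ℕ) : PolyLength fun _ => c := by
  rw [polyLength_iff]
  have h₀ := polyLength_iff.1 polyLength_id
  have h₁ : PolyTime fun _ : ℕ => ([] : List Bool) := by
    have := h₀.insert h₀ (A := Bool) id id (id : Bool → Bool) (fun _ => false) (fun _ => false)
    simpa only [insertList_false, List.map_nil] using this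
  simpa using h₁.concat h₁ (List.replicate c true)

theorem uniformCircuits_nil : UniformCircuits fun _ => [] := by
  rw [uniformCircuits_iff]
  have h₀ := polyLength_iff.1 polyLength_id
  have := h₀.insert h₀ (A := Bool) id id (fun _ => Sym.done) (fun _ => false) (fun _ => false)
  simp only [insertList_false, List.map_nil] at this
  exact this

theorem UniformCircuits.append {C D : ℕ → List Gate} (hC : UniformCircuits C)
    (hD : UniformCircuits D) : UniformCircuits fun n => C n ++ D n := by
  rw [uniformCircuits_iff] at *
  have : Inhabited Sym := ⟨.done⟩
  simpa [circuitCode] using hC.concat hD []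

/-- A gate with all wires moved up by `O`. -/
def Gate.shift (O : ℕ) : Gate → Gate
  | .x i => .x (O + i)
  | .cx i j => .cx (O + i) (O + j)
  | .ccx i j l => .ccx (O + i) (O + j) (O + l)
  | .h i => .h (O + i)
  | .t i => .t (O + i)

/-- Wire numbers are in unary and closed by `done`, so raising all of them by `O` amounts to
inserting `O` ticks before every `done`. -/
theorem UniformCircuits.shift {C : ℕ → List Gate} (hC : UniformCircuits C) {O : ℕ → ℕ}
    (hO : PolyLength O) : UniformCircuits fun n => (C n).map (Gate.shift (O n)) := by
  rw [uniformCircuits_iff] at *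
  rw [polyLength_iff] at hO
  have : Inhabited Sym := ⟨.done⟩
  have := hC.insert hO (A := Sym) id (fun _ => Sym.tick) (id : Sym → Sym)
    (fun s => s = .done) (fun _ => true)
  convert this using 2 with n
  have wire : ∀ O i, insertList (fun s => decide (s = Sym.done)) (fun _ => true)
      (List.replicate O Sym.tick) (wireCode i) = wireCode (O + i) := by
    intro O i
    rw [wireCode, insertList_append, insertList_replicate (by decide) rfl, wireCode, Nat.add_comm,
      List.replicate_add, List.append_assoc]
    simp [insertList]
  simp only [List.map_replicate, List.map_id]
  induction C n with
  | nil => rfl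
  | cons g C ih =>
    rw [List.map_cons, circuitCode, List.flatMap_cons, circuitCode, List.flatMap_cons, insertList_append]
    refine congrArg₂ (· ++ ·) ?_ ih
    cases g <;> simp [Gate.shift, Gate.code, insertList_cons, insertList_append, wire]

/-- The code of a gate consists of its name followed by `tick` and `done` only, so the names mark
the beginnings of the pieces whose order is reversed. -/
theorem UniformCircuits.reverse {C : ℕ → List Gate} (hC : UniformCircuits C) :
    UniformCircuits fun n => (C n).reverse := by
  rw [uniformCircuits_iff] at *
  have : Inhabited Sym := ⟨.done⟩
  have e : ∀ C : List Gate, circuitCode C = (C.map Gate.code).flatten := fun C => by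
    rw [circuitCode, List.flatMap_def]
  simp only [e, List.map_reverse] at hC ⊢
  refine hC.reversePieces (fun s => s ≠ .tick ∧ s ≠ .done) fun n l hl => ?_
  obtain ⟨g, -, rfl⟩ := List.mem_map.1 hl
  have hw : ∀ i, ∀ x ∈ wireCode i, x = Sym.tick ∨ x = Sym.done := fun i x hx => by
    rw [wireCode, List.mem_append] at hx
    exact hx.imp List.eq_of_mem_replicate List.mem_singleton.1
  cases g
  all_goals
    refine ⟨_, _, rfl, by decide, fun x hx => ?_⟩
    try simp only [List.mem_append, or_assoc] at hx
    have : x = Sym.tick ∨ x = Sym.done := by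
      first
      | exact hw _ _ hx
      | exact hx.elim (hw _ _) (hw _ _)
      | exact hx.elim (hw _ _) fun h => h.elim (hw _ _) (hw _ _)
    rcases this with rfl | rfl <;> decide

/-- Add the `m` wires from `a` on to the `m` wires from `b` on. -/
def copyBlock (a b m : ℕ) : List Gate := (List.range m).map fun i => .cx (a + i) (b + i)

/-- Hadamard gates on the `m` wires from `a` on. -/
def hBlock (a m : ℕ) : List Gate := (List.range m).map fun i => .h (a + i)

theorem wireCode_add (O i : ℕ) :
    wireCode (O + i) = List.replicate i .tick ++ (List.replicate O .tick ++ [.done]) := by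
  rw [wireCode, Nat.add_comm, List.replicate_add, List.append_assoc]

theorem PolyLength.copyBlock {a b m : ℕ → ℕ} (ha : PolyLength a) (hb : PolyLength b)
    (hm : PolyLength m) : UniformCircuits fun n => copyBlock (a n) (b n) (m n) := by
  rw [uniformCircuits_iff]
  rw [polyLength_iff] at *
  have : Inhabited Sym := ⟨.done⟩
  -- The symbols `inr true` and `inr false` mark where the offsets `a` and `b` belong. The staircase
  -- writes the ticks that depend on `i`, and each insertion then replaces one kind of marker by its
  -- offset.
  have h₁ := hm.stair (A := Sym ⊕ Bool) (.inl .tick) [.inl .nameCX] [.inr true, .inl .done]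
    [.inl .tick] [.inr false, .inl .done]
  have h₂ := h₁.insert ha (A := Sym ⊕ Bool) id (fun _ => .inl Sym.tick) id
    (fun s => s = .inr true) (fun s => s ≠ .inr true)
  have h₃ := h₂.insert hb (A := Sym ⊕ Bool) id (fun _ => .inl Sym.tick)
    (Sum.elim id fun _ => Sym.done) (fun s => s = .inr false) (fun s => s ≠ .inr false)
  convert h₃ using 2 with n
  simp only [List.map_replicate, List.map_id, List.length_replicate]
  rw [PoQ.copyBlock]
  induction List.range (m n) with
  | nil => rfl
  | cons i l ih =>
    rw [List.map_cons, circuitCode, List.flatMap_cons, List.flatMap_cons, insertList_append,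
      insertList_append, List.map_append]
    refine congrArg₂ (· ++ ·) ?_ ih
    simp only [Gate.code, stairPiece, insertList_append, wireCode_add]
    simp [insertList_replicate, insertList_cons, insertList_nil, insertList_append]

theorem PolyLength.hBlock {a m : ℕ → ℕ} (ha : PolyLength a) (hm : PolyLength m) :
    UniformCircuits fun n => hBlock (a n) (m n) := by
  rw [uniformCircuits_iff]
  rw [polyLength_iff] at *
  have : Inhabited Sym := ⟨.done⟩
  have h₁ := hm.stair (A := Sym ⊕ Bool) (.inl .tick) [.inl .nameH] [.inr true, .inl .done] [] []
  have h₂ := h₁.insert ha (A := Sym ⊕ Bool) id (fun _ => .inl Sym.tick)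
    (Sum.elim id fun _ => Sym.done) (fun s => s = .inr true) (fun s => s ≠ .inr true)
  convert h₂ using 2 with n
  simp only [List.map_replicate, List.map_id, List.length_replicate]
  rw [PoQ.hBlock]
  induction List.range (m n) with
  | nil => rfl
  | cons i l ih =>
    rw [List.map_cons, circuitCode, List.flatMap_cons, List.flatMap_cons, insertList_append,
      List.map_append]
    refine congrArg₂ (· ++ ·) ?_ ih
    simp only [Gate.code, stairPiece, insertList_append, wireCode_add]
    simp [insertList_replicate, insertList_cons, insertList_nil]

end PoQ

namespace PoQ

/-! ## Classical circuits -/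

/-- The wires that a gate touches. -/
def Gate.wires : Gate → List ℕ
  | .x i => [i]
  | .cx i j => [i, j]
  | .ccx i j l => [i, j, l]
  | .h i => [i]
  | .t i => [i]

/-- This is why the reversed gate list is the inverse circuit. The convention that a gate whose
target is one of its controls does nothing keeps it true in the degenerate cases. -/
theorem Gate.act_act (g : Gate) (s : Wires) : g.act (g.act s) = s := by
  cases g with
  | x i => simp [Gate.act]
  | cx i j =>
    by_cases h : i = j
    · simp [Gate.act, h]
    · simp [Gate.act, h]
  | ccx i j l =>
    by_cases h : i = l ∨ j = l
    · simp [Gate.act, h]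
    · have h' := not_or.1 h
      simp [Gate.act, h'.1, h'.2]
  | h i => rfl
  | t i => rfl

theorem Gate.act_of_notMem {g : Gate} {i : ℕ} (hi : i ∉ g.wires) (s : Wires) : g.act s i = s i := by
  cases g <;> simp only [Gate.wires, List.mem_cons, List.not_mem_nil, or_false, not_or] at hi <;>
    simp only [Gate.act]
  · rw [Function.update_of_ne hi]
  · split_ifs
    · rfl
    · rw [Function.update_of_ne hi.2]
  · split_ifs
    · rfl
    · rw [Function.update_of_ne hi.2.2]

theorem Gate.act_congr {g : Gate} {s s' : Wires} {T : Set ℕ} (hg : ∀ i ∈ g.wires, i ∉ T)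
    (h : ∀ i, i ∉ T → s i = s' i) (i : ℕ) (hi : i ∉ T) : g.act s i = g.act s' i := by
  cases g with
  | x a =>
    simp only [Gate.wires, List.mem_singleton, forall_eq] at hg
    simp only [Gate.act, Function.update_apply, h a hg, h i hi]
  | cx a b =>
    simp only [Gate.wires, List.mem_cons, List.not_mem_nil, or_false, forall_eq_or_imp,
      forall_eq] at hg
    simp only [Gate.act]
    split_ifs
    · exact h i hi
    · simp only [Function.update_apply, h a hg.1, h b hg.2, h i hi]
  | ccx a b c =>
    simp only [Gate.wires, List.mem_cons, List.not_mem_nil, or_false, forall_eq_or_imp,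
      forall_eq] at hg
    simp only [Gate.act]
    split_ifs
    · exact h i hi
    · simp only [Function.update_apply, h a hg.1, h b hg.2.1, h c hg.2.2, h i hi]
  | h a => exact h i hi
  | t a => exact h i hi

theorem runC_append (C D : List Gate) (s : Wires) : runC (C ++ D) s = runC D (runC C s) :=
  List.foldl_append

theorem runC_cons (g : Gate) (C : List Gate) (s : Wires) : runC (g :: C) s = runC C (g.act s) := rfl

theorem runC_reverse (C : List Gate) (s : Wires) : runC C.reverse (runC C s) = s := by
  induction C generalizing s with
  | nil => rfl
  | cons g C ih =>
    rw [List.reverse_cons, runC_append, runC_cons g C s, ih]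
    exact g.act_act s

theorem runC_of_forall_notMem {C : List Gate} {i : ℕ} (hC : ∀ g ∈ C, i ∉ g.wires) (s : Wires) :
    runC C s i = s i := by
  induction C generalizing s with
  | nil => rfl
  | cons g C ih =>
    rw [runC_cons, ih fun g hg => hC g (List.mem_cons_of_mem _ hg),
      Gate.act_of_notMem (hC g List.mem_cons_self)]

/-- Wires in `T` are neither read nor written, so their content cannot influence the rest. This lets
an uncomputation ignore the block that received the result. -/
theorem runC_congr {C : List Gate} {T : Set ℕ} (hC : ∀ g ∈ C, ∀ i ∈ g.wires, i ∉ T) {s s' : Wires}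
    (h : ∀ i, i ∉ T → s i = s' i) (i : ℕ) (hi : i ∉ T) : runC C s i = runC C s' i := by
  induction C generalizing s s' with
  | nil => exact h i hi
  | cons g C ih =>
    exact ih (fun g hg => hC g (List.mem_cons_of_mem _ hg))
      (Gate.act_congr (hC g List.mem_cons_self) h)

theorem act_shift (g : Gate) (O : ℕ) (s : Wires) (j : ℕ) :
    (g.shift O).act s (O + j) = g.act (fun j => s (O + j)) j := by
  cases g <;> simp only [Gate.shift, Gate.act, Nat.add_right_inj] <;>
    try split_ifs
  all_goals simp [Function.update_apply]

theorem wires_shift (g : Gate) (O : ℕ) : ∀ i ∈ (g.shift O).wires, O ≤ i := by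
  cases g <;> simp [Gate.shift, Gate.wires]

theorem runC_shift (C : List Gate) (O : ℕ) (s : Wires) (j : ℕ) :
    runC (C.map (Gate.shift O)) s (O + j) = runC C (fun j => s (O + j)) j := by
  induction C generalizing s with
  | nil => rfl
  | cons g C ih =>
    rw [List.map_cons, runC_cons, runC_cons, ih]
    congr 1
    funext j
    exact act_shift g O s j

theorem copyBlock_succ (a b m : ℕ) :
    copyBlock a b (m + 1) = copyBlock a b m ++ [.cx (a + m) (b + m)] := by
  simp [copyBlock, List.range_succ]

theorem runC_copyBlock {a b m : ℕ} (h : a + m ≤ b ∨ b + m ≤ a) (s : Wires) (i : ℕ) :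
    runC (copyBlock a b m) s i =
      if b ≤ i ∧ i < b + m then xor (s i) (s (a + (i - b))) else s i := by
  induction m generalizing i with
  | zero =>
    rw [if_neg (by omega)]
    rfl
  | succ m ih =>
    have hact : runC [.cx (a + m) (b + m)] (runC (copyBlock a b m) s) =
        Function.update (runC (copyBlock a b m) s) (b + m)
          (xor (runC (copyBlock a b m) s (b + m)) (runC (copyBlock a b m) s (a + m))) :=
      if_neg (by omega)
    rw [copyBlock_succ, runC_append, hact, Function.update_apply]
    have ih := ih (by omega)
    by_cases hi : i = b + m
    · subst hi
      rw [if_pos rfl, if_pos (by omega), ih, ih, if_neg (by omega), if_neg (by omega)]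
      congr 3
      omega
    · rw [if_neg hi, ih]
      by_cases hi' : b ≤ i ∧ i < b + m
      · rw [if_pos hi', if_pos (by omega)]
      · rw [if_neg hi', if_neg (by omega)]

theorem wires_copyBlock {a b m : ℕ} {g : Gate} (hg : g ∈ copyBlock a b m) {i : ℕ}
    (hi : i ∈ g.wires) : (a ≤ i ∧ i < a + m) ∨ (b ≤ i ∧ i < b + m) := by
  obtain ⟨j, hj, rfl⟩ := List.mem_map.1 hg
  rw [List.mem_range] at hj
  simp only [Gate.wires, List.mem_cons, List.not_mem_nil, or_false] at hi
  omega

/-! ### Subroutine calls that leave no garbage -/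

/-- Run `W`, add the `m` wires from `p` on to those from `q` on, and undo `W`. -/
def compute (W : List Gate) (p q m : ℕ) : List Gate := W ++ copyBlock p q m ++ W.reverse

/-- The copying changes only the target block, which `W` does not touch, so running `W` backwards
restores all other wires. -/
theorem runC_compute {W : List Gate} {p q m : ℕ}
    (hW : ∀ g ∈ W, ∀ i ∈ g.wires, i < q ∨ q + m ≤ i) (hpq : p + m ≤ q ∨ q + m ≤ p) (s : Wires)
    (i : ℕ) : runC (compute W p q m) s i =
      if q ≤ i ∧ i < q + m then xor (s i) (runC W s (p + (i - q))) else s i := by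
  rw [compute, runC_append, runC_append]
  by_cases hi : q ≤ i ∧ i < q + m
  · rw [if_pos hi, runC_of_forall_notMem, runC_copyBlock hpq, if_pos hi, runC_of_forall_notMem]
    · exact fun g hg h => by have := hW g hg i h; omega
    · exact fun g hg h => by have := hW g (List.mem_reverse.1 hg) i h; omega
  · rw [if_neg hi, runC_congr (T := {i | q ≤ i ∧ i < q + m}) (s' := runC W s), runC_reverse]
    · exact fun g hg i hi h => by
        have := hW g (List.mem_reverse.1 hg) i hi
        simp only [Set.mem_ofPred_eq] at h
        omega
    · intro i hi
      rw [runC_copyBlock hpq, if_neg (show ¬(q ≤ i ∧ i < q + m) from hi)]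
    · exact hi

/-- Move the `m` wires from `a` on to those from `b` on, which are in state `0`. -/
def moveBlock (a b m : ℕ) : List Gate := copyBlock a b m ++ copyBlock b a m

/-- After the first addition the target equals the source, so adding it back clears the source. -/
theorem runC_moveBlock {a b m : ℕ} (h : a + m ≤ b ∨ b + m ≤ a) {s : Wires}
    (hs : ∀ i, b ≤ i → i < b + m → s i = false) (i : ℕ) :
    runC (moveBlock a b m) s i = if b ≤ i ∧ i < b + m then s (a + (i - b)) else
      if a ≤ i ∧ i < a + m then false else s i := by
  rw [moveBlock, runC_append, runC_copyBlock h.symm]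
  by_cases hi : b ≤ i ∧ i < b + m
  · rw [if_neg (by omega), if_pos hi, runC_copyBlock h, if_pos hi, hs i hi.1 hi.2, Bool.false_xor]
  · rw [if_neg hi]
    by_cases hi' : a ≤ i ∧ i < a + m
    · rw [if_pos hi', if_pos hi', runC_copyBlock h, runC_copyBlock h, if_neg hi, if_pos (by omega),
        hs (b + (i - a)) (by omega) (by omega), show a + (b + (i - a) - b) = i by omega]
      simp
    · rw [if_neg hi', if_neg hi', runC_copyBlock h, if_neg hi]

theorem load_append (l l' : List Bool) (i : ℕ) :
    load (l ++ l') i = if i < l.length then load l i else load l' (i - l.length) := by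
  simp only [load]
  split_ifs with h
  · rw [List.getD_append _ _ _ _ h]
  · rw [List.getD_append_right _ _ _ _ (not_lt.1 h)]

theorem load_of_length_le {l : List Bool} {i : ℕ} (h : l.length ≤ i) : load l i = false :=
  List.getD_eq_default _ _ h

theorem length_str {m : ℕ} (x : Bits m) : (str x).length = m := List.length_ofFn

theorem load_str {m : ℕ} (x : Bits m) {i : ℕ} (h : i < m) : load (str x) i = x ⟨i, h⟩ := by
  simp [load, str, h]

theorem load_str_slice (s : Wires) {a m i : ℕ} (h : i < m) : load (str (slice s a m)) i = s (a + i) :=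
  load_str _ h

/-- The concatenation of blocks of wires, given by their first wire and their length. -/
def readBlocks (s : Wires) (l : List (ℕ × ℕ)) : List Bool :=
  l.flatMap fun b => str (slice s b.1 b.2)

/-- Copy blocks of wires to the wires from `O` on. -/
def copyIn (O : ℕ) : List (ℕ × ℕ) → List Gate
  | [] => []
  | b :: l => copyBlock b.1 O b.2 ++ copyIn (O + b.2) l

theorem runC_copyIn {O' : ℕ} (l : List (ℕ × ℕ)) (hl : ∀ b ∈ l, b.1 + b.2 ≤ O') {O : ℕ}
    (hO : O' ≤ O) {s : Wires} (hs : ∀ i, O ≤ i → s i = false) (i : ℕ) :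
    runC (copyIn O l) s i = if i < O then s i else load (readBlocks s l) (i - O) := by
  induction l generalizing O s with
  | nil =>
    split_ifs with h
    · rfl
    · exact hs i (not_lt.1 h)
  | cons b l ih =>
    have hb := hl b List.mem_cons_self
    have hc := runC_copyBlock (a := b.1) (b := O) (m := b.2) (by omega) s
    rw [copyIn, runC_append, ih (fun b hb => hl b (List.mem_cons_of_mem _ hb)) (by omega)
      (fun i hi => by rw [hc, if_neg (by omega)]; exact hs i (by omega))]
    have hread : readBlocks (runC (copyBlock b.1 O b.2) s) l = readBlocks s l := by
      simp only [readBlocks, List.flatMap_def]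
      congr 1
      refine List.map_congr_left fun c hc' => ?_
      congr 1
      funext j
      have := hl c (List.mem_cons_of_mem _ hc')
      have := j.2
      simp only [slice]
      rw [hc, if_neg (by omega)]
    rw [hread, hc]
    simp only [readBlocks, List.flatMap_cons]
    rw [load_append, length_str]
    by_cases h₁ : i < O
    · rw [if_pos (by omega), if_neg (by omega), if_pos h₁]
    · by_cases h₂ : i < O + b.2
      · rw [if_pos h₂, if_pos (by omega), if_neg h₁, if_pos (by omega), hs i (by omega),
          load_str_slice _ (by omega), Bool.false_xor]
      · rw [if_neg h₂, if_neg h₁, if_neg (by omega), Nat.sub_sub]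

theorem wires_copyIn {O : ℕ} {l : List (ℕ × ℕ)} {g : Gate} (hg : g ∈ copyIn O l) {i : ℕ}
    (hi : i ∈ g.wires) : O ≤ i ∨ ∃ b ∈ l, b.1 ≤ i ∧ i < b.1 + b.2 := by
  induction l generalizing O with
  | nil => cases hg
  | cons b l ih =>
    rcases List.mem_append.1 hg with hg | hg
    · rcases wires_copyBlock hg hi with h | h
      · exact .inr ⟨b, List.mem_cons_self, h⟩
      · exact .inl h.1
    · rcases ih hg with h | ⟨c, hc, h⟩
      · exact .inl (by omega)
      · exact .inr ⟨c, List.mem_cons_of_mem _ hc, h⟩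

/-- Run the circuit `D` on an input that consists of the blocks `l`, with wires from `O` on, and add
the `m` wires of `D` from `p` on to the wires from `q` on. -/
def call (O : ℕ) (l : List (ℕ × ℕ)) (D : List Gate) (p q m : ℕ) : List Gate :=
  compute (copyIn O l ++ D.map (Gate.shift O)) (O + p) q m

/-- The workspace from `O` on is returned to zero, so several calls can share the same `O`. The
input blocks must avoid the target; otherwise the uncomputation would start from altered inputs. -/
theorem runC_call {O p q m : ℕ} {l : List (ℕ × ℕ)} (D : List Gate) {s : Wires}
    (hs : ∀ i, O ≤ i → s i = false)
    (hl : ∀ b ∈ l, b.1 + b.2 ≤ O ∧ (b.1 + b.2 ≤ q ∨ q + m ≤ b.1)) (hq : q + m ≤ O) (i : ℕ) :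
    runC (call O l D p q m) s i = if q ≤ i ∧ i < q + m then
      xor (s i) (runC D (load (readBlocks s l)) (p + (i - q))) else s i := by
  rw [call, runC_compute _ (by omega)]
  · congr 2
    rw [runC_append, Nat.add_assoc, runC_shift]
    congr 2
    funext j
    rw [runC_copyIn l (fun b hb => (hl b hb).1) le_rfl hs, if_neg (by omega), Nat.add_sub_cancel_left]
  · intro g hg i hi
    rcases List.mem_append.1 hg with hg | hg
    · rcases wires_copyIn hg hi with h | ⟨b, hb, h⟩
      · omega
      · have := hl b hb
        omega
    · obtain ⟨g, -, rfl⟩ := List.mem_map.1 hg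
      have := wires_shift g O i hi
      omega

/-! Classical gates -/

/-- All gates of the circuit are classical. -/
def AllClassical (C : List Gate) : Prop := ∀ g ∈ C, g.IsClassical

theorem AllClassical.append {C D : List Gate} (hC : AllClassical C) (hD : AllClassical D) :
    AllClassical (C ++ D) := fun g hg => (List.mem_append.1 hg).elim (hC g) (hD g)

theorem AllClassical.reverse {C : List Gate} (hC : AllClassical C) : AllClassical C.reverse :=
  fun g hg => hC g (List.mem_reverse.1 hg)

theorem AllClassical.shift {C : List Gate} (hC : AllClassical C) (O : ℕ) :
    AllClassical (C.map (Gate.shift O)) := fun g hg => by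
  obtain ⟨g, hg', rfl⟩ := List.mem_map.1 hg
  have := hC g hg'
  cases g <;> exact this

theorem allClassical_copyBlock (a b m : ℕ) : AllClassical (copyBlock a b m) := fun g hg => by
  obtain ⟨j, -, rfl⟩ := List.mem_map.1 hg
  trivial

theorem allClassical_moveBlock (a b m : ℕ) : AllClassical (moveBlock a b m) :=
  (allClassical_copyBlock _ _ _).append (allClassical_copyBlock _ _ _)

theorem allClassical_copyIn (O : ℕ) (l : List (ℕ × ℕ)) : AllClassical (copyIn O l) := by
  induction l generalizing O with
  | nil => exact fun g hg => by cases hg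
  | cons b l ih => exact (allClassical_copyBlock _ _ _).append (ih _)

theorem AllClassical.call {D : List Gate} (hD : AllClassical D) (O : ℕ) (l : List (ℕ × ℕ))
    (p q m : ℕ) : AllClassical (call O l D p q m) :=
  have := (allClassical_copyIn O l).append (hD.shift O)
  (this.append (allClassical_copyBlock _ _ _)).append this.reverse

/-! Uniformity -/

theorem PolyLength.moveBlock {a b m : ℕ → ℕ} (ha : PolyLength a) (hb : PolyLength b)
    (hm : PolyLength m) : UniformCircuits fun n => moveBlock (a n) (b n) (m n) :=
  (ha.copyBlock hb hm).append (hb.copyBlock ha hm)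

theorem uniformCircuits_copyIn {O : ℕ → ℕ} (hO : PolyLength O) (l : List ((ℕ → ℕ) × (ℕ → ℕ)))
    (hl : ∀ b ∈ l, PolyLength b.1 ∧ PolyLength b.2) :
    UniformCircuits fun n => copyIn (O n) (l.map fun b => (b.1 n, b.2 n)) := by
  induction l generalizing O with
  | nil => exact uniformCircuits_nil
  | cons b l ih =>
    have hb := hl b List.mem_cons_self
    exact (hb.1.copyBlock hO hb.2).append
      (ih (hO.add hb.2) fun b hb => hl b (List.mem_cons_of_mem _ hb))

theorem UniformCircuits.call {D : ℕ → List Gate} (hD : UniformCircuits D) {O p q m : ℕ → ℕ}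
    (hO : PolyLength O) (hp : PolyLength p) (hq : PolyLength q) (hm : PolyLength m)
    (l : List ((ℕ → ℕ) × (ℕ → ℕ))) (hl : ∀ b ∈ l, PolyLength b.1 ∧ PolyLength b.2) :
    UniformCircuits fun n =>
      call (O n) (l.map fun b => (b.1 n, b.2 n)) (D n) (p n) (q n) (m n) :=
  have := (uniformCircuits_copyIn hO l hl).append (hD.shift hO)
  (this.append ((hO.add hp).copyBlock hq hm)).append this.reverse

end PoQ

namespace PoQ

/-! ## Uniform probabilities and negligible functions -/

section Prob

variable {Ω Ω' : Type} [Fintype Ω] [Fintype Ω']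

theorem avg_mono {Z Z' : Ω → ℝ} (h : ∀ ω, Z ω ≤ Z' ω) : avg Z ≤ avg Z' :=
  div_le_div_of_nonneg_right (Finset.sum_le_sum fun ω _ => h ω) (Nat.cast_nonneg _)

theorem avg_add (Z Z' : Ω → ℝ) : avg (fun ω => Z ω + Z' ω) = avg Z + avg Z' := by
  simp only [avg, Finset.sum_add_distrib, add_div]

theorem avg_sub (Z Z' : Ω → ℝ) : avg (fun ω => Z ω - Z' ω) = avg Z - avg Z' := by
  simp only [avg, Finset.sum_sub_distrib, sub_div]

theorem avg_const [Nonempty Ω] (c : ℝ) : avg (fun _ : Ω => c) = c := by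
  have : (Fintype.card Ω : ℝ) ≠ 0 := Nat.cast_ne_zero.2 Fintype.card_ne_zero
  simp [avg, this]

theorem avg_prod (Z : Ω × Ω' → ℝ) : avg Z = avg fun ω => avg fun ω' => Z (ω, ω') := by
  simp only [avg, Fintype.sum_prod_type, Fintype.card_prod, Nat.cast_mul, ← Finset.sum_div,
    div_div]
  rw [mul_comm]

theorem avg_equiv (e : Ω ≃ Ω') (Z : Ω' → ℝ) : avg (fun ω => Z (e ω)) = avg Z := by
  simp only [avg, Equiv.sum_comp e Z, Fintype.card_congr e]

theorem prob_mono {E E' : Ω → Prop} (h : ∀ ω, E ω → E' ω) : prob E ≤ prob E' := by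
  refine avg_mono fun ω => ?_
  by_cases hE : E ω
  · rw [if_pos hE, if_pos (h ω hE)]
  · rw [if_neg hE]
    split_ifs <;> norm_num

theorem prob_nonneg (E : Ω → Prop) : 0 ≤ prob E :=
  div_nonneg (Finset.sum_nonneg fun ω _ => by split_ifs <;> norm_num) (Nat.cast_nonneg _)

theorem prob_or_le (E E' : Ω → Prop) : prob (fun ω => E ω ∨ E' ω) ≤ prob E + prob E' := by
  rw [prob, prob, prob, ← avg_add]
  refine avg_mono fun ω => ?_
  by_cases h : E ω <;> by_cases h' : E' ω <;> simp [h, h']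

open scoped Classical in
-- Inclusion and exclusion, with the union bounded by `1`.
theorem prob_add_le [Nonempty Ω] (E E' : Ω → Prop) :
    prob E + prob E' ≤ 1 + prob fun ω => E ω ∧ E' ω := by
  have h : prob E + prob E' ≤ avg fun ω => (1 : ℝ) + if E ω ∧ E' ω then 1 else 0 := by
    rw [prob, prob, ← avg_add]
    refine avg_mono fun ω => ?_
    by_cases h : E ω <;> by_cases h' : E' ω <;> simp [h, h']
  rw [avg_add, avg_const] at h
  exact h.trans (le_of_eq (congrArg (1 + ·) (congrArg avg (funext fun ω => by congr))))

open scoped Classical in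
theorem prob_not [Nonempty Ω] (E : Ω → Prop) : prob (fun ω => ¬E ω) = 1 - prob E := by
  have h : prob (fun ω => ¬E ω) = avg fun ω => (1 : ℝ) - if E ω then 1 else 0 := by
    refine congrArg avg (funext fun ω => ?_)
    by_cases h : E ω <;> simp [h]
  rwa [avg_sub, avg_const] at h

open scoped Classical in
theorem prob_equiv (e : Ω ≃ Ω') (E : Ω' → Prop) : prob (fun ω => E (e ω)) = prob E :=
  avg_equiv e fun ω => if E ω then (1 : ℝ) else 0

theorem prob_prod (E : Ω × Ω' → Prop) : prob E = avg fun ω => prob fun ω' => E (ω, ω') :=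
  avg_prod _

open scoped Classical in
theorem prob_fst [Nonempty Ω'] (E : Ω → Prop) : prob (fun p : Ω × Ω' => E p.1) = prob E := by
  rw [prob_prod]
  exact congrArg avg (funext fun ω => avg_const (if E ω then (1 : ℝ) else 0))

end Prob

instance (m : ℕ) : Nonempty (Bits m) := ⟨fun _ => false⟩

theorem Negligible.add {μ ν : ℕ → ℝ} (hμ : Negligible μ) (hν : Negligible ν) :
    Negligible fun n => μ n + ν n :=
  Asymptotics.SuperpolynomialDecay.add hμ hν

theorem Negligible.const_mul {μ : ℕ → ℝ} (c : ℝ) (hμ : Negligible μ) :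
    Negligible fun n => c * μ n :=
  Asymptotics.SuperpolynomialDecay.const_mul hμ c

theorem Negligible.abs {μ : ℕ → ℝ} (hμ : Negligible μ) : Negligible fun n => |μ n| :=
  Asymptotics.SuperpolynomialDecay.trans_abs_le hμ fun n => by rw [abs_abs]

/-- The two halves of a bit string. -/
def halves (a b : ℕ) (r : Bits (a + b)) : Bits a × Bits b := (Fin.appendEquiv a b).symm r

theorem str_halves {a b : ℕ} (r : Bits (a + b)) :
    str r = str (halves a b r).1 ++ str (halves a b r).2 := by
  rw [str, str, str, ← List.ofFn_fin_append]
  congr 1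
  exact ((Fin.appendEquiv a b).apply_symm_apply r).symm

theorem prob_halves {Ω : Type} [Fintype Ω] {a b : ℕ} (E : Ω × Bits a × Bits b → Prop) :
    prob (fun p : Ω × Bits (a + b) => E (p.1, halves a b p.2)) = prob E :=
  prob_equiv ((Equiv.refl Ω).prodCongr (Fin.appendEquiv a b).symm) E

/-! ## Running a prover together with an extractor -/

theorem str_slice_eq {s : Wires} {a m : ℕ} {l : List Bool} (hl : l.length = m)
    (h : ∀ i < m, s (a + i) = load l i) : str (slice s a m) = l := by
  refine List.ext_getElem (by rw [length_str, hl]) fun i h₁ h₂ => ?_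
  rw [length_str] at h₁
  simp only [str, slice, List.getElem_ofFn]
  rw [h i h₁, load, List.getD_eq_getElem _ _ h₂]

theorem slice_congr {s s' : Wires} {a a' m : ℕ} (h : ∀ i < m, s (a + i) = s' (a' + i)) :
    slice s a m = slice s' a' m := funext fun i => h i i.2

section Extract

/-- On input `(k, r, r')`, run `A` on `(k, r)` and `E` on `(k, r, y, r')`, where `y` is the first part
of the output of `A`; put the outputs `(b, x)`, `(d, c)`, `y` on the wires from `B` on. -/
def extractCirc (CA CE : List Gate) (B nK cA cE nX nY w : ℕ) : List Gate :=
  let P := nK + (cA + cE) + (B + (1 + nX + (w + 1) + nY))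
  let O := P + (nK + (cA + cE))
  let Y := B + (1 + nX + (w + 1))
  moveBlock 0 P (nK + (cA + cE)) ++
    (call O [(P, nK + cA)] CA nY (B + (1 + nX)) (w + 1) ++
    (call O [(P, nK + cA)] CA 0 Y nY ++
    call O [(P, nK + cA), (Y, nY), (P + (nK + cA), cE)] CE 0 B (1 + nX)))

/-- `CA` is called twice on the same coins, so that `(d, c)` can be placed directly behind `(b, x)`
while `y` goes elsewhere. The wires before `B` stay free for a later verdict, and the key and the
empty workspace survive so that the check algorithm can be called afterwards. -/
theorem runC_extractCirc (CA CE : List Gate) (B nK cA cE nX nY w : ℕ) (k : Bits nK) (rA : Bits cA)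
    (rE : Bits cE) {s sA sE : Wires}
    (hs : s = runC (extractCirc CA CE B nK cA cE nX nY w) (load (str k ++ (str rA ++ str rE))))
    (hA : sA = runC CA (load (str k ++ str rA)))
    (hE : sE = runC CE (load (str k ++ str rA ++ str (slice sA 0 nY) ++ str rE))) :
    (∀ i, i < B → s i = false) ∧
    (∀ i, i < 1 + nX → s (B + i) = sE i) ∧
    (∀ i, i < w + 1 → s (B + (1 + nX) + i) = sA (nY + i)) ∧
    (∀ i, i < nY → s (B + (1 + nX + (w + 1)) + i) = sA i) ∧
    (∀ i, i < nK → s (nK + (cA + cE) + (B + (1 + nX + (w + 1) + nY)) + i) = load (str k) i) ∧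
    ∀ i, nK + (cA + cE) + (B + (1 + nX + (w + 1) + nY)) + (nK + (cA + cE)) ≤ i → s i = false := by
  rw [extractCirc, runC_append, runC_append, runC_append] at hs
  obtain ⟨I, hI⟩ : ∃ I, nK + (cA + cE) = I := ⟨_, rfl⟩
  obtain ⟨P, hP⟩ : ∃ P, I + (B + (1 + nX + (w + 1) + nY)) = P := ⟨_, rfl⟩
  rw [hI] at hs ⊢
  rw [hP] at hs ⊢
  have hlen : (str k ++ (str rA ++ str rE)).length = I := by simp [length_str, hI]
  obtain ⟨s₀, hs₀⟩ : ∃ s₀, load (str k ++ (str rA ++ str rE)) = s₀ := ⟨_, rfl⟩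
  obtain ⟨s₁, hs₁⟩ : ∃ s₁, runC (moveBlock 0 P I) s₀ = s₁ := ⟨_, rfl⟩
  have h₁ : ∀ i, s₁ i = if P ≤ i ∧ i < P + I then s₀ (i - P) else false := fun i => by
    have hz : ∀ i, I ≤ i → s₀ i = false := fun i hi => by
      rw [← hs₀]; exact load_of_length_le (by omega)
    rw [← hs₁, runC_moveBlock (by omega) (fun i hi _ => hz i (by omega)), Nat.zero_add]
    by_cases hi : P ≤ i ∧ i < P + I
    · rw [if_pos hi, if_pos hi]
    · rw [if_neg hi, if_neg hi]
      split_ifs with h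
      · rfl
      · exact hz i (by omega)
  -- the part of the input that `A` gets
  have kr : ∀ s : Wires, (∀ i, P ≤ i → i < P + I → s i = s₀ (i - P)) →
      str (slice s P (nK + cA)) = str k ++ str rA := fun s hs => by
    refine str_slice_eq (by simp [length_str]) fun i hi => ?_
    rw [hs _ (by omega) (by omega), Nat.add_sub_cancel_left, ← hs₀, ← List.append_assoc, load_append,
      if_pos (by simpa [length_str] using hi)]
  have kr' : ∀ s : Wires, (∀ i, P ≤ i → i < P + I → s i = s₀ (i - P)) →
      str (slice s (P + (nK + cA)) cE) = str rE := fun s hs => by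
    refine str_slice_eq (length_str _) fun i hi => ?_
    rw [hs _ (by omega) (by omega), ← hs₀, ← List.append_assoc, load_append,
      if_neg (by simp [length_str]; omega)]
    congr 1
    simp only [List.length_append, length_str]
    omega
  rw [hs₀, hs₁] at hs
  obtain ⟨s₂, hs₂⟩ : ∃ s₂, runC (call (P + I) [(P, nK + cA)] CA nY (B + (1 + nX)) (w + 1)) s₁ = s₂ :=
    ⟨_, rfl⟩
  have h₂ : ∀ i, s₂ i = if B + (1 + nX) ≤ i ∧ i < B + (1 + nX) + (w + 1) then
      sA (nY + (i - (B + (1 + nX)))) else s₁ i := fun i => by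
    rw [← hs₂, runC_call]
    · split_ifs with h
      · rw [h₁, if_neg (by omega), Bool.false_xor, hA]
        simp only [readBlocks, List.flatMap_cons, List.flatMap_nil, List.append_nil]
        rw [kr s₁ fun i hi hi' => by rw [h₁, if_pos ⟨hi, hi'⟩]]
      · rfl
    · exact fun i hi => by rw [h₁, if_neg (by omega)]
    · simp only [List.mem_singleton, forall_eq]; omega
    · omega
  rw [hs₂] at hs
  obtain ⟨s₃, hs₃⟩ : ∃ s₃, runC (call (P + I) [(P, nK + cA)] CA 0 (B + (1 + nX + (w + 1))) nY) s₂ =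
    s₃ := ⟨_, rfl⟩
  have h₃ : ∀ i, s₃ i = if B + (1 + nX + (w + 1)) ≤ i ∧ i < B + (1 + nX + (w + 1)) + nY then
      sA (i - (B + (1 + nX + (w + 1)))) else s₂ i := fun i => by
    rw [← hs₃, runC_call]
    · split_ifs with h
      · rw [h₂, if_neg (by omega), h₁, if_neg (by omega), Bool.false_xor, hA, Nat.zero_add]
        simp only [readBlocks, List.flatMap_cons, List.flatMap_nil, List.append_nil]
        rw [kr s₂ fun i hi hi' => by rw [h₂, if_neg (by omega), h₁, if_pos ⟨hi, hi'⟩]]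
      · rfl
    · exact fun i hi => by rw [h₂, if_neg (by omega), h₁, if_neg (by omega)]
    · simp only [List.mem_singleton, forall_eq]; omega
    · omega
  rw [hs₃] at hs
  have h₄ : ∀ i, s i = if B ≤ i ∧ i < B + (1 + nX) then sE (i - B) else s₃ i := fun i => by
    have hin : ∀ i, P ≤ i → i < P + I → s₃ i = s₀ (i - P) := fun i hi hi' => by
      rw [h₃, if_neg (by omega), h₂, if_neg (by omega), h₁, if_pos ⟨hi, hi'⟩]
    rw [hs, runC_call]
    · split_ifs with h
      · rw [h₃, if_neg (by omega), h₂, if_neg (by omega), h₁, if_neg (by omega), Bool.false_xor, hE,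
          Nat.zero_add]
        simp only [readBlocks, List.flatMap_cons, List.flatMap_nil, List.append_nil]
        rw [kr s₃ hin, kr' s₃ hin, slice_congr (s' := sA) (a' := 0) fun i hi => by
          rw [h₃, if_pos (by omega), Nat.add_sub_cancel_left, Nat.zero_add], List.append_assoc,
          List.append_assoc, List.append_assoc]
      · rfl
    · exact fun i hi => by
        rw [h₃, if_neg (by omega), h₂, if_neg (by omega), h₁, if_neg (by omega)]
    · simp only [List.mem_cons, List.not_mem_nil, or_false, forall_eq_or_imp, forall_eq]; omega
    · omega
  refine ⟨fun i hi => ?_, fun i hi => ?_, fun i hi => ?_, fun i hi => ?_, fun i hi => ?_,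
    fun i hi => ?_⟩
  · rw [h₄, if_neg (by omega), h₃, if_neg (by omega), h₂, if_neg (by omega), h₁, if_neg (by omega)]
  · rw [h₄, if_pos (by omega), Nat.add_sub_cancel_left]
  · rw [h₄, if_neg (by omega), h₃, if_neg (by omega), h₂, if_pos (by omega), Nat.add_sub_cancel_left]
  · rw [h₄, if_neg (by omega), h₃, if_pos (by omega), Nat.add_sub_cancel_left]
  · rw [h₄, if_neg (by omega), h₃, if_neg (by omega), h₂, if_neg (by omega), h₁, if_pos (by omega),
      Nat.add_sub_cancel_left, ← hs₀, load_append, if_pos (by simpa [length_str] using hi)]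
  · rw [h₄, if_neg (by omega), h₃, if_neg (by omega), h₂, if_neg (by omega), h₁, if_neg (by omega)]

end Extract

end PoQ

namespace PoQ

/-! ## Soundness -/

section Soundness

variable {S : Setting} (F : NTCFData S) (G : TIFData S)

theorem polyLength_extract (A E : PPTAlg) (B : ℕ) :
    PolyLength (fun n => S.nK n + (A.coins n + E.coins n)) ∧
    PolyLength (fun n => B + (1 + S.nX n)) ∧
    PolyLength (fun n => B + (1 + S.nX n + (F.w n + 1))) ∧
    PolyLength (fun n => S.nK n + (A.coins n + E.coins n) +
      (B + (1 + S.nX n + (F.w n + 1) + S.nY n))) := by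
  have hI := S.nK_length.add (A.coins_length.add E.coins_length)
  have hB := polyLength_const B
  have h1 := (polyLength_const 1).add S.nX_length
  have hw := F.w_length.add (polyLength_const 1)
  exact ⟨hI, hB.add h1, hB.add (h1.add hw), hI.add (hB.add ((h1.add hw).add S.nY_length))⟩

theorem uniform_extractCirc (A E : PPTAlg) (B : ℕ) :
    UniformCircuits fun n => extractCirc (A.circ n) (E.circ n) B (S.nK n) (A.coins n) (E.coins n)
      (S.nX n) (S.nY n) (F.w n) := by
  obtain ⟨hI, hD, hY, hP⟩ := polyLength_extract F A E B
  have hB := polyLength_const B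
  have h0 := polyLength_const 0
  have hO := hP.add hI
  have hkA := S.nK_length.add A.coins_length
  refine (h0.moveBlock hP hI).append (UniformCircuits.append ?_ (UniformCircuits.append ?_ ?_))
  · exact A.uniform.call hO S.nY_length hD (F.w_length.add (polyLength_const 1))
      [(_, _)] (by simpa using ⟨hP, hkA⟩)
  · exact A.uniform.call hO h0 hY S.nY_length [(_, _)] (by simpa using ⟨hP, hkA⟩)
  · exact E.uniform.call hO h0 hB ((polyLength_const 1).add S.nX_length)
      [(_, _), (_, _), (_, _)] (by
        simpa using ⟨⟨hP, hkA⟩, ⟨hY, S.nY_length⟩, hP.add hkA, E.coins_length⟩)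

theorem allClassical_extractCirc {CA CE : List Gate} (hA : AllClassical CA) (hE : AllClassical CE)
    (B nK cA cE nX nY w : ℕ) : AllClassical (extractCirc CA CE B nK cA cE nX nY w) :=
  (allClassical_moveBlock _ _ _).append ((hA.call _ _ _ _ _).append ((hA.call _ _ _ _ _).append
    (hE.call _ _ _ _ _)))

/-- The adversary against the adaptive hardcore bit property: run the prover `A` and the extractor
`E`. -/
def adversary (A E : PPTAlg) : PPTAlg where
  circ n := extractCirc (A.circ n) (E.circ n) 0 (S.nK n) (A.coins n) (E.coins n)
      (S.nX n) (S.nY n) (F.w n)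
  uniform := uniform_extractCirc F A E 0
  classical n := allClassical_extractCirc (A.classical n) (E.classical n) _ _ _ _ _ _ _
  coins n := A.coins n + E.coins n
  coins_length := A.coins_length.add E.coins_length

/-- The distinguisher of keys: run the prover `A`, the extractor `E`, and the check algorithm. -/
def distinguisher (A E : PPTAlg) (chk : DetAlg) : PPTAlg where
  circ n := extractCirc (A.circ n) (E.circ n) 1 (S.nK n) (A.coins n) (E.coins n)
      (S.nX n) (S.nY n) (F.w n) ++
    call (S.nK n + (A.coins n + E.coins n) + (1 + (1 + S.nX n + (F.w n + 1) + S.nY n)) +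
        (S.nK n + (A.coins n + E.coins n)))
      [(S.nK n + (A.coins n + E.coins n) + (1 + (1 + S.nX n + (F.w n + 1) + S.nY n)), S.nK n),
        (1 + (1 + S.nX n + (F.w n + 1)), S.nY n), (2, S.nX n), (1, 1)] (chk.circ n) 0 0 1
  uniform := by
    obtain ⟨hI, hD, hY, hP⟩ := polyLength_extract F A E 1
    refine (uniform_extractCirc F A E 1).append ?_
    exact chk.uniform.call (hP.add hI) (polyLength_const 0) (polyLength_const 0)
      (polyLength_const 1) [(_, _), (_, _), (_, _), (_, _)] (by
        simpa using ⟨⟨hP, S.nK_length⟩, ⟨hY, S.nY_length⟩, ⟨polyLength_const 2, S.nX_length⟩,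
          polyLength_const 1⟩)
  classical n := (allClassical_extractCirc (A.classical n) (E.classical n) _ _ _ _ _ _ _).append
    (AllClassical.call (chk.classical n) _ _ _ _ _)
  coins n := A.coins n + E.coins n
  coins_length := A.coins_length.add E.coins_length

variable {F G}

/-- The string `y` in the reply of `A`. -/
def replyY (S : Setting) (A : PPTAlg) (n : ℕ) (k : Bits (S.nK n)) (rA : A.Coins n) : Bits (S.nY n) :=
  slice (A.runWith n (str k) rA) 0 (S.nY n)

/-- The final wires of the extractor after a run of `A`. -/
def extractorWires (S : Setting) (A E : PPTAlg) (n : ℕ) (k : Bits (S.nK n)) (rA : A.Coins n)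
    (rE : E.Coins n) : Wires :=
  E.runWith n (str k ++ str rA ++ str (replyY S A n k rA)) rE

/-- With `B = 0` the blocks `(b, x)` and `(d, c)` are adjacent from wire 0 on, in the order in which
`readAHCB` expects them. -/
theorem readAHCB_adversary (A E : PPTAlg) (n : ℕ) (k : Bits (S.nK n))
    (r : (adversary F A E).Coins n) :
    let rr := halves (A.coins n) (E.coins n) r
    F.readAHCB n ((adversary F A E).runWith n (str k) r) =
      (extractorWires S A E n k rr.1 rr.2 0, slice (extractorWires S A E n k rr.1 rr.2) 1 (S.nX n),
        (readMessage F n (A.runWith n (str k) rr.1)).2) := by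
  intro rr
  obtain ⟨-, h₂, h₃, -⟩ := runC_extractCirc (A.circ n) (E.circ n) 0 (S.nK n) (A.coins n) (E.coins n)
      (S.nX n) (S.nY n) (F.w n) k rr.1 rr.2 (s := (adversary F A E).runWith n (str k) r)
      (by rw [← show str r = str rr.1 ++ str rr.2 from str_halves r]; rfl) rfl rfl
  simp only [Nat.zero_add] at h₂ h₃
  refine Prod.ext (h₂ 0 (by omega)) (Prod.ext ?_ (Prod.ext ?_ ?_))
  · exact slice_congr fun i hi => h₂ (1 + i) (by omega)
  · exact slice_congr fun i hi => h₃ i (by omega)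
  · exact h₃ (F.w n) (by omega)

/-- With `B = 1` wire 0 is still empty after the extraction and receives the verdict of the check
algorithm on the extracted pair. -/
theorem distinguisher_zero (A E : PPTAlg) (chk : DetAlg) (n : ℕ) (k : Bits (S.nK n))
    (r : (distinguisher F A E chk).Coins n) :
    let rr := halves (A.coins n) (E.coins n) r
    let sE := extractorWires S A E n k rr.1 rr.2
    (distinguisher F A E chk).runWith n (str k) r 0 =
      chk.run n (str k ++ str (replyY S A n k rr.1) ++ str (slice sE 1 (S.nX n)) ++ [sE 0]) 0 := by
  intro rr sE
  obtain ⟨s, hs⟩ : ∃ s, runC (extractCirc (A.circ n) (E.circ n) 1 (S.nK n) (A.coins n) (E.coins n)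
      (S.nX n) (S.nY n) (F.w n)) (load (str k ++ str r)) = s := ⟨_, rfl⟩
  obtain ⟨h₁, h₂, -, h₄, h₅, h₆⟩ := runC_extractCirc (A.circ n) (E.circ n) 1 (S.nK n) (A.coins n)
      (E.coins n) (S.nX n) (S.nY n) (F.w n) k rr.1 rr.2 (s := s)
      (by rw [← show str r = str rr.1 ++ str rr.2 from str_halves r]; exact hs.symm) rfl rfl
  have h : (distinguisher F A E chk).runWith n (str k) r =
      runC (call (S.nK n + (A.coins n + E.coins n) + (1 + (1 + S.nX n + (F.w n + 1) + S.nY n)) +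
        (S.nK n + (A.coins n + E.coins n)))
      [(S.nK n + (A.coins n + E.coins n) + (1 + (1 + S.nX n + (F.w n + 1) + S.nY n)), S.nK n),
        (1 + (1 + S.nX n + (F.w n + 1)), S.nY n), (2, S.nX n), (1, 1)] (chk.circ n) 0 0 1) s := by
    rw [← hs]
    exact runC_append _ _ _
  rw [h, runC_call _ h₆ _ (by omega), if_pos (by omega), h₁ 0 (by omega), Bool.false_xor]
  · rw [DetAlg.run]
    congr 2
    simp only [readBlocks, List.flatMap_cons, List.flatMap_nil, List.append_nil]
    rw [str_slice_eq (length_str k) h₅, List.append_assoc, List.append_assoc]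
    refine congrArg₂ _ rfl (congrArg₂ _ ?_ (congrArg₂ _ ?_ ?_))
    · exact congrArg str (slice_congr fun i hi => (h₄ i hi).trans (by rw [Nat.zero_add]; rfl))
    · exact congrArg str (slice_congr fun i hi => by
        rw [show 2 + i = 1 + (1 + i) by omega]
        exact h₂ (1 + i) (by omega))
    · exact str_slice_eq rfl fun i hi => by
        obtain rfl : i = 0 := by omega
        exact h₂ 0 (by omega)
  · simp only [List.mem_cons, List.not_mem_nil, or_false, forall_eq_or_imp, forall_eq]
    omega

/-- Wires without input carry `0`, so zero padding at the end is invisible. This reconciles the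
algorithms of `F`, run on the bare bit, with those of `G`, run on the padded one. -/
theorem load_append_padBit (l : List Bool) {m : ℕ} (hm : 0 < m) (b : Bool) :
    load (l ++ str (padBit m b)) = load (l ++ [b]) := by
  funext i
  rw [load_append, load_append]
  split_ifs with h
  · rfl
  · rcases Nat.eq_zero_or_pos (i - l.length) with h0 | h0
    · rw [h0, load_str _ hm]
      simp [padBit, load]
    · rw [load_of_length_le (l := [b]) h0]
      by_cases h' : i - l.length < m
      · rw [load_str _ h']
        simp [padBit, h0.ne']
      · exact load_of_length_le (by rw [length_str]; omega)

/-- For a good key, `x_b ∈ X_b` determines the other end of its claw, and then `d` determines `c`.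
-/
theorem not_mem_H_and_Hbar (hF : IsNTCF F) {n : ℕ} {k : F.K n} {t : F.T n} (hkt : (k, t) ∈ F.I n)
    {p : Bool × Bits (S.nX n) × Bits (F.w n) × Bool} (h : p ∈ F.H n k) (h' : p ∈ F.Hbar n k) :
    False := by
  obtain ⟨b, x, d, c⟩ := p
  obtain ⟨x₀, x₁, hc, hx, hX, -, -, hd⟩ := h
  obtain ⟨x₀', x₁', hc', hx', hX', -, -, hd'⟩ := h'
  simp only at hx hX hd hx' hX' hd'
  have : x₀ = x₀' ∧ x₁ = x₁' := by
    cases b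
    · have e : x₀ = x₀' := Subtype.ext (hx.symm.trans hx')
      subst e
      exact ⟨rfl, (hF.pair₀ n k t hkt x₀ hX).unique hc hc'⟩
    · have e : x₁ = x₁' := Subtype.ext (hx.symm.trans hx')
      subst e
      exact ⟨(hF.pair₁ n k t hkt x₁ hX).unique hc hc', rfl⟩
  rw [this.1, this.2, ← hd'] at hd
  cases c <;> simp at hd

/-- Acceptance by the check puts `y` in the support of the approximating density at `x`, so `x` is
what the trapdoor inversion returns, namely the end `x_b` of the claw that the verifier has tested.
-/
theorem mem_H_of_eqTest (hF : IsNTCF F) {n : ℕ} {k : F.K n} {t : F.T n} (hkt : (k, t) ∈ F.I n)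
    {m : Message F n} (hm : m ∈ eqTest F n k t) {b : Bool} {x : Bits (S.nX n)} (hx : x ∈ S.X n)
    (hchk : F.Check n k m.1 b x) : (b, x, m.2) ∈ F.H n k := by
  obtain ⟨hY, x₀, x₁, h₀, h₁, -, -, hc, hX₀, hX₁, hdot, hd₀, hd₁⟩ := hm
  have hb := hF.invert_fr n k t hkt b ⟨x, hx⟩ ⟨m.1, hY⟩ ((hF.check n k b ⟨x, hx⟩ ⟨m.1, hY⟩).1 hchk)
  refine ⟨x₀, x₁, hc, ?_, ?_, hd₀, hd₁, hdot.symm⟩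
  · cases b
    · exact hb.symm.trans h₀
    · exact hb.symm.trans h₁
  · cases b
    · exact hX₀
    · exact hX₁

/-- The check algorithm accepts the output of the extractor. -/
def ExtractOK (chk : DetAlg) (A E : PPTAlg) (n : ℕ) (k : Bits (S.nK n)) (rA : A.Coins n)
    (rE : E.Coins n) : Prop :=
  let sE := extractorWires S A E n k rA rE
  chk.run n (str k ++ str (replyY S A n k rA) ++ str (slice sE 1 (S.nX n)) ++ [sE 0]) 0 = true

/-- The test ignores the extractor's coins. Adding them places all events on one probability space,
where union bounds apply. -/
theorem avg_prob_eq {Ω α β : Type} [Fintype Ω] [Fintype α] [Fintype β] [Nonempty β]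
    (Q : Ω → α → Prop) :
    avg (fun r => prob fun a => Q r a) = prob fun p : Ω × α × β => Q p.1 p.2.1 := by
  rw [prob_prod]
  exact congrArg avg (funext fun r => (prob_fst (Ω' := β) (Q r)).symm)

/-- `CompIndist` measures the output `false`, which here means rejection, hence the complement. -/
theorem prob_distinguisher (A E : PPTAlg) (chk : DetAlg) (n : ℕ) {Ω : Type} [Fintype Ω] [Nonempty Ω]
    (key : Ω → Bits (S.nK n)) :
    prob (fun p : Ω × (distinguisher F A E chk).Coins n =>
      (distinguisher F A E chk).runWith n (str (key p.1)) p.2 0 = false) =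
    1 - prob fun p : Ω × A.Coins n × E.Coins n => ExtractOK chk A E n (key p.1) p.2.1 p.2.2 := by
  rw [← prob_not, ← prob_halves]
  congr 1
  funext p
  rw [distinguisher_zero, ExtractOK, Bool.not_eq_true]

theorem prob_adversary (A E : PPTAlg) (n : ℕ) {Ω : Type} [Fintype Ω]
    (key : Ω → Bits (S.nK n)) (H : Ω → Set (Bool × Bits (S.nX n) × Bits (F.w n) × Bool)) :
    prob (fun p : Ω × (adversary F A E).Coins n =>
      F.readAHCB n ((adversary F A E).runWith n (str (key p.1)) p.2) ∈ H p.1) =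
    prob fun p : Ω × A.Coins n × E.Coins n =>
      (extractorWires S A E n (key p.1) p.2.1 p.2.2 0,
        slice (extractorWires S A E n (key p.1) p.2.1 p.2.2) 1 (S.nX n),
        (readMessage F n (A.runWith n (str (key p.1)) p.2.1)).2) ∈ H p.1 := by
  rw [← prob_halves]
  congr 1
  funext p
  rw [readAHCB_adversary]

/-- The extractor fails on an image. -/
def ExtractBad (G : TIFData S) {A E : PPTAlg}
    (hE : ∀ n (k : Bits (S.nK n)) (r : A.Coins n) (y : Bits (S.nY n)) (r' : E.Coins n),
      slice (E.runWith n (str k ++ str r ++ str y) r') 1 (S.nX n) ∈ S.X n) (n : ℕ)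
    (k : G.K n) (rA : A.Coins n) (rE : E.Coins n) : Prop :=
  ∃ y : S.Y n, y.1 = slice (A.runWith n (str k.1) rA) 0 (S.nY n) ∧
    ¬ 0 < (G.g n k (G.bit n (E.runWith n (str k.1 ++ str rA ++ str y.1) rE 0))
        (G.incl n ⟨_, hE n k.1 rA y.1 rE⟩) : S.Y n → ℝ) y ∧
    ∃ (b' : Bool) (x' : S.X n), 0 < (G.g n k (G.bit n b') (G.incl n x') : S.Y n → ℝ) y

/-- For a good key, inversion returns a pair in `{0, 1} × X`. An accepting check therefore certifies
that `y` is an image, which is precisely when the extractor is obliged to succeed. -/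
theorem extractOK_of_imTest (hG : IsTrapdoorInjective G) {A E : PPTAlg} {n : ℕ}
    (hE : ∀ n (k : Bits (S.nK n)) (r : A.Coins n) (y : Bits (S.nY n)) (r' : E.Coins n),
      slice (E.runWith n (str k ++ str r ++ str y) r') 1 (S.nX n) ∈ S.X n)
    {k : G.K n} {t : G.T n} (hkt : (k, t) ∈ G.I n) {rA : A.Coins n} {rE : E.Coins n}
    (him : readMessage F n (A.runWith n (str k.1) rA) ∈ imTest F G n k t) :
    ExtractOK G.chk A E n k.1 rA rE ∨ ExtractBad G hE n k rA rE := by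
  obtain ⟨hY, hchk⟩ := him
  have hY' : replyY S A n k.1 rA ∈ S.Y n := hY
  have hsupp := (hG.check n k (G.bit n _)
    (G.incl n ⟨_, hG.invert_mem n k t hkt _ hY⟩) ⟨_, hY⟩).1 hchk
  by_cases hpos : 0 < (G.g n k
      (G.bit n (E.runWith n (str k.1 ++ str rA ++ str (replyY S A n k.1 rA)) rE 0))
      (G.incl n ⟨_, hE n k.1 rA (replyY S A n k.1 rA) rE⟩) : S.Y n → ℝ) ⟨_, hY'⟩
  · have := (hG.check n k _ _ _).2 hpos
    rw [TIFData.Check, DetAlg.run, TIFData.bit, load_append_padBit _ (G.nB_pos n)] at this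
    exact .inl this
  · exact .inr ⟨⟨_, hY'⟩, rfl, hpos, _, _, hsupp⟩

theorem soundness (hFG : IsE2NTCF F G) (A : PPTAlg) :
    ∃ μ : ℕ → ℝ, Negligible μ ∧ ∀ n, successPPT F G A n ≤ 3 / 4 + μ n := by
  obtain ⟨hF, hG, hinv, hext⟩ := hFG
  obtain ⟨E, hE, hbad⟩ := hext A
  have hdist := hinv.keys (distinguisher F A E G.chk)
  have hahcb := hF.ahcb (adversary F A E)
  have hbad : Negligible fun n =>
    prob fun p : G.gen.alg.Coins n × A.Coins n × E.Coins n =>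
      ExtractBad G hE n (G.gen.key n p.1) p.2.1 p.2.2 := hbad
  -- Bad keys of `F` enter twice, in placing a tuple in `H` and in keeping `H` and `Hbar` apart; the
  -- coefficient `2` is generous.
  have neg := ((hF.good.const_mul 2).add ((hdist.add hahcb).add (hbad.add hG.good)))
  refine ⟨_, neg, fun n => ?_⟩
  have d₁ := prob_distinguisher (F := F) A E G.chk n fun r => (F.gen.key n r).1
  have d₂ := prob_distinguisher (F := F) A E G.chk n fun r => (G.gen.key n r).1
  have a₁ := prob_adversary (F := F) A E n (fun r => (F.gen.key n r).1) fun r =>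
    F.H n (F.gen.key n r)
  have a₂ := prob_adversary (F := F) A E n (fun r => (F.gen.key n r).1) fun r =>
    F.Hbar n (F.gen.key n r)
  beta_reduce at d₁ d₂ a₁ a₂ ⊢
  rw [d₁, d₂, a₁, a₂, successPPT, acceptProb,
    avg_prob_eq (β := E.Coins n), avg_prob_eq (β := E.Coins n)]
  have gF := prob_fst (Ω' := A.Coins n × E.Coins n) fun r : F.gen.alg.Coins n =>
    (F.gen.key n r, F.gen.trap n r) ∉ F.I n
  have gG := prob_fst (Ω' := A.Coins n × E.Coins n) fun r : G.gen.alg.Coins n =>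
    (G.gen.key n r, G.gen.trap n r) ∉ G.I n
  have im := (prob_mono fun (p : G.gen.alg.Coins n × A.Coins n × E.Coins n)
    (him : readMessage F n (A.runWith n (str (G.gen.key n p.1).1) p.2.1) ∈
      imTest F G n (G.gen.key n p.1) (G.gen.trap n p.1)) =>
    show ExtractOK G.chk A E n (G.gen.key n p.1).1 p.2.1 p.2.2 ∨
        (ExtractBad G hE n (G.gen.key n p.1) p.2.1 p.2.2 ∨
          (G.gen.key n p.1, G.gen.trap n p.1) ∉ G.I n) from
      (em _).elim (fun hI => (extractOK_of_imTest hG hE hI him).imp id .inl)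
        fun hI => .inr (.inr hI)).trans ((prob_or_le _ _).trans (add_le_add_right (prob_or_le _ _) _))
  -- Passing the equation test and successful extraction overlap with probability at least the sum
  -- of their probabilities minus `1`.
  have eq := prob_add_le (fun p : F.gen.alg.Coins n × A.Coins n × E.Coins n =>
    readMessage F n (A.runWith n (str (F.gen.key n p.1).1) p.2.1) ∈
      eqTest F n (F.gen.key n p.1) (F.gen.trap n p.1))
    (fun p => ExtractOK G.chk A E n (F.gen.key n p.1).1 p.2.1 p.2.2)
  have eqH : ∀ p : F.gen.alg.Coins n × A.Coins n × E.Coins n,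
      (readMessage F n (A.runWith n (str (F.gen.key n p.1).1) p.2.1) ∈
        eqTest F n (F.gen.key n p.1) (F.gen.trap n p.1) ∧
      ExtractOK G.chk A E n (F.gen.key n p.1).1 p.2.1 p.2.2) →
      (extractorWires S A E n (F.gen.key n p.1).1 p.2.1 p.2.2 0,
        slice (extractorWires S A E n (F.gen.key n p.1).1 p.2.1 p.2.2) 1 (S.nX n),
        (readMessage F n (A.runWith n (str (F.gen.key n p.1).1) p.2.1)).2) ∈ F.H n (F.gen.key n p.1) ∨
      (F.gen.key n p.1, F.gen.trap n p.1) ∉ F.I n := fun p ⟨h₁, h₂⟩ => by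
    by_cases hI : (F.gen.key n p.1, F.gen.trap n p.1) ∈ F.I n
    · refine .inl (mem_H_of_eqTest hF hI h₁ (hE n _ _ _ _) ?_)
      rw [NTCFData.Check, hinv.chk_eq]
      exact h₂
    · exact .inr hI
  have eq' := (prob_mono eqH).trans (prob_or_le _ _)
  have hh := prob_add_le (fun p : F.gen.alg.Coins n × A.Coins n × E.Coins n =>
      (extractorWires S A E n (F.gen.key n p.1).1 p.2.1 p.2.2 0,
        slice (extractorWires S A E n (F.gen.key n p.1).1 p.2.1 p.2.2) 1 (S.nX n),
        (readMessage F n (A.runWith n (str (F.gen.key n p.1).1) p.2.1)).2) ∈ F.H n (F.gen.key n p.1))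
      (fun p => (extractorWires S A E n (F.gen.key n p.1).1 p.2.1 p.2.2 0,
        slice (extractorWires S A E n (F.gen.key n p.1).1 p.2.1 p.2.2) 1 (S.nX n),
        (readMessage F n (A.runWith n (str (F.gen.key n p.1).1) p.2.1)).2) ∈
          F.Hbar n (F.gen.key n p.1))
  have hh' := prob_mono fun (p : F.gen.alg.Coins n × A.Coins n × E.Coins n)
      (h : (extractorWires S A E n (F.gen.key n p.1).1 p.2.1 p.2.2 0,
        slice (extractorWires S A E n (F.gen.key n p.1).1 p.2.1 p.2.2) 1 (S.nX n),
        (readMessage F n (A.runWith n (str (F.gen.key n p.1).1) p.2.1)).2) ∈ F.H n (F.gen.key n p.1) ∧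
      (extractorWires S A E n (F.gen.key n p.1).1 p.2.1 p.2.2 0,
        slice (extractorWires S A E n (F.gen.key n p.1).1 p.2.1 p.2.2) 1 (S.nX n),
        (readMessage F n (A.runWith n (str (F.gen.key n p.1).1) p.2.1)).2) ∈
          F.Hbar n (F.gen.key n p.1)) =>
      show (F.gen.key n p.1, F.gen.trap n p.1) ∉ F.I n from
        fun hI => not_mem_H_and_Hbar hF hI h.1 h.2
  rw [gG] at im
  rw [gF] at eq' hh'
  -- The bounds on `h + h'` and `|h - h'|` give `h ≤ 1/2` up to errors. The overlap bound then gives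
  -- `peq + pim ≤ 3/2` up to errors, and the fair coin halves this.
  have key : ∀ peq pim okF okG bad gF gG eqok h h' hh : ℝ, pim ≤ okG + (bad + gG) →
      peq + okF ≤ 1 + eqok → eqok ≤ h + gF → h + h' ≤ 1 + hh → hh ≤ gF → 0 ≤ gF → 0 ≤ gG →
      0 ≤ bad → 1 / 2 * peq + 1 / 2 * pim ≤
        3 / 4 + (2 * gF + (|1 - okF - (1 - okG)| + |h - h'| + (bad + gG))) := by
    intro peq pim okF okG bad gF gG eqok h h' hh _ _ _ _ _ _ _ _
    have h₁ := abs_nonneg (1 - okF - (1 - okG))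
    have h₂ := le_abs_self (1 - okF - (1 - okG))
    have h₃ := le_abs_self (h - h')
    have h₄ := abs_nonneg (h - h')
    linarith
  exact key _ _ _ _ _ _ _ _ _ _ _ im eq eq' hh hh' (prob_nonneg _) (prob_nonneg _) (prob_nonneg _)

end Soundness

end PoQ

namespace PoQ

/-! ## Quantum circuits -/

section Quantum

theorem runQ_append (C D : List Gate) (ψ : QState) : runQ (C ++ D) ψ = runQ D (runQ C ψ) :=
  List.foldl_append

/-- The action of a circuit as a linear map. -/
noncomputable def runLin (C : List Gate) : QState →ₗ[ℂ] QState where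
  toFun := runQ C
  map_add' ψ φ := by
    induction C generalizing ψ φ with
    | nil => rfl
    | cons g C ih =>
      simp only [runQ, List.foldl_cons, map_add]
      exact ih _ _
  map_smul' a ψ := by
    induction C generalizing ψ with
    | nil => rfl
    | cons g C ih =>
      simp only [runQ, List.foldl_cons, map_smul]
      exact ih _

theorem runLin_apply (C : List Gate) (ψ : QState) : runLin C ψ = runQ C ψ := rfl

theorem apply_ket (g : Gate) (s : Wires) : g.apply (ket s) = g.onKet s := by
  rw [Gate.apply, ket, Finsupp.linearCombination_single, one_smul]

theorem onKet_of_isClassical {g : Gate} (hg : g.IsClassical) (s : Wires) :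
    g.onKet s = ket (g.act s) := by
  cases g <;> first | rfl | exact hg.elim

theorem runQ_ket {C : List Gate} (hC : AllClassical C) (s : Wires) :
    runQ C (ket s) = ket (runC C s) := by
  induction C generalizing s with
  | nil => rfl
  | cons g C ih =>
    rw [runC_cons, ← ih fun g hg => hC g (List.mem_cons_of_mem _ hg)]
    change runQ C (g.apply (ket s)) = _
    rw [apply_ket, onKet_of_isClassical (hC g List.mem_cons_self)]

open scoped Classical in
-- A classical gate permutes the basis states and is its own inverse, so the coefficient at `u`
-- comes from `g.act u`.
theorem apply_of_isClassical {g : Gate} (hg : g.IsClassical) (ψ : QState) (u : Wires) :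
    g.apply ψ u = ψ (g.act u) := by
  induction ψ using Finsupp.induction_linear with
  | zero => simp
  | add f g hf hg => rw [map_add, Finsupp.add_apply, Finsupp.add_apply, hf, hg]
  | single s a =>
    rw [Gate.apply, Finsupp.linearCombination_single, onKet_of_isClassical hg, ket,
      Finsupp.smul_single, smul_eq_mul, mul_one]
    have : g.act s = u ↔ s = g.act u :=
      ⟨fun h => by rw [← h, Gate.act_act], fun h => by rw [h, Gate.act_act]⟩
    simp only [Finsupp.single_apply, this]

open scoped Classical in
theorem apply_h (i : ℕ) (ψ : QState) (u : Wires) :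
    (Gate.h i).apply ψ u = ((1 / Real.sqrt 2 : ℝ) : ℂ) *
      (ψ (Function.update u i false) + (if u i then -1 else 1) * ψ (Function.update u i true)) := by
  induction ψ using Finsupp.induction_linear with
  | zero => simp
  | add f g hf hg =>
    rw [map_add, Finsupp.add_apply, Finsupp.add_apply, Finsupp.add_apply, hf, hg]
    ring
  | single s a =>
    rw [Gate.apply, Finsupp.linearCombination_single]
    have h₁ : ∀ β, Function.update s i β = u ↔ β = u i ∧ Function.update s i (u i) = u := fun β => by
      constructor
      · intro h
        have h' : β = u i := by rw [← h, Function.update_self]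
        exact ⟨h', h' ▸ h⟩
      · rintro ⟨rfl, h⟩
        exact h
    have h₂ : ∀ β, s = Function.update u i β ↔ β = s i ∧ Function.update s i (u i) = u := fun β => by
      constructor
      · intro h
        refine ⟨by rw [h, Function.update_self], ?_⟩
        rw [h, Function.update_idem, Function.update_eq_self]
      · rintro ⟨rfl, h⟩
        rw [← h, Function.update_idem, Function.update_eq_self]
    generalize (Function.update s i (u i) = u) = P at h₁ h₂
    simp only [Gate.onKet, Finsupp.smul_apply, Finsupp.add_apply, Finsupp.single_apply, smul_eq_mul,
      h₁, h₂]
    by_cases h : P <;> cases s i <;> cases u i <;> simp [h] <;> ring_nf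

theorem normSq_eq_tsum (ψ : QState) : normSq ψ = ∑' u, ‖ψ u‖ ^ 2 := by
  rw [normSq, Finsupp.sum, tsum_eq_sum]
  intro u hu
  simp [Finsupp.notMem_support_iff.1 hu]

theorem summable_normSq (ψ : QState) : Summable fun u => ‖ψ u‖ ^ 2 :=
  summable_of_ne_finset_zero (s := ψ.support) fun u hu => by
    rw [Finsupp.notMem_support_iff.1 hu, norm_zero, zero_pow two_ne_zero]

/-- Flip a wire. -/
def flip (i : ℕ) : Wires ≃ Wires :=
  Function.Involutive.toPerm (fun s => (Gate.x i).act s) (Gate.act_act _)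

/-- A classical gate permutes coefficients. A Hadamard gate acts on the pairs `u`, `flip i u`, where
the parallelogram law applies. The gate `T` can be left out because norm preservation is needed only
for the part of the prover after the state preparation. -/
theorem normSq_apply {g : Gate} (hg : g.IsClassical ∨ ∃ i, g = .h i) (ψ : QState) :
    normSq (g.apply ψ) = normSq ψ := by
  rw [normSq_eq_tsum, normSq_eq_tsum]
  rcases hg with hg | ⟨i, rfl⟩
  · simp only [apply_of_isClassical hg]
    exact (Function.Involutive.toPerm g.act g.act_act).tsum_eq fun u => ‖ψ u‖ ^ 2
  -- Counting every pair twice avoids the choice of a representative.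
  · have key : ∀ φ : QState, 2 * ∑' u, ‖φ u‖ ^ 2 = ∑' u, (‖φ u‖ ^ 2 + ‖φ (flip i u)‖ ^ 2) := fun φ => by
      have h := Summable.tsum_add (summable_normSq φ) ((flip i).summable_iff.2 (summable_normSq φ))
      rw [two_mul]
      exact ((congrArg _ ((flip i).tsum_eq fun u => ‖φ u‖ ^ 2).symm).trans h.symm)
    refine mul_left_cancel₀ two_ne_zero (((key _).trans (tsum_congr fun u => ?_)).trans (key ψ).symm)
    have hp : ∀ a b : ℂ, ‖((1 / Real.sqrt 2 : ℝ) : ℂ) * (a + b)‖ ^ 2 +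
        ‖((1 / Real.sqrt 2 : ℝ) : ℂ) * (a - b)‖ ^ 2 = ‖a‖ ^ 2 + ‖b‖ ^ 2 := fun a b => by
      have := parallelogram_law_with_norm ℝ a b
      have h2 : (1 / Real.sqrt 2) ^ 2 = 1 / 2 := by rw [div_pow, Real.sq_sqrt (by norm_num)]; norm_num
      rw [norm_mul, norm_mul, mul_pow, mul_pow, Complex.norm_real, Real.norm_eq_abs, sq_abs, h2]
      linarith
    have hf : flip i u = Function.update u i (!u i) := rfl
    rw [apply_h, apply_h, hf]
    have hu := Function.update_eq_self i u
    cases h : u i <;> rw [h] at hu <;>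
      simp only [Function.update_idem, Function.update_self, hu, Bool.not_false, Bool.not_true,
        if_true, if_false, Bool.false_eq_true, one_mul, neg_mul, ← sub_eq_add_neg]
    · exact hp _ _
    · rw [add_comm, hp, add_comm]

theorem normSq_runQ {C : List Gate} (hC : ∀ g ∈ C, g.IsClassical ∨ ∃ i, g = .h i) (ψ : QState) :
    normSq (runQ C ψ) = normSq ψ := by
  induction C generalizing ψ with
  | nil => rfl
  | cons g C ih =>
    exact (ih (fun g hg => hC g (List.mem_cons_of_mem _ hg)) _).trans
      (normSq_apply (hC g List.mem_cons_self) ψ)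

open scoped Classical in
theorem measureProb_eq_sum {ψ : QState} {T : Finset Wires} (hT : ψ.support ⊆ T) (E : Wires → Prop) :
    measureProb ψ E = ∑ u ∈ T, if E u then ‖ψ u‖ ^ 2 else 0 :=
  Finsupp.sum_of_support_subset _ hT _ fun u _ => by simp

theorem normSq_eq_measureProb (ψ : QState) : normSq ψ = measureProb ψ fun _ => True := by
  simp [normSq, measureProb]

theorem normSq_eq_sum {ψ : QState} {T : Finset Wires} (hT : ψ.support ⊆ T) :
    normSq ψ = ∑ u ∈ T, ‖ψ u‖ ^ 2 := Finsupp.sum_of_support_subset _ hT _ fun u _ => by simp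

theorem measureProb_nonneg (ψ : QState) (E : Wires → Prop) : 0 ≤ measureProb ψ E :=
  Finset.sum_nonneg fun u _ => by dsimp only; split_ifs <;> positivity

open scoped Classical in
/-- Close states give close measurement results. -/
theorem measureProb_sub_le (ψ φ : QState) (E : Wires → Prop) :
    measureProb φ E - 2 * (Real.sqrt (normSq φ) * Real.sqrt (normSq (ψ - φ))) ≤ measureProb ψ E := by
  have hφ : φ.support ⊆ ψ.support ∪ φ.support := Finset.subset_union_right
  have hψ : ψ.support ⊆ ψ.support ∪ φ.support := Finset.subset_union_left
  have hs : (ψ - φ).support ⊆ ψ.support ∪ φ.support := Finsupp.support_sub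
  have hcs := Real.sum_mul_le_sqrt_mul_sqrt (ψ.support ∪ φ.support) (fun u => ‖φ u‖)
    fun u => ‖(ψ - φ) u‖
  rw [← normSq_eq_sum hφ, ← normSq_eq_sum hs] at hcs
  refine (sub_le_sub_left (mul_le_mul_of_nonneg_left hcs zero_le_two) _).trans ?_
  rw [measureProb_eq_sum hφ, measureProb_eq_sum hψ, Finset.mul_sum, ← Finset.sum_sub_distrib]
  refine Finset.sum_le_sum fun u _ => ?_
  have h : ‖φ u‖ ≤ ‖ψ u‖ + ‖(ψ - φ) u‖ := by
    rw [Finsupp.sub_apply, add_comm, ← sub_le_iff_le_add, norm_sub_rev]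
    exact norm_sub_norm_le _ _
  have h₁ := norm_nonneg (φ u)
  have h₂ := norm_nonneg (ψ u)
  have h₃ := norm_nonneg ((ψ - φ) u)
  -- From `‖φ u‖ ≤ ‖ψ u‖ + ‖(ψ - φ) u‖` one gets `‖φ u‖ ^ 2 - 2 * ‖φ u‖ * ‖(ψ - φ) u‖ ≤ ‖ψ u‖ ^ 2`;
  -- outside `E` the left-hand term is at most `0`.
  split_ifs
  · rcases le_total (‖φ u‖) (‖ψ u‖) with h' | h' <;> nlinarith
  · nlinarith

/-- The measurement of a combination of distinct basis states. -/
theorem measureProb_sum_ket {ι : Type} [Fintype ι] (a : ι → ℂ) {s : ι → Wires}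
    (hs : Function.Injective s) (E : Wires → Prop) [DecidablePred E] :
    measureProb (∑ i, a i • ket (s i)) E = ∑ i, if E (s i) then ‖a i‖ ^ 2 else 0 := by
  classical
  have hval : ∀ j, (∑ i, a i • ket (s i)) (s j) = a j := fun j => by
    rw [Finsupp.finsetSum_apply, Finset.sum_eq_single j]
    · simp [ket]
    · intro i _ hij
      simp [ket, hs.ne hij]
    · simp
  have hsup : (∑ i, a i • ket (s i)).support ⊆ Finset.univ.image s := fun u hu => by
    by_contra h
    refine Finsupp.mem_support_iff.1 hu ?_
    rw [Finsupp.finsetSum_apply]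
    refine Finset.sum_eq_zero fun i _ => ?_
    have : s i ≠ u := fun h' => h (Finset.mem_image.2 ⟨i, Finset.mem_univ _, h'⟩)
    simp [ket, this]
  rw [measureProb_eq_sum hsup, Finset.sum_image fun i _ j _ h => hs h]
  refine Finset.sum_congr rfl fun i _ => ?_
  rw [hval]
  congr

theorem normSq_sum_ket {ι : Type} [Fintype ι] (a : ι → ℂ) {s : ι → Wires}
    (hs : Function.Injective s) : normSq (∑ i, a i • ket (s i)) = ∑ i, ‖a i‖ ^ 2 := by
  classical
  rw [normSq_eq_measureProb, measureProb_sum_ket a hs]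
  simp

theorem normSq_smul (a : ℂ) (ψ : QState) : normSq (a • ψ) = ‖a‖ ^ 2 * normSq ψ := by
  rw [normSq_eq_tsum, normSq_eq_tsum, ← tsum_mul_left]
  simp [mul_pow]

theorem normSq_add_le (ψ φ : QState) : normSq (ψ + φ) ≤ 2 * normSq ψ + 2 * normSq φ := by
  classical
  have h₁ : ψ.support ⊆ ψ.support ∪ φ.support := Finset.subset_union_left
  have h₂ : φ.support ⊆ ψ.support ∪ φ.support := Finset.subset_union_right
  rw [normSq_eq_sum h₁, normSq_eq_sum h₂, normSq_eq_sum Finsupp.support_add, Finset.mul_sum,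
    Finset.mul_sum, ← Finset.sum_add_distrib]
  refine Finset.sum_le_sum fun u _ => ?_
  have h := norm_add_le (ψ u) (φ u)
  have h₃ := norm_nonneg (ψ u + φ u)
  rw [Finsupp.add_apply]
  nlinarith [sq_nonneg (‖ψ u‖ - ‖φ u‖), norm_nonneg (ψ u), norm_nonneg (φ u)]

end Quantum

end PoQ

namespace PoQ

/-! ## Hadamard gates on a block of wires -/

section Hadamard

/-- The sign that belongs to a bit. -/
def sgn (b : Bool) : ℝ := if b then -1 else 1

theorem sgn_sq (b : Bool) : sgn b ^ 2 = 1 := by cases b <;> simp [sgn]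

theorem sgn_xor (a b : Bool) : sgn (xor a b) = sgn a * sgn b := by
  cases a <;> cases b <;> simp [sgn]

theorem sgn_dot {m : ℕ} (u v : Bits m) : sgn (dot u v) = ∏ i, sgn (u i && v i) := by
  have h : ∀ c : ℕ, sgn (decide (Odd c)) = (-1) ^ c := fun c => by
    rcases Nat.even_or_odd c with hc | hc
    · simp [sgn, hc.neg_one_pow, Nat.not_odd_iff_even.2 hc]
    · simp [sgn, hc.neg_one_pow, hc]
  rw [dot, h]
  simp [sgn, Finset.prod_ite]

theorem sgn_dot_bxor {m : ℕ} (d u v : Bits m) :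
    sgn (dot d (bxor u v)) = sgn (dot d u) * sgn (dot d v) := by
  rw [sgn_dot, sgn_dot, sgn_dot, ← Finset.prod_mul_distrib]
  refine Finset.prod_congr rfl fun i _ => ?_
  rw [← sgn_xor, bxor, Bool.and_xor_distrib_left]

theorem sgn_dot_snoc {m : ℕ} (u v : Bits m) (a b : Bool) :
    sgn (dot (Fin.snoc (α := fun _ => Bool) u a : Bits (m + 1)) (Fin.snoc (α := fun _ => Bool) v b)) =
      sgn (dot u v) * sgn (a && b) := by
  rw [sgn_dot, sgn_dot, Fin.prod_univ_castSucc]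
  simp

theorem sum_bits_succ {M : Type*} [AddCommMonoid M] {m : ℕ} (f : Bits (m + 1) → M) :
    ∑ e, f e = ∑ e : Bits m, ∑ b : Bool, f (Fin.snoc (α := fun _ => Bool) e b) := by
  rw [← Fintype.sum_prod_type', ← (Equiv.prodComm _ _).sum_comp,
    ← (Fin.snocEquiv fun _ : Fin (m + 1) => Bool).sum_comp]
  rfl

theorem str_snoc {m : ℕ} (e : Bits m) (b : Bool) :
    str (Fin.snoc (α := fun _ => Bool) e b : Bits (m + 1)) = str e ++ [b] := by
  rw [str, List.ofFn_succ', List.concat_eq_append]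
  simp [str]

/-- Replace the wires from `a` on by the bits `e`. -/
def put (s : Wires) (a : ℕ) {m : ℕ} (e : Bits m) : Wires := fun i =>
  if a ≤ i ∧ i < a + m then load (str e) (i - a) else s i

theorem update_put (s : Wires) (a : ℕ) {m : ℕ} (e : Bits m) (b : Bool) :
    Function.update (put s a e) (a + m) b = put s a (Fin.snoc (α := fun _ => Bool) e b) := by
  funext i
  rcases eq_or_ne i (a + m) with rfl | h
  · rw [Function.update_self, put, if_pos (by omega), str_snoc, load_append, length_str,
      if_neg (by omega), Nat.add_sub_cancel_left, Nat.sub_self]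
    rfl
  · rw [Function.update_of_ne h, put, put]
    by_cases h' : a ≤ i ∧ i < a + m
    · rw [if_pos h', if_pos (by omega), str_snoc, load_append, length_str, if_pos (by omega)]
    · rw [if_neg h', if_neg (by omega)]

theorem slice_succ (s : Wires) (a m : ℕ) :
    slice s a (m + 1) = Fin.snoc (α := fun _ => Bool) (slice s a m) (s (a + m)) :=
  (Fin.snoc_init_self _).symm

theorem onKet_h (i : ℕ) (s : Wires) : (Gate.h i).onKet s =
    ∑ b : Bool, ((1 / Real.sqrt 2 * sgn (s i && b) : ℝ) : ℂ) • ket (Function.update s i b) := by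
  rw [Fintype.sum_bool, add_comm]
  cases h : s i <;> simp [Gate.onKet, ket, sgn, h]

theorem hBlock_succ (a m : ℕ) : hBlock a (m + 1) = hBlock a m ++ [.h (a + m)] := by
  simp [hBlock, List.range_succ]

/-- The gate on wire `a + m` finds that wire unchanged, appends one bit to `e`, and multiplies the
sign by the new factor of the inner product. -/
theorem runQ_hBlock (a m : ℕ) (s : Wires) : runQ (hBlock a m) (ket s) =
    ∑ e : Bits m, (((1 / Real.sqrt 2) ^ m * sgn (dot (slice s a m) e) : ℝ) : ℂ) • ket (put s a e) := by
  induction m with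
  | zero =>
    have : ∀ e : Bits 0, put s a e = s := fun e => funext fun i => if_neg (by omega)
    simp [hBlock, runQ, this, dot, sgn]
  | succ m ih =>
    rw [hBlock_succ, runQ_append, ih, ← runLin_apply, map_sum, sum_bits_succ]
    refine Finset.sum_congr rfl fun e _ => ?_
    rw [map_smul, runLin_apply, show runQ [.h (a + m)] (ket (put s a e)) =
      (Gate.h (a + m)).apply (ket (put s a e)) from rfl, apply_ket, onKet_h, Finset.smul_sum]
    refine Finset.sum_congr rfl fun b _ => ?_
    rw [update_put, smul_smul, slice_succ, sgn_dot_snoc, show put s a e (a + m) = s (a + m) from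
      if_neg (by omega), ← Complex.ofReal_mul]
    congr 2
    ring

theorem hBlock_gates (a m : ℕ) : ∀ g ∈ hBlock a m, ∃ i, g = .h i := fun g hg => by
  obtain ⟨i, -, rfl⟩ := List.mem_map.1 hg
  exact ⟨_, rfl⟩

end Hadamard

/-! ## The classical part of the honest prover -/

section Post

/-- Replace `x` by `J x`, move `y`, `J x`, `b` to the front, and put the key away. -/
def postCirc (DJ DI : List Gate) (nK nX nY w : ℕ) : List Gate :=
  let B := nK + nX + nY
  let Z := B + 1 + (nY + (w + 1))
  let Q := Z + (nY + (w + 1))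
  let O := Q + nK
  call O [(nK, nX)] DJ 0 (Z + nY) w ++ (call O [(Z + nY, w)] DI 0 nK nX ++
    (moveBlock (nK + nX) Z nY ++ (moveBlock B (Z + nY + w) 1 ++ (moveBlock 0 Q nK ++
      moveBlock Z 0 (nY + (w + 1))))))

/-- The wires that contain `y` and `e` at the front, and the key further behind. -/
def outWires {nK nY m : ℕ} (Q : ℕ) (k : Bits nK) (y : Bits nY) (e : Bits m) : Wires := fun i =>
  if i < Q then load (str y ++ str e) i else load (str k) (i - Q)

/-- `J x` is written on fresh wires, and `x` is then cancelled by calling the inverse of `J` on it.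
If `x` stayed behind, it would record which end of the claw is present and destroy the interference.
The key may stay, since it is the same in all branches. -/
theorem runC_postCirc (DJ DI : List Gate) {nK nX nY w : ℕ} (k : Bits nK) (x : Bits nX) (y : Bits nY)
    (b : Bool) (u : Bits w) (hJ : slice (runC DJ (load (str x))) 0 w = u)
    (hI : slice (runC DI (load (str u))) 0 nX = x) :
    runC (postCirc DJ DI nK nX nY w) (load (str k ++ str x ++ str y ++ [b])) =
      outWires (nK + nX + nY + 1 + (nY + (w + 1)) + (nY + (w + 1))) k y
        (Fin.snoc (α := fun _ => Bool) u b : Bits (w + 1)) := by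
  obtain ⟨B, hB⟩ : ∃ B, nK + nX + nY = B := ⟨_, rfl⟩
  obtain ⟨Z, hZ⟩ : ∃ Z, B + 1 + (nY + (w + 1)) = Z := ⟨_, rfl⟩
  obtain ⟨Q, hQ⟩ : ∃ Q, Z + (nY + (w + 1)) = Q := ⟨_, rfl⟩
  simp only [postCirc, runC_append, hB, hZ, hQ]
  obtain ⟨s₀, hs₀⟩ : ∃ s₀, load (str k ++ str x ++ str y ++ [b]) = s₀ := ⟨_, rfl⟩
  have l₁ : (str k ++ str x).length = nK + nX := by simp [length_str]
  have l₂ : (str k ++ str x ++ str y).length = B := by simp [length_str, ← hB, Nat.add_assoc]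
  have h₀k : ∀ i, i < nK → s₀ i = load (str k) i := fun i hi => by
    rw [← hs₀, load_append, l₂, if_pos (by omega), load_append, l₁, if_pos (by omega), load_append,
      length_str, if_pos hi]
  have h₀x : ∀ i, i < nX → s₀ (nK + i) = load (str x) i := fun i hi => by
    rw [← hs₀, load_append, l₂, if_pos (by omega), load_append, l₁, if_pos (by omega), load_append,
      length_str, if_neg (by omega), Nat.add_sub_cancel_left]
  have h₀y : ∀ i, i < nY → s₀ (nK + nX + i) = load (str y) i := fun i hi => by
    rw [← hs₀, load_append, l₂, if_pos (by omega), load_append, l₁, if_neg (by omega),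
      Nat.add_sub_cancel_left]
  have h₀b : s₀ B = b := by
    rw [← hs₀, load_append, l₂, if_neg (by omega), Nat.sub_self]
    rfl
  have h₀z : ∀ i, B < i → s₀ i = false := fun i hi => by
    rw [← hs₀]
    exact load_of_length_le (by rw [List.length_append, l₂]; exact hi)
  rw [hs₀]
  obtain ⟨s₁, hs₁⟩ : ∃ s₁, runC (call (Q + nK) [(nK, nX)] DJ 0 (Z + nY) w) s₀ = s₁ := ⟨_, rfl⟩
  have h₁ : ∀ i, s₁ i = if Z + nY ≤ i ∧ i < Z + nY + w then load (str u) (i - (Z + nY)) else s₀ i :=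
    fun i => by
    rw [← hs₁, runC_call]
    · split_ifs with h
      · rw [h₀z i (by omega), Bool.false_xor, ← hJ, load_str_slice _ (by omega)]
        congr 2
        simp only [readBlocks, List.flatMap_cons, List.flatMap_nil, List.append_nil]
        rw [str_slice_eq (length_str x) h₀x]
      · rfl
    · exact fun i hi => h₀z i (by omega)
    · simp only [List.mem_singleton, forall_eq]; omega
    · omega
  rw [hs₁]
  obtain ⟨s₂, hs₂⟩ : ∃ s₂, runC (call (Q + nK) [(Z + nY, w)] DI 0 nK nX) s₁ = s₂ := ⟨_, rfl⟩
  have h₂ : ∀ i, s₂ i = if nK ≤ i ∧ i < nK + nX then false else s₁ i := fun i => by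
    rw [← hs₂, runC_call]
    · split_ifs with h
      · obtain ⟨j, rfl⟩ := Nat.exists_eq_add_of_le h.1
        have hj : j < nX := by omega
        rw [h₁, if_neg (by omega), h₀x j hj, Nat.add_sub_cancel_left]
        simp only [readBlocks, List.flatMap_cons, List.flatMap_nil, List.append_nil]
        rw [str_slice_eq (length_str u) fun i hi => by
          rw [h₁, if_pos (by omega), Nat.add_sub_cancel_left]]
        rw [← load_str_slice (runC DI (load (str u))) hj, hI, Bool.xor_self]
      · rfl
    · exact fun i hi => by rw [h₁, if_neg (by omega)]; exact h₀z i (by omega)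
    · simp only [List.mem_singleton, forall_eq]; omega
    · omega
  rw [hs₂]
  obtain ⟨s₃, hs₃⟩ : ∃ s₃, runC (moveBlock (nK + nX) Z nY) s₂ = s₃ := ⟨_, rfl⟩
  have h₃ : ∀ i, s₃ i = if Z ≤ i ∧ i < Z + nY then s₂ (nK + nX + (i - Z)) else
      if nK + nX ≤ i ∧ i < nK + nX + nY then false else s₂ i := fun i => by
    rw [← hs₃, runC_moveBlock (by omega)]
    intro i _ _
    rw [h₂, if_neg (by omega), h₁, if_neg (by omega), h₀z i (by omega)]
  rw [hs₃]
  obtain ⟨s₄, hs₄⟩ : ∃ s₄, runC (moveBlock B (Z + nY + w) 1) s₃ = s₄ := ⟨_, rfl⟩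
  have h₄ : ∀ i, s₄ i = if Z + nY + w ≤ i ∧ i < Z + nY + w + 1 then s₃ (B + (i - (Z + nY + w))) else
      if B ≤ i ∧ i < B + 1 then false else s₃ i := fun i => by
    rw [← hs₄, runC_moveBlock (by omega)]
    intro i _ _
    rw [h₃, if_neg (by omega), if_neg (by omega), h₂, if_neg (by omega), h₁, if_neg (by omega),
      h₀z i (by omega)]
  rw [hs₄]
  obtain ⟨s₅, hs₅⟩ : ∃ s₅, runC (moveBlock 0 Q nK) s₄ = s₅ := ⟨_, rfl⟩
  have h₅ : ∀ i, s₅ i = if Q ≤ i ∧ i < Q + nK then s₄ (0 + (i - Q)) else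
      if 0 ≤ i ∧ i < 0 + nK then false else s₄ i := fun i => by
    rw [← hs₅, runC_moveBlock (by omega)]
    intro i _ _
    rw [h₄, if_neg (by omega), if_neg (by omega), h₃, if_neg (by omega), if_neg (by omega), h₂,
      if_neg (by omega), h₁, if_neg (by omega), h₀z i (by omega)]
  rw [hs₅]
  have hz : ∀ i, i < Z → s₅ i = false := fun i hi => by
    rw [h₅, if_neg (by omega)]
    split_ifs with h'
    · rfl
    rw [h₄, if_neg (by omega)]
    split_ifs
    · rfl
    rw [h₃, if_neg (by omega)]
    split_ifs
    · rfl
    rw [h₂]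
    split_ifs
    · rfl
    rw [h₁, if_neg (by omega), h₀z i (by omega)]
  funext i
  rw [runC_moveBlock (by omega) fun i _ _ => hz i (by omega), outWires, str_snoc]
  split_ifs with c₁ c₂ c₃ c₄
  · rw [h₅, if_neg (by omega), if_neg (by omega), h₄, load_append, load_append, length_str, length_str]
    by_cases c : i < nY
    · rw [if_pos c, if_neg (by omega), if_neg (by omega), h₃, if_pos (by omega), h₂, if_neg (by omega),
        h₁, if_neg (by omega), h₀y _ (by omega)]
      congr 1
      omega
    · rw [if_neg c]
      by_cases c' : i - nY < w
      · rw [if_pos c', if_neg (by omega), if_neg (by omega), h₃, if_neg (by omega), if_neg (by omega),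
          h₂, if_neg (by omega), h₁, if_pos (by omega)]
        congr 1
        omega
      · rw [if_neg c', if_pos (by omega), h₃, if_neg (by omega), if_neg (by omega), h₂,
          if_neg (by omega), h₁, if_neg (by omega), show B + (Z + (i - 0) - (Z + nY + w)) = B by omega,
          h₀b, show i - nY - w = 0 by omega]
        rfl
  · omega
  · exact (load_of_length_le (by simp [length_str]; omega)).symm
  · exact absurd c₃ (by omega)
  · by_cases c : i < Z
    · rw [hz i c]
      exact (load_of_length_le (by simp [length_str]; omega)).symm
    · omega
  · by_cases c : i < Q + nK
    · rw [h₅, if_pos (by omega), h₄, if_neg (by omega), if_neg (by omega), h₃, if_neg (by omega),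
        if_neg (by omega), h₂, if_neg (by omega), h₁, if_neg (by omega), h₀k _ (by omega), Nat.zero_add]
    · rw [h₅, if_neg (by omega), if_neg (by omega), h₄, if_neg (by omega), if_neg (by omega), h₃,
        if_neg (by omega), if_neg (by omega), h₂, if_neg (by omega), h₁, if_neg (by omega),
        h₀z _ (by omega)]
      exact (load_of_length_le (by rw [length_str]; omega)).symm

theorem put_outWires {nK nY m : ℕ} {Q : ℕ} (k : Bits nK) (y : Bits nY) (e e' : Bits m)
    (hQ : nY + m ≤ Q) : put (outWires Q k y e) nY e' = outWires Q k y e' := by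
  funext i
  simp only [put, outWires, load_append, length_str]
  by_cases h : nY ≤ i ∧ i < nY + m
  · rw [if_pos h, if_pos (by omega), if_neg (by omega)]
  · rw [if_neg h]
    split_ifs with h₁ h₂
    · rfl
    · rw [load_of_length_le (by rw [length_str]; omega), load_of_length_le (by rw [length_str]; omega)]
    · rfl

theorem slice_outWires {nK nY m : ℕ} {Q : ℕ} (k : Bits nK) (y : Bits nY) (e : Bits m)
    (hQ : nY + m ≤ Q) : slice (outWires Q k y e) nY m = e := by
  funext i
  have := i.2
  simp only [slice, outWires, load_append, length_str]
  rw [if_pos (by omega), if_neg (by omega), Nat.add_sub_cancel_left, load_str _ i.2]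

theorem slice_outWires_zero {nK nY m : ℕ} {Q : ℕ} (k : Bits nK) (y : Bits nY) (e : Bits m)
    (hQ : nY + m ≤ Q) : slice (outWires Q k y e) 0 nY = y := by
  funext i
  have := i.2
  simp only [slice, outWires, load_append, length_str]
  rw [if_pos (by omega), if_pos (by omega), Nat.zero_add, load_str _ i.2]

theorem readMessage_outWires {S : Setting} (F : NTCFData S) (n : ℕ) {nK : ℕ} {Q : ℕ} (k : Bits nK)
    (y : Bits (S.nY n)) (d : Bits (F.w n)) (c : Bool) (hQ : S.nY n + (F.w n + 1) ≤ Q) :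
    readMessage F n (outWires Q k y (Fin.snoc (α := fun _ => Bool) d c : Bits (F.w n + 1))) =
      (y, d, c) := by
  have h := slice_outWires k y (Fin.snoc (α := fun _ => Bool) d c : Bits (F.w n + 1)) hQ
  rw [slice_succ, Fin.snoc_inj] at h
  exact Prod.ext (slice_outWires_zero _ _ _ hQ) (Prod.ext h.1 h.2)

theorem allClassical_postCirc {DJ DI : List Gate} (hJ : AllClassical DJ) (hI : AllClassical DI)
    (nK nX nY w : ℕ) : AllClassical (postCirc DJ DI nK nX nY w) :=
  (hJ.call _ _ _ _ _).append ((hI.call _ _ _ _ _).append ((allClassical_moveBlock _ _ _).append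
    ((allClassical_moveBlock _ _ _).append ((allClassical_moveBlock _ _ _).append
      (allClassical_moveBlock _ _ _)))))

theorem uniform_postCirc (DJ DI : DetAlg) {nK nX nY w : ℕ → ℕ} (hK : PolyLength nK)
    (hX : PolyLength nX) (hY : PolyLength nY) (hw : PolyLength w) :
    UniformCircuits fun n => postCirc (DJ.circ n) (DI.circ n) (nK n) (nX n) (nY n) (w n) := by
  have h0 := polyLength_const 0
  have h1 := polyLength_const 1
  have hM := hY.add (hw.add h1)
  have hB := (hK.add hX).add hY
  have hZ := (hB.add h1).add hM
  have hQ := hZ.add hM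
  have hO := hQ.add hK
  have c₁ := DJ.uniform.call hO h0 (hZ.add hY) hw [(_, _)] (by simpa using ⟨hK, hX⟩)
  have c₂ := DI.uniform.call hO h0 hK hX [(_, _)] (by simpa using ⟨hZ.add hY, hw⟩)
  exact c₁.append (c₂.append (((hK.add hX).moveBlock hZ hY).append
    ((hB.moveBlock ((hZ.add hY).add hw) h1).append ((h0.moveBlock hQ hK).append
      (hZ.moveBlock h0 hM)))))

end Post

end PoQ

namespace PoQ

/-! ## The honest prover -/

section Prover

variable {S : Setting} (F : NTCFData S)

/-- The part of the prover that comes after the preparation of the range superposition. -/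
def finishCirc (DJ DI : DetAlg) (n : ℕ) : List Gate :=
  postCirc (DJ.circ n) (DI.circ n) (S.nK n) (S.nX n) (S.nY n) (F.w n) ++
    hBlock (S.nY n) (F.w n + 1)

/-- The honest prover. -/
def prover (DJ DI : DetAlg) : QPTAlg where
  circ n := hBlock (S.nK n + S.nX n + S.nY n) 1 ++ (F.samp.circ n ++ finishCirc F DJ DI n)
  uniform :=
    (((S.nK_length.add S.nX_length).add S.nY_length).hBlock (polyLength_const 1)).append
      (F.samp.uniform.append
        ((uniform_postCirc DJ DI S.nK_length S.nX_length S.nY_length F.w_length).append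
          (S.nY_length.hBlock (F.w_length.add (polyLength_const 1)))))

theorem finishCirc_gates (DJ DI : DetAlg) (n : ℕ) :
    ∀ g ∈ finishCirc F DJ DI n, g.IsClassical ∨ ∃ i, g = .h i := fun g hg =>
  (List.mem_append.1 hg).imp
    (allClassical_postCirc (DJ.classical n) (DI.classical n) _ _ _ _ g) (hBlock_gates _ _ g)

/-- The superposition of the two range superpositions. -/
noncomputable def idealInit (S : Setting) (n : ℕ) (k : Bits (S.nK n))
    (p : Bool → S.X n → stdSimplex ℝ (S.Y n)) : QState :=
  ∑ b : Bool, ((1 / Real.sqrt 2 : ℝ) : ℂ) • S.rangeState n k [b] (p b)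

theorem load_injective {l l' : List Bool} (hl : l.length = l'.length) (h : load l = load l') :
    l = l' :=
  List.ext_getElem hl fun i h₁ h₂ => by
    have := congrFun h i
    rwa [load, load, List.getD_eq_getElem _ _ h₁, List.getD_eq_getElem _ _ h₂] at this

theorem idealInit_eq (n : ℕ) (k : Bits (S.nK n)) (p : Bool → S.X n → stdSimplex ℝ (S.Y n)) :
    idealInit S n k p = ∑ i : Bool × S.X n × S.Y n,
      ((1 / Real.sqrt 2 * (Real.sqrt ((p i.1 i.2.1 : S.Y n → ℝ) i.2.2) /
        Real.sqrt ((S.X n).card : ℝ)) : ℝ) : ℂ) •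
        ket (load (str k ++ str i.2.1.1 ++ str i.2.2.1 ++ [i.1])) := by
  simp only [Fintype.sum_prod_type, idealInit, Setting.rangeState, Finset.smul_sum, smul_smul,
    Complex.ofReal_mul]

theorem sq_one_div_sqrt_two : (1 / Real.sqrt 2) ^ 2 = 1 / 2 := by
  rw [div_pow, Real.sq_sqrt (by norm_num)]
  norm_num

theorem card_pos_real (S : Setting) (n : ℕ) : (0 : ℝ) < ((S.X n).card : ℝ) :=
  Nat.cast_pos.2 (Finset.card_pos.2 (S.X_nonempty n))

theorem stdSimplex_nonneg {Y : Type} [Fintype Y] (p : stdSimplex ℝ Y) (y : Y) :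
    0 ≤ (p : Y → ℝ) y := p.2.1 y

theorem stdSimplex_sum {Y : Type} [Fintype Y] (p : stdSimplex ℝ Y) : ∑ y, (p : Y → ℝ) y = 1 := p.2.2

/-- Different triples `(b, x, y)` give different basis states, so the norm is an average over `b`
and `x` of total masses of densities. -/
theorem normSq_idealInit (n : ℕ) (k : Bits (S.nK n)) (p : Bool → S.X n → stdSimplex ℝ (S.Y n)) :
    normSq (idealInit S n k p) = 1 := by
  rw [idealInit_eq, normSq_sum_ket]
  · simp only [Complex.norm_real, Real.norm_eq_abs, sq_abs, mul_pow, div_pow (Real.sqrt _) (Real.sqrt _),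
      sq_one_div_sqrt_two, Real.sq_sqrt (Nat.cast_nonneg _), Fintype.sum_prod_type]
    have h : ∀ b x, ∑ y, 1 / 2 * (Real.sqrt ((p b x : S.Y n → ℝ) y) ^ 2 / ((S.X n).card : ℝ)) =
        1 / 2 / ((S.X n).card : ℝ) := fun b x => by
      rw [← Finset.mul_sum, ← Finset.sum_div, Finset.sum_congr rfl fun y _ =>
        Real.sq_sqrt (stdSimplex_nonneg _ y), stdSimplex_sum]
      ring
    simp only [h, Finset.sum_const, Finset.card_univ, Fintype.card_coe, nsmul_eq_mul,
      Fintype.card_bool]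
    have := (card_pos_real S n).ne'
    push_cast
    field_simp
  · rintro ⟨b, x, y⟩ ⟨b', x', y'⟩ h
    have h := load_injective (by simp [length_str]) h
    obtain ⟨h, hb⟩ := List.append_inj' h rfl
    obtain ⟨h, hy⟩ := List.append_inj' h (by simp [length_str])
    obtain ⟨-, hx⟩ := List.append_inj' h (by simp [length_str])
    simp only [List.cons.injEq, and_true] at hb
    exact Prod.ext hb (Prod.ext (Subtype.ext (List.ofFn_injective hx))
      (Subtype.ext (List.ofFn_injective hy)))

/-- The amplitude of the reply `(y, e)` where `e` consists of `d` and `c`. -/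
noncomputable def amplitude (n : ℕ) (p : Bool → S.X n → stdSimplex ℝ (S.Y n)) (y : S.Y n)
    (e : Bits (F.w n + 1)) : ℝ :=
  ∑ b : Bool, ∑ x : S.X n, 1 / Real.sqrt 2 * (Real.sqrt ((p b x : S.Y n → ℝ) y) /
    Real.sqrt ((S.X n).card : ℝ)) * ((1 / Real.sqrt 2) ^ (F.w n + 1) *
      sgn (dot (Fin.snoc (α := fun _ => Bool) (F.J n x) b : Bits (F.w n + 1)) e))

variable {F}

/-- For given `y` and `e`, the final wires no longer depend on `(b, x)`, which survives only in the
coefficients. Collecting terms by `(y, e)` is the interference. -/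
theorem runQ_finishCirc_idealInit {DJ DI : DetAlg}
    (hJ : ∀ n (x : S.X n), slice (DJ.run n (str x.1)) 0 (F.w n) = F.J n x)
    (hI : ∀ n (x : S.X n), slice (DI.run n (str (F.J n x))) 0 (S.nX n) = x.1) (n : ℕ) (k : Bits (S.nK n))
    (p : Bool → S.X n → stdSimplex ℝ (S.Y n)) :
    runQ (finishCirc F DJ DI n) (idealInit S n k p) =
      ∑ i : S.Y n × Bits (F.w n + 1), ((amplitude F n p i.1 i.2 : ℝ) : ℂ) •
        ket (outWires (S.nK n + S.nX n + S.nY n + 1 + (S.nY n + (F.w n + 1)) +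
          (S.nY n + (F.w n + 1))) k i.1.1 i.2) := by
  have h : ∀ (b : Bool) (x : S.X n) (y : S.Y n),
      runQ (finishCirc F DJ DI n) (ket (load (str k ++ str x.1 ++ str y.1 ++ [b]))) =
      ∑ e : Bits (F.w n + 1), (((1 / Real.sqrt 2) ^ (F.w n + 1) *
        sgn (dot (Fin.snoc (α := fun _ => Bool) (F.J n x) b : Bits (F.w n + 1)) e) : ℝ) : ℂ) •
        ket (outWires (S.nK n + S.nX n + S.nY n + 1 + (S.nY n + (F.w n + 1)) +
          (S.nY n + (F.w n + 1))) k y.1 e) := fun b x y => by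
    rw [finishCirc, runQ_append,
      runQ_ket (allClassical_postCirc (DJ.classical n) (DI.classical n) _ _ _ _),
      runC_postCirc _ _ k x.1 y.1 b _ (hJ n x) (hI n x), runQ_hBlock,
      slice_outWires _ _ _ (by omega)]
    refine Finset.sum_congr rfl fun e _ => ?_
    rw [put_outWires _ _ _ _ (by omega)]
  rw [idealInit_eq, ← runLin_apply, map_sum]
  simp only [map_smul, runLin_apply, h, Fintype.sum_prod_type, amplitude, Finset.smul_sum, smul_smul,
    Complex.ofReal_sum, Finset.sum_smul, ← Complex.ofReal_mul]
  rw [Finset.sum_congr rfl fun b _ => Finset.sum_comm, Finset.sum_comm]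
  refine Finset.sum_congr rfl fun y _ => ?_
  rw [Finset.sum_congr rfl fun b _ => Finset.sum_comm, Finset.sum_comm]

/-- How well the state of the prover is approximated by the ideal state. -/
theorem le_measureProb_prover (DJ DI : DetAlg) (n : ℕ) (k : Bits (S.nK n))
    (p : Bool → S.X n → stdSimplex ℝ (S.Y n)) {ε : ℝ}
    (hε : ∀ b, normSq (F.samp.state n
        (str k ++ List.replicate (S.nX n) false ++ List.replicate (S.nY n) false ++ [b]) -
      S.rangeState n k [b] (p b)) ≤ ε) (E : Wires → Prop) :
    measureProb (runQ (finishCirc F DJ DI n) (idealInit S n k p)) E - 2 * Real.sqrt (2 * ε) ≤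
      measureProb ((prover F DJ DI).state n (str k)) E := by
  have hlen : (str k ++ List.replicate (S.nX n) false ++ List.replicate (S.nY n) false).length =
      S.nK n + S.nX n + S.nY n := by simp [length_str, Nat.add_assoc]
  have hs : ∀ b, Function.update (load (str k)) (S.nK n + S.nX n + S.nY n + 0) b =
      load (str k ++ List.replicate (S.nX n) false ++ List.replicate (S.nY n) false ++ [b]) := fun b => by
    funext i
    rw [load_append, hlen, Nat.add_zero]
    rcases lt_trichotomy i (S.nK n + S.nX n + S.nY n) with h | rfl | h
    · rw [Function.update_of_ne h.ne, if_pos h, List.append_assoc, load_append]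
      split_ifs with h'
      · rfl
      · rw [load_of_length_le (not_lt.1 h')]
        simp [load]
    · rw [Function.update_self, if_neg (lt_irrefl _), Nat.sub_self]
      rfl
    · rw [Function.update_of_ne h.ne', if_neg (by omega), load_of_length_le (by simp [length_str]; omega),
        load_of_length_le (by simp; omega)]
  have hstart : runQ (hBlock (S.nK n + S.nX n + S.nY n) 1) (ket (load (str k))) =
      ∑ b : Bool, ((1 / Real.sqrt 2 : ℝ) : ℂ) • ket (load (str k ++ List.replicate (S.nX n) false ++
        List.replicate (S.nY n) false ++ [b])) := by
    rw [show hBlock (S.nK n + S.nX n + S.nY n) 1 = [.h (S.nK n + S.nX n + S.nY n + 0)] from rfl]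
    change (Gate.h _).apply _ = _
    rw [apply_ket, onKet_h]
    refine Finset.sum_congr rfl fun b _ => ?_
    rw [hs, load_of_length_le (by rw [length_str]; omega)]
    simp [sgn]
  have hstate : (prover F DJ DI).state n (str k) = runQ (finishCirc F DJ DI n)
      (∑ b : Bool, ((1 / Real.sqrt 2 : ℝ) : ℂ) • F.samp.state n
        (str k ++ List.replicate (S.nX n) false ++ List.replicate (S.nY n) false ++ [b])) := by
    rw [QPTAlg.state, prover, runQ_append, runQ_append, hstart, ← runLin_apply (F.samp.circ n), map_sum]
    simp only [map_smul, runLin_apply, QPTAlg.state]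
  -- The finishing circuit preserves norms, so only the preparation error counts. Each branch
  -- contributes `ε / 2`, and `normSq_add_le` doubles the sum.
  have hd : normSq ((prover F DJ DI).state n (str k) -
      runQ (finishCirc F DJ DI n) (idealInit S n k p)) ≤ 2 * ε := by
    rw [hstate, ← runLin_apply, ← runLin_apply, ← map_sub, runLin_apply,
      normSq_runQ (finishCirc_gates F DJ DI n), idealInit, ← Finset.sum_sub_distrib, Fintype.sum_bool]
    refine (normSq_add_le _ _).trans ?_
    rw [← smul_sub, ← smul_sub, normSq_smul, normSq_smul, Complex.norm_real, Real.norm_eq_abs, sq_abs,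
      sq_one_div_sqrt_two]
    linarith [hε false, hε true]
  refine le_trans ?_ (measureProb_sub_le _ (runQ (finishCirc F DJ DI n) (idealInit S n k p)) E)
  rw [normSq_runQ (finishCirc_gates F DJ DI n), normSq_idealInit, Real.sqrt_one, one_mul]
  exact sub_le_sub_left (mul_le_mul_of_nonneg_left (Real.sqrt_le_sqrt hd) zero_le_two) _

/-- The replies of the ideal prover. -/
theorem measureProb_finishCirc_idealInit {DJ DI : DetAlg}
    (hJ : ∀ n (x : S.X n), slice (DJ.run n (str x.1)) 0 (F.w n) = F.J n x)
    (hI : ∀ n (x : S.X n), slice (DI.run n (str (F.J n x))) 0 (S.nX n) = x.1) (n : ℕ)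
    (k : Bits (S.nK n)) (p : Bool → S.X n → stdSimplex ℝ (S.Y n)) (E : Message F n → Prop)
    [DecidablePred E] :
    measureProb (runQ (finishCirc F DJ DI n) (idealInit S n k p)) (fun s => E (readMessage F n s)) =
      ∑ y : S.Y n, ∑ d : Bits (F.w n), ∑ c : Bool, if E (y.1, d, c) then
        amplitude F n p y (Fin.snoc (α := fun _ => Bool) d c : Bits (F.w n + 1)) ^ 2 else 0 := by
  rw [runQ_finishCirc_idealInit hJ hI, measureProb_sum_ket]
  · rw [Fintype.sum_prod_type]
    refine Finset.sum_congr rfl fun y _ => ?_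
    rw [sum_bits_succ]
    refine Finset.sum_congr rfl fun d _ => Finset.sum_congr rfl fun c _ => ?_
    rw [readMessage_outWires F n k y.1 d c (by omega), Complex.norm_real, Real.norm_eq_abs, sq_abs]
  · rintro ⟨y, e⟩ ⟨y', e'⟩ h
    have h₁ := slice_outWires_zero (Q := S.nK n + S.nX n + S.nY n + 1 + (S.nY n + (F.w n + 1)) +
          (S.nY n + (F.w n + 1))) k y.1 e (by omega)
    have h₂ := slice_outWires (Q := S.nK n + S.nX n + S.nY n + 1 + (S.nY n + (F.w n + 1)) +
          (S.nY n + (F.w n + 1))) k y.1 e (by omega)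
    dsimp only at h
    rw [h, slice_outWires_zero _ _ _ (by omega)] at h₁
    rw [h, slice_outWires _ _ _ (by omega)] at h₂
    exact Prod.ext (Subtype.ext h₁.symm) h₂.symm

/-- The sum is the squared norm of the final state, and the finishing circuit preserves norms, so no
sum of signs has to be evaluated. -/
theorem sum_amplitude_sq {DJ DI : DetAlg}
    (hJ : ∀ n (x : S.X n), slice (DJ.run n (str x.1)) 0 (F.w n) = F.J n x)
    (hI : ∀ n (x : S.X n), slice (DI.run n (str (F.J n x))) 0 (S.nX n) = x.1) (n : ℕ)
    (k : Bits (S.nK n)) (p : Bool → S.X n → stdSimplex ℝ (S.Y n)) :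
    ∑ y : S.Y n, ∑ d : Bits (F.w n), ∑ c : Bool,
      amplitude F n p y (Fin.snoc (α := fun _ => Bool) d c : Bits (F.w n + 1)) ^ 2 = 1 := by
  have h := measureProb_finishCirc_idealInit hJ hI n k p fun _ => True
  rw [← normSq_eq_measureProb, normSq_runQ (finishCirc_gates F DJ DI n), normSq_idealInit] at h
  simpa using h.symm

/-- Every reply of the ideal prover is an image. -/
theorem measureProb_imTest {G : TIFData S} (hG : IsTrapdoorInjective G) {DJ DI : DetAlg}
    (hJ : ∀ n (x : S.X n), slice (DJ.run n (str x.1)) 0 (F.w n) = F.J n x)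
    (hI : ∀ n (x : S.X n), slice (DI.run n (str (F.J n x))) 0 (S.nX n) = x.1) {n : ℕ}
    {k : G.K n} {t : G.T n} (hkt : (k, t) ∈ G.I n) :
    measureProb (runQ (finishCirc F DJ DI n)
      (idealInit S n k.1 fun b x => G.g n k (G.bit n b) (G.incl n x)))
      (fun s => readMessage F n s ∈ imTest F G n k t) = 1 := by
  classical
  rw [measureProb_finishCirc_idealInit hJ hI n k.1 _ fun m => m ∈ imTest F G n k t,
    ← sum_amplitude_sq hJ hI n k.1 fun b x => G.g n k (G.bit n b) (G.incl n x)]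
  refine Finset.sum_congr rfl fun y _ => Finset.sum_congr rfl fun d _ =>
    Finset.sum_congr rfl fun c _ => ?_
  split_ifs with h
  · rfl
  -- If `y` were in one of the supports, inversion would recover `(b, x)` and the check would
  -- accept. A rejected `y` thus has amplitude `0`.
  · have hzero : ∀ b x, (G.g n k (G.bit n b) (G.incl n x) : S.Y n → ℝ) y = 0 := fun b x => by
      by_contra hne
      have hpos := (stdSimplex_nonneg (G.g n k (G.bit n b) (G.incl n x)) y).lt_of_ne' hne
      obtain ⟨h₁, h₂⟩ := hG.invert_g n k t hkt b x y hpos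
      refine h ⟨y.2, ?_⟩
      rw [h₁, h₂]
      exact (hG.check n k (G.bit n b) (G.incl n x) y).2 hpos
    simp [amplitude, hzero]

end Prover

end PoQ

namespace PoQ

/-! ## The equation test -/

section Hellinger

variable {Y : Type} [Fintype Y]

theorem sum_sqrt_sq (p : stdSimplex ℝ Y) : ∑ y, Real.sqrt ((p : Y → ℝ) y) ^ 2 = 1 := by
  rw [Finset.sum_congr rfl fun y _ => Real.sq_sqrt (stdSimplex_nonneg p y), stdSimplex_sum]

theorem hellingerSq_nonneg (p q : stdSimplex ℝ Y) : 0 ≤ hellingerSq p q := by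
  have h : ∑ y, Real.sqrt ((p : Y → ℝ) y * (q : Y → ℝ) y) ≤
      ∑ y, (Real.sqrt ((p : Y → ℝ) y) ^ 2 + Real.sqrt ((q : Y → ℝ) y) ^ 2) / 2 :=
    Finset.sum_le_sum fun y _ => by
      rw [Real.sqrt_mul (stdSimplex_nonneg p y)]
      linarith [two_mul_le_add_sq (Real.sqrt ((p : Y → ℝ) y)) (Real.sqrt ((q : Y → ℝ) y))]
  rw [← Finset.sum_div, Finset.sum_add_distrib, sum_sqrt_sq, sum_sqrt_sq] at h
  rw [hellingerSq]
  linarith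

/-- The Hellinger distance to a third density bounds the overlap of two densities from below. -/
theorem le_sum_sqrt_mul (p q r : stdSimplex ℝ Y) :
    1 - 2 * hellingerSq q p - 2 * hellingerSq q r ≤
      ∑ y, Real.sqrt ((p : Y → ℝ) y) * Real.sqrt ((r : Y → ℝ) y) := by
  -- Pointwise, this is half the expansion of `(√p + √r - 2√q) ^ 2 ≥ 0`; the squares sum to
  -- constants because all three densities have mass `1`.
  have h : ∑ y, (2 * Real.sqrt ((q : Y → ℝ) y * (p : Y → ℝ) y) +
      2 * Real.sqrt ((q : Y → ℝ) y * (r : Y → ℝ) y)) ≤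
      ∑ y, (Real.sqrt ((p : Y → ℝ) y) * Real.sqrt ((r : Y → ℝ) y) +
        (1 / 2 * Real.sqrt ((p : Y → ℝ) y) ^ 2 + 1 / 2 * Real.sqrt ((r : Y → ℝ) y) ^ 2 +
          2 * Real.sqrt ((q : Y → ℝ) y) ^ 2)) :=
    Finset.sum_le_sum fun y _ => by
      rw [Real.sqrt_mul (stdSimplex_nonneg q y), Real.sqrt_mul (stdSimplex_nonneg q y)]
      linarith [sq_nonneg (Real.sqrt ((p : Y → ℝ) y) + Real.sqrt ((r : Y → ℝ) y) -
        2 * Real.sqrt ((q : Y → ℝ) y))]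
  simp only [Finset.sum_add_distrib, ← Finset.mul_sum, sum_sqrt_sq] at h
  rw [hellingerSq, hellingerSq]
  linarith

end Hellinger

section EqTest

variable {S : Setting} {F : NTCFData S}

theorem dot_comm {m : ℕ} (u v : Bits m) : dot u v = dot v u := by
  simp only [dot, and_comm]

/-- The amplitude of a reply that passes the test for a claw. -/
theorem le_amplitude_sq {n : ℕ} {p : Bool → S.X n → stdSimplex ℝ (S.Y n)} {y : S.Y n}
    {x₀ x₁ : S.X n} (h₀ : ∀ x ≠ x₀, (p false x : S.Y n → ℝ) y = 0)
    (h₁ : ∀ x ≠ x₁, (p true x : S.Y n → ℝ) y = 0) (d : Bits (F.w n)) :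
    Real.sqrt ((p false x₀ : S.Y n → ℝ) y) * Real.sqrt ((p true x₁ : S.Y n → ℝ) y) *
      (1 / 2) ^ F.w n / ((S.X n).card : ℝ) ≤
      amplitude F n p y (Fin.snoc (α := fun _ => Bool) d (dot d (bxor (F.J n x₀) (F.J n x₁)))) ^ 2 := by
  -- With one preimage in each branch, two terms remain. For this value of `c` their signs agree,
  -- since the square of the sign of `d · J x₁` is `1`.
  have hamp : amplitude F n p y
      (Fin.snoc (α := fun _ => Bool) d (dot d (bxor (F.J n x₀) (F.J n x₁)))) =
      1 / Real.sqrt 2 * (1 / Real.sqrt 2) ^ (F.w n + 1) / Real.sqrt ((S.X n).card : ℝ) *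
        sgn (dot d (F.J n x₀)) *
        (Real.sqrt ((p false x₀ : S.Y n → ℝ) y) + Real.sqrt ((p true x₁ : S.Y n → ℝ) y)) := by
    rw [amplitude, Fintype.sum_bool, Finset.sum_eq_single x₁ (fun x _ hx => by simp [h₁ x hx])
      (by simp), Finset.sum_eq_single x₀ (fun x _ hx => by simp [h₀ x hx]) (by simp), sgn_dot_snoc,
      sgn_dot_snoc, Bool.true_and, Bool.false_and, sgn_dot_bxor, dot_comm (F.J n x₀),
      dot_comm (F.J n x₁)]
    have h := sgn_sq (dot d (F.J n x₁))
    rw [show sgn false = 1 from rfl]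
    linear_combination (1 / Real.sqrt 2 * (1 / Real.sqrt 2) ^ (F.w n + 1) /
      Real.sqrt ((S.X n).card : ℝ) * sgn (dot d (F.J n x₀)) *
      Real.sqrt ((p true x₁ : S.Y n → ℝ) y)) * h
  rw [hamp, mul_pow, mul_pow, sgn_sq, div_pow _ (Real.sqrt _), mul_pow, ← pow_mul, Nat.mul_comm (F.w n + 1), pow_mul,
    sq_one_div_sqrt_two, Real.sq_sqrt (Nat.cast_nonneg _), pow_succ]
  have hc := card_pos_real S n
  rw [div_mul_eq_mul_div, div_mul_eq_mul_div]
  refine div_le_div_of_nonneg_right ?_ hc.le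
  have hw : (0 : ℝ) < (1 / 2) ^ F.w n := by positivity
  -- With `a`, `b` the two roots, `(a + b) ^ 2 ≥ 4ab` absorbs the factor `1/4` that comes from the
  -- superposition over `b` and the Hadamard gate on its wire.
  nlinarith [mul_nonneg hw.le (sq_nonneg (Real.sqrt ((p false x₀ : S.Y n → ℝ) y) -
    Real.sqrt ((p true x₁ : S.Y n → ℝ) y)))]

open scoped Classical in
-- A union bound over the two exceptional sets, written as a normalised count in the form in which
-- the sum over replies `d` appears.
theorem le_card_dset {m : ℕ} {D D' : Finset (Bits m)} {ε : ℝ}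
    (h : prob (fun d : Bits m => d ∉ D) ≤ ε) (h' : prob (fun d : Bits m => d ∉ D') ≤ ε) :
    1 - 2 * ε ≤ (1 / 2) ^ m * ∑ d : Bits m, if d ∈ D ∧ d ∈ D' then 1 else 0 := by
  have hp : prob (fun d : Bits m => d ∈ D ∧ d ∈ D') = (1 / 2) ^ m *
      ∑ d : Bits m, if d ∈ D ∧ d ∈ D' then 1 else 0 := by
    rw [prob, avg, Fintype.card_fun, Fintype.card_bool, Fintype.card_fin, Nat.cast_pow, Nat.cast_ofNat,
      div_eq_mul_inv, mul_comm, one_div, inv_pow]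
    congr 2
    funext d
    congr
  have h₁ := prob_or_le (fun d : Bits m => d ∉ D) fun d => d ∉ D'
  have h₂ := prob_not fun d : Bits m => d ∈ D ∧ d ∈ D'
  simp only [not_and_or] at h₂
  linarith

/-- The ideal prover passes the equation test with probability almost `c`. -/
theorem le_measureProb_eqTest (hF : IsNTCF F) {DJ DI : DetAlg}
    (hJ : ∀ n (x : S.X n), slice (DJ.run n (str x.1)) 0 (F.w n) = F.J n x)
    (hI : ∀ n (x : S.X n), slice (DI.run n (str (F.J n x))) 0 (S.nX n) = x.1) {n : ℕ}
    {k : F.K n} {t : F.T n} (hkt : (k, t) ∈ F.I n) {εH εd : ℝ}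
    (hc : F.c ≤ ((F.X₀ n ∩ F.X₁ n).card : ℝ) / ((S.X n).card : ℝ))
    (hX : ∀ x₀ x₁ : S.X n, F.Claw n k x₀ x₁ → x₀ ∈ F.X₀ n ∩ F.X₁ n → x₁ ∈ F.X₁ n)
    (hH : ∀ b : Bool, avg (fun x : S.X n => hellingerSq (F.f n k b x) (F.fr n k b x)) ≤ εH)
    (hd : ∀ (b : Bool) (x : S.X n), prob (fun d : Bits (F.w n) => d ∉ F.dset n k b x) ≤ εd) :
    F.c - 4 * εH - 2 * εd ≤ measureProb (runQ (finishCirc F DJ DI n) (idealInit S n k.1 (F.fr n k)))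
      (fun s => readMessage F n s ∈ eqTest F n k t) := by
  classical
  rw [measureProb_finishCirc_idealInit hJ hI n k.1 _ fun m => m ∈ eqTest F n k t]
  have : Nonempty (S.X n) := (S.X_nonempty n).coe_sort
  have hcard := card_pos_real S n
  -- `φ` sends a point of `X₀` to the other end of its claw. On `X₀ ∩ X₁` it takes values in `X₁`
  -- and is injective, because claws are unique from both ends.
  choose! φ hφ using fun x hx => (hF.pair₀ n k t hkt x hx).exists
  set Z := F.X₀ n ∩ F.X₁ n with hZ
  have hZ₀ : ∀ x ∈ Z, x ∈ F.X₀ n := fun x hx => (Finset.mem_inter.1 hx).1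
  have hφ₁ : ∀ x ∈ Z, φ x ∈ F.X₁ n := fun x hx => hX x (φ x) (hφ x (hZ₀ x hx)) hx
  have hinj : ∀ x ∈ Z, ∀ x' ∈ Z, φ x = φ x' → x = x' := fun x hx x' hx' h =>
    (hF.pair₁ n k t hkt (φ x) (hφ₁ x hx)).unique (hφ x (hZ₀ x hx)) (h ▸ hφ x' (hZ₀ x' hx'))
  -- for every image, the part of the sum that belongs to claws
  have hy : ∀ y : S.Y n, ∑ x ∈ Z, Real.sqrt ((F.fr n k false x : S.Y n → ℝ) y) *
      Real.sqrt ((F.fr n k true (φ x) : S.Y n → ℝ) y) / ((S.X n).card : ℝ) * (1 - 2 * εd) ≤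
      ∑ d : Bits (F.w n), ∑ c : Bool, if ((y.1, d, c) : Message F n) ∈ eqTest F n k t then
        amplitude F n (F.fr n k) y (Fin.snoc (α := fun _ => Bool) d c : Bits (F.w n + 1)) ^ 2
        else 0 := fun y => by
    have hnn : 0 ≤ ∑ d : Bits (F.w n), ∑ c : Bool,
        if ((y.1, d, c) : Message F n) ∈ eqTest F n k t then
        amplitude F n (F.fr n k) y (Fin.snoc (α := fun _ => Bool) d c : Bits (F.w n + 1)) ^ 2
        else 0 :=
      Finset.sum_nonneg fun d _ => Finset.sum_nonneg fun c _ => by split_ifs <;> positivity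
    -- A claw contributes only if `y` lies in both of its supports. Inversion makes the preimage of
    -- `y` unique in each branch, so at most one claw contributes to a given `y`.
    by_cases hex : ∃ x ∈ Z, 0 < (F.fr n k false x : S.Y n → ℝ) y ∧
        0 < (F.fr n k true (φ x) : S.Y n → ℝ) y
    · obtain ⟨x, hx, hp₀, hp₁⟩ := hex
      have i₀ := hF.invert_fr n k t hkt false x y hp₀
      have i₁ := hF.invert_fr n k t hkt true (φ x) y hp₁
      have u₀ : ∀ x' ≠ x, (F.fr n k false x' : S.Y n → ℝ) y = 0 := fun x' hx' => by
        by_contra hne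
        exact hx' (Subtype.ext ((hF.invert_fr n k t hkt false x' y
          ((stdSimplex_nonneg _ y).lt_of_ne' hne)).symm.trans i₀))
      have u₁ : ∀ x' ≠ φ x, (F.fr n k true x' : S.Y n → ℝ) y = 0 := fun x' hx' => by
        by_contra hne
        exact hx' (Subtype.ext ((hF.invert_fr n k t hkt true x' y
          ((stdSimplex_nonneg _ y).lt_of_ne' hne)).symm.trans i₁))
      rw [Finset.sum_eq_single x (fun x' _ hx' => by rw [u₀ x' hx']; simp) fun h => (h hx).elim]
      set a := Real.sqrt ((F.fr n k false x : S.Y n → ℝ) y) *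
        Real.sqrt ((F.fr n k true (φ x) : S.Y n → ℝ) y) with ha
      have ha0 : 0 ≤ a / ((S.X n).card : ℝ) := by positivity
      refine (mul_le_mul_of_nonneg_left (le_card_dset (hd false x) (hd true (φ x))) ha0).trans ?_
      rw [← mul_assoc, Finset.mul_sum]
      refine Finset.sum_le_sum fun d _ => ?_
      split_ifs with hdd
      · refine le_trans ?_ (Finset.single_le_sum (fun c _ => by split_ifs <;> positivity)
          (Finset.mem_univ (dot d (bxor (F.J n x) (F.J n (φ x))))))
        rw [if_pos]
        · refine le_trans (le_of_eq ?_) (le_amplitude_sq u₀ u₁ d)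
          ring
        · exact ⟨y.2, x, φ x, i₀, i₁, (hF.check n k false x y).2 hp₀,
            (hF.check n k true (φ x) y).2 hp₁, hφ x (hZ₀ x hx), hZ₀ x hx, hφ₁ x hx, rfl, hdd.1, hdd.2⟩
      · rw [mul_zero]
        exact Finset.sum_nonneg fun c _ => by split_ifs <;> positivity
    · refine le_trans (le_of_eq (Finset.sum_eq_zero fun x hx => ?_)) hnn
      by_cases hp₀ : 0 < (F.fr n k false x : S.Y n → ℝ) y
      · have := le_antisymm (not_lt.1 fun hp₁ => hex ⟨x, hx, hp₀, hp₁⟩)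
          (stdSimplex_nonneg (F.fr n k true (φ x)) y)
        rw [this]
        simp
      · rw [le_antisymm (not_lt.1 hp₀) (stdSimplex_nonneg (F.fr n k false x) y)]
        simp
  refine le_trans ?_ (Finset.sum_le_sum fun y _ => hy y)
  rw [Finset.sum_comm]
  simp only [← Finset.sum_mul, ← Finset.sum_div]
  -- `O` is the total overlap over the claws. The upper bound `O ≤ |X|` serves to turn the factor `1
  -- - 2 * εd` into a subtraction, and the lower bound is about `|Z|`.
  set O := ∑ x ∈ Z, ∑ y, Real.sqrt ((F.fr n k false x : S.Y n → ℝ) y) *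
      Real.sqrt ((F.fr n k true (φ x) : S.Y n → ℝ) y) with hO
  have hεd : 0 ≤ εd := (prob_nonneg _).trans (hd false (Classical.arbitrary _))
  have hO1 : O / ((S.X n).card : ℝ) ≤ 1 := by
    rw [div_le_one hcard]
    have h : O ≤ ∑ x ∈ Z, (1 : ℝ) := Finset.sum_le_sum fun x _ => by
      have h : ∑ y, Real.sqrt ((F.fr n k false x : S.Y n → ℝ) y) *
          Real.sqrt ((F.fr n k true (φ x) : S.Y n → ℝ) y) ≤
          ∑ y, (Real.sqrt ((F.fr n k false x : S.Y n → ℝ) y) ^ 2 +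
            Real.sqrt ((F.fr n k true (φ x) : S.Y n → ℝ) y) ^ 2) / 2 :=
        Finset.sum_le_sum fun y _ => by
          linarith [two_mul_le_add_sq (Real.sqrt ((F.fr n k false x : S.Y n → ℝ) y))
            (Real.sqrt ((F.fr n k true (φ x) : S.Y n → ℝ) y))]
      rw [← Finset.sum_div, Finset.sum_add_distrib, sum_sqrt_sq, sum_sqrt_sq] at h
      linarith
    refine h.trans ?_
    rw [Finset.sum_const, nsmul_eq_mul, mul_one, ← Fintype.card_coe (S.X n)]
    exact_mod_cast Finset.card_le_univ Z
  have hO2 : (Z.card : ℝ) - 4 * (εH * ((S.X n).card : ℝ)) ≤ O := by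
    have hs : ∀ b, ∑ x, hellingerSq (F.f n k b x) (F.fr n k b x) ≤ εH * ((S.X n).card : ℝ) := fun b => by
      have := hH b
      rwa [avg, Fintype.card_coe, div_le_iff₀ hcard] at this
    have h : ∑ x ∈ Z, (1 - 2 * hellingerSq (F.f n k false x) (F.fr n k false x) -
        2 * hellingerSq (F.f n k true (φ x)) (F.fr n k true (φ x))) ≤ O :=
      Finset.sum_le_sum fun x hx => by
        -- The common density of the claw plays the role of the middle density in `le_sum_sqrt_mul`.
        have hcl : F.f n k false x = F.f n k true (φ x) := hφ x (hZ₀ x hx)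
        rw [← hcl]
        exact le_sum_sqrt_mul _ _ _
    have h₀ : ∑ x ∈ Z, hellingerSq (F.f n k false x) (F.fr n k false x) ≤
        ∑ x, hellingerSq (F.f n k false x) (F.fr n k false x) :=
      Finset.sum_le_sum_of_subset_of_nonneg (Finset.subset_univ _) fun x _ _ => hellingerSq_nonneg _ _
    -- Injectivity of `φ` keeps each right end from being counted more than once, so the average
    -- bound over all of `X` applies.
    have h₁ : ∑ x ∈ Z, hellingerSq (F.f n k true (φ x)) (F.fr n k true (φ x)) ≤
        ∑ x, hellingerSq (F.f n k true x) (F.fr n k true x) := by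
      rw [← Finset.sum_image (f := fun x => hellingerSq (F.f n k true x) (F.fr n k true x))
        fun x hx x' hx' h => hinj x hx x' hx' h]
      exact Finset.sum_le_sum_of_subset_of_nonneg (Finset.subset_univ _)
        fun x _ _ => hellingerSq_nonneg _ _
    simp only [Finset.sum_sub_distrib, Finset.sum_const, nsmul_eq_mul, mul_one,
      ← Finset.mul_sum] at h
    linarith [hs false, hs true]
  have hO3 : F.c - 4 * εH ≤ O / ((S.X n).card : ℝ) := by
    rw [le_div_iff₀ hcard]
    rw [le_div_iff₀ hcard] at hc
    linarith
  nlinarith [mul_le_mul_of_nonneg_right hO1 hεd]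

end EqTest

end PoQ

namespace PoQ

/-! ## Completeness -/

/-- `n ^ c * √μ` is `√(n ^ (2 * c) * μ)`, so decay of order `2 * c` suffices. -/
theorem Negligible.sqrt {μ : ℕ → ℝ} (hμ : Negligible μ) : Negligible fun n => Real.sqrt (μ n) := by
  intro c
  have h := (hμ (2 * c)).abs.sqrt
  simp only [abs_zero, Real.sqrt_zero] at h
  refine squeeze_zero_norm (fun n => ?_) h
  have hn : (0 : ℝ) ≤ (n : ℝ) ^ c := by positivity
  rw [Real.norm_eq_abs, abs_of_nonneg (mul_nonneg hn (Real.sqrt_nonneg _)), Nat.mul_comm, pow_mul, abs_mul,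
    abs_of_nonneg (sq_nonneg _), Real.sqrt_mul (sq_nonneg _), Real.sqrt_sq hn]
  exact mul_le_mul_of_nonneg_left (Real.sqrt_le_sqrt (le_abs_self _)) hn

/-- This absorbs the finitely many `n` for which the bound on the fraction of claws is not yet
assumed. -/
theorem Negligible.ite_le {μ : ℕ → ℝ} (hμ : Negligible μ) (N : ℕ) (a : ℝ) :
    Negligible fun n => if n ≤ N then a else μ n :=
  Asymptotics.SuperpolynomialDecay.congr' hμ <| by
    filter_upwards [Filter.eventually_gt_atTop N] with n hn
    rw [if_neg (not_le.2 hn)]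

/-- On `B` the loss is at most `v ≤ 1`, because `Z` is nonnegative. -/
theorem le_avg_of_good {Ω : Type} [Fintype Ω] [Nonempty Ω] {Z : Ω → ℝ} {v : ℝ} {B : Ω → Prop}
    (hv : v ≤ 1) (hZ : ∀ ω, 0 ≤ Z ω) (h : ∀ ω, ¬B ω → v ≤ Z ω) : v - prob B ≤ avg Z := by
  rw [← avg_const (Ω := Ω) v, prob, ← avg_sub]
  refine avg_mono fun ω => ?_
  split_ifs with hB
  · linarith [hZ ω]
  · linarith [h ω hB]

theorem completeness {S : Setting} {F : NTCFData S} {G : TIFData S} (hFG : IsE2NTCF F G) :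
    ∃ (P : QPTAlg) (μ : ℕ → ℝ), Negligible μ ∧
      ∀ n, (1 + F.c) / 2 - μ n ≤ successQPT F G P n := by
  obtain ⟨hF, hG, hinv, -⟩ := hFG
  obtain ⟨DJ, hJ⟩ := hF.J_computable
  obtain ⟨DI, hI⟩ := hF.J_invertible
  obtain ⟨N, hN⟩ := hF.fraction
  obtain ⟨μH, nH, hH⟩ := hF.hellinger
  obtain ⟨μd, nd, hd⟩ := hF.dset_large
  obtain ⟨μs, ns, hs⟩ := hF.samp
  obtain ⟨μs', ns', hs'⟩ := hG.samp
  -- These are the error terms of the two tests, halved by the coin. The absolute values make the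
  -- error terms nonnegative, as `le_avg_of_good` needs its lower bound to be at most `1`.
  have hneg := ((((nH.abs.const_mul 2).add nd.abs).add (ns.const_mul 2).sqrt).add
    (hF.good.const_mul (1 / 2))).add ((ns'.const_mul 2).sqrt.add (hG.good.const_mul (1 / 2)))
  refine ⟨prover F DJ DI, _, hneg.ite_le N 1, fun n => ?_⟩
  have hnn : ∀ (k : Bits (S.nK n)) (E : Set (Message F n)),
      0 ≤ measureProb ((prover F DJ DI).state n (str k)) fun s => readMessage F n s ∈ E :=
    fun k E => measureProb_nonneg _ _
  rw [successQPT, acceptProb]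
  split_ifs with hle
  -- With error `1` the claim only needs a nonnegative success probability, because `(1 + c) / 2 ≤
  -- 1`.
  · have h₁ := le_avg_of_good (v := 0) (B := fun _ => False) zero_le_one
      (fun r : F.gen.alg.Coins n => hnn (F.gen.key n r).1 (eqTest F n (F.gen.key n r) (F.gen.trap n r)))
      fun r _ => hnn _ _
    have h₂ := le_avg_of_good (v := 0) (B := fun _ => False) zero_le_one
      (fun r : G.gen.alg.Coins n => hnn (G.gen.key n r).1 (imTest F G n (G.gen.key n r) (G.gen.trap n r)))
      fun r _ => hnn _ _
    have h₃ : ∀ (Ω : Type) [Fintype Ω], prob (fun _ : Ω => False) = 0 := fun Ω _ => by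
      simp [prob, avg]
    rw [h₃] at h₁ h₂
    linarith [hF.c_mem.2]
  · obtain ⟨hc, hX⟩ := hN n (not_le.1 hle)
    have h₁ := le_avg_of_good
      (v := F.c - 4 * |μH n| - 2 * |μd n| - 2 * Real.sqrt (2 * μs n))
      (B := fun r : F.gen.alg.Coins n => (F.gen.key n r, F.gen.trap n r) ∉ F.I n)
      (by linarith [hF.c_mem.2, abs_nonneg (μH n), abs_nonneg (μd n), Real.sqrt_nonneg (2 * μs n)])
      (fun r => hnn (F.gen.key n r).1 (eqTest F n (F.gen.key n r) (F.gen.trap n r))) fun r hr => by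
        have hr := not_not.1 hr
        refine le_trans (sub_le_sub_right ?_ _) (le_measureProb_prover DJ DI n _
          (F.fr n (F.gen.key n r)) (hs n (F.gen.key n r)) _)
        exact le_measureProb_eqTest hF hJ hI hr hc (fun x₀ x₁ h h' => (hX _ _ hr x₀ x₁ h).1 h')
          (fun b => (hH n _ b).trans (le_abs_self _)) fun b x => (hd n _ b x).trans (le_abs_self _)
    have h₂ := le_avg_of_good (v := 1 - 2 * Real.sqrt (2 * μs' n))
      (B := fun r : G.gen.alg.Coins n => (G.gen.key n r, G.gen.trap n r) ∉ G.I n)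
      (by linarith [Real.sqrt_nonneg (2 * μs' n)])
      (fun r => hnn (G.gen.key n r).1 (imTest F G n (G.gen.key n r) (G.gen.trap n r))) fun r hr => by
        refine le_trans (sub_le_sub_right (measureProb_imTest hG hJ hI (not_not.1 hr)).ge _)
          (le_measureProb_prover DJ DI n _ _ (fun b => ?_) _)
        -- `G` prepares its state from the padded bit and `F` from the bare bit. As wire assignments
        -- these inputs coincide, and so do the target states.
        have h := hs' n (G.gen.key n r) (G.bit n b)
        simp only [TIFData.bit, QPTAlg.state, Setting.rangeState,
          load_append_padBit _ (G.nB_pos n)] at h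
        rw [hinv.samp_eq]
        exact h
    linarith

end PoQ

theorem mainTheorem2 {S : PoQ.Setting} (F : PoQ.NTCFData S) (G : PoQ.TIFData S)
    (hFG : PoQ.IsE2NTCF F G) :
    (∃ (P : PoQ.QPTAlg) (μ : ℕ → ℝ), PoQ.Negligible μ ∧
      ∀ n, (1 + F.c) / 2 - μ n ≤ PoQ.successQPT F G P n) ∧
    (∀ A : PoQ.PPTAlg, ∃ μ : ℕ → ℝ, PoQ.Negligible μ ∧
      ∀ n, PoQ.successPPT F G A n ≤ 3 / 4 + μ n) :=
  ⟨PoQ.completeness hFG, PoQ.soundness hFG⟩
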